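/- Let $k\in\{0,1,2,\dots\}$. Let $L_0$ be the class of selfdecomposable probability measures on $\mathbb R$ (for every $c\in(0,1)$ one has $\nu=T_c\nu*\nu_c$ for some probability measure $\nu_c$, where $T_c\nu$ is the image of $\nu$ under $x\mapsto cx$), and let $L_k$, $k\ge 1$, be the class of those $\nu$ for which the $\nu_c$ can be chosen in $L_{k-1}$ for every $c\in(0,1)$. For an infinitely divisible $\nu$ with characteristic function $\phi_\nu$, a probability measure $\tilde\nu$ on $\mathbb R$ is the free-probability counterpart of $\nu$ if its Voiculescu transform $V_{\tilde\nu}(z)=F_{\tilde\nu}^{-1}(z)-z$ (with $F_{\tilde\nu}(z)=1/\int(z-x)^{-1}\,\tilde\nu(dx)$) extends analytically to the upper half-plane and $V_{\tilde\nu}(it)=it^2\int_0^\infty\log\phi_\nu(-u)\,e^{-tu}\,du$ for all $t>0$. Let $Li_{k+1}$ denote the analytic continuation to $\mathbb C\setminus[1,\infty)$ of $\sum_{n\ge1}z^n/n^{k+1}$, $|z|<1$. A probability measure $\tilde\nu$ on $\mathbb R$ is the free-probability counterpart of some $\nu\in L_k$ if and only if there are $a\in\mathbb R$, $\sigma^2\ge0$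 and a Lévy measure $M$ on $\mathbb R\setminus\{0\}$ with $\int_{|x|>1}\log^{k+1}(1+|x|)\,M(dx)<\infty$ such that $$V_{\tilde\nu}(it)=a+\frac1{2^{k+1}}\frac{\sigma^2}{it}+\int_{\mathbb R\setminus\{0\}}\Big(it\,Li_{k+1}\big(\tfrac{x}{it}\big)-\frac{x}{1+x^2}\Big)M(dx),\qquad t>0. \tag{1}$$ Here $a,\sigma^2,M$ are the parameters of the background driving measure of $\nu$: for every such triple, (1) holds if and only if $\tilde\nu$ is the free-probability counterpart of a measure $\nu\in L_k$ that is the law of $\int_{(0,\infty)}e^{-s}\,dY\big(s^{k+1}/(k+1)!\big)$, that is, $\log\phi_\nu(u)=\int_0^\infty\log\phi_\mu(e^{-s}u)\frac{s^k}{k!}\,ds$, where $Y$ is a Lévy process whose $Y(1)$ has the law $\mu=[a,\sigma^2,M]$ with $$\phi_\mu(u)=\exp\Big(iua-\tfrac12\sigma^2u^2+\int_{\mathbb R\setminus\{0\}}\big(e^{iux}-1-\tfrac{iux}{1+x^2}\big)M(dx)\Big).$$ Equivalently, there are $a\in\mathbb R$ and a finite Borel measure $m$ on $\mathbb R$ such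 that $$V_{\tilde\nu}(it)=a+\int_{\mathbb R}\Big[it\,Li_{k+1}\big(\tfrac{x}{it}\big)-\frac{x}{1+x^2}\Big]\frac{m(dx)}{\log^{k+1}(1+|x|^{2/(k+1)})},\qquad t>0, \tag{2}$$ where the integrand at $x=0$, including the factor $1/\log^{k+1}(1+|x|^{2/(k+1)})$, is equal to $\frac1{2^{k+1}}\frac1{it}$. The two forms correspond through $m(\{0\})=\sigma^2$ and $m(dx)=\log^{k+1}(1+|x|^{2/(k+1)})\,M(dx)$ on $\mathbb R\setminus\{0\}$: the measure $m$ so defined is finite if and only if $M$ is a Lévy measure with $\int_{|x|>1}\log^{k+1}(1+|x|)\,M(dx)<\infty$, and then the integrals in (1) and (2) converge absolutely and the right-hand sides agree for all $t>0$. -/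

import Mathlib

open MeasureTheory Set Filter
open scoped Topology

noncomputable section

/-! ### Classical infinite divisibility and Urbanik's classes -/

/-- The `n`-fold convolution power of a measure on `ℝ`. -/
def convPower (μ : Measure ℝ) : ℕ → Measure ℝ
  | 0 => Measure.dirac 0
  | n + 1 => (convPower μ n).conv μ

/-- `μ ∈ (ID, ∗)`: an infinitely divisible probability measure on `ℝ`. -/
def IsInfDivisible (μ : Measure ℝ) : Prop :=
  IsProbabilityMeasure μ ∧
    ∀ n : ℕ, 0 < n → ∃ μn : Measure ℝ, IsProbabilityMeasure μn ∧ convPower μn n = μ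

/-- `IsUrbanik k ν` says `ν ∈ (L_k, ∗)`, the class of `k`-times selfdecomposable measures.
`L_0` consists of the selfdecomposable probability measures: for every `c ∈ (0,1)` one has
`ν = T_c ν ∗ ν_c` for some probability measure `ν_c`; and `ν ∈ L_{k+1}` if these cofactors
`ν_c` can be found in `L_k`. Here `T_c ν` is the image of `ν` under `x ↦ c x`. -/
def IsUrbanik : ℕ → Measure ℝ → Prop
  | 0, ν => IsProbabilityMeasure ν ∧ ∀ c : ℝ, 0 < c → c < 1 →
      ∃ νc : Measure ℝ, IsProbabilityMeasure νc ∧ ν = (ν.map (fun x => c * x)).conv νc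
  | k + 1, ν => IsProbabilityMeasure ν ∧ ∀ c : ℝ, 0 < c → c < 1 →
      ∃ νc : Measure ℝ, IsUrbanik k νc ∧ ν = (ν.map (fun x => c * x)).conv νc

/-- `ψ = log φ_μ`: the continuous logarithm, vanishing at `0`, of the characteristic function
of `μ` (it exists and is unique when `μ` is infinitely divisible). -/
def IsCharExponent (μ : Measure ℝ) (ψ : ℝ → ℂ) : Prop :=
  Continuous ψ ∧ ψ 0 = 0 ∧ ∀ u : ℝ, charFun μ u = Complex.exp (ψ u)

/-- A Lévy (spectral) measure on `ℝ ∖ {0}`, seen as a measure on `ℝ` without mass at `0`. -/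
def IsLevyMeasure (M : Measure ℝ) : Prop :=
  M {0} = 0 ∧ ∫⁻ x, ENNReal.ofReal (min 1 (x ^ 2)) ∂M < ⊤

/-- `∫_{|x|>1} log^{k+1}(1+|x|) M(dx) < ∞`. -/
def HasLogMoment (k : ℕ) (M : Measure ℝ) : Prop :=
  ∫⁻ x in {x : ℝ | 1 < |x|}, ENNReal.ofReal (Real.log (1 + |x|) ^ (k + 1)) ∂M < ⊤

/-- `μ = [a, σ², M]`: the Lévy–Khintchine representation of `μ` (`v` stands for `σ²`). -/
def HasLevyTriplet (μ : Measure ℝ) (a v : ℝ) (M : Measure ℝ) : Prop :=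
  IsProbabilityMeasure μ ∧ 0 ≤ v ∧ IsLevyMeasure M ∧
    ∀ u : ℝ, charFun μ u = Complex.exp (Complex.I * u * a - (1 / 2) * v * u ^ 2 +
      ∫ x in ({0} : Set ℝ)ᶜ,
        (Complex.exp (Complex.I * u * x) - 1 - Complex.I * u * x / (1 + x ^ 2)) ∂M)

/-- `ν` is the law of the random integral `∫_{(0,∞)} e^{-s} dY(s^{k+1}/(k+1)!)` where `Y` is a
Lévy process with `Y(1)` distributed as `μ` (the background driving measure of `ν`). In terms of
laws: `log φ_ν(u) = ∫_0^∞ log φ_μ(e^{-s} u) s^k/k! ds`, an absolutely convergent integral. -/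
def IsRandomIntegralLaw (k : ℕ) (μ ν : Measure ℝ) : Prop :=
  IsProbabilityMeasure μ ∧ IsProbabilityMeasure ν ∧
    ∃ ψ χ : ℝ → ℂ, IsCharExponent μ ψ ∧ IsCharExponent ν χ ∧ ∀ u : ℝ,
      IntegrableOn (fun s : ℝ => ψ (Real.exp (-s) * u) * ((s ^ k / k.factorial : ℝ) : ℂ))
        (Ioi 0) ∧
      χ u = ∫ s in Ioi (0 : ℝ), ψ (Real.exp (-s) * u) * ((s ^ k / k.factorial : ℝ) : ℂ)

/-! ### Voiculescu transforms and free counterparts -/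

/-- The Cauchy transform `G_ρ(z) = ∫ (z - x)⁻¹ ρ(dx)`. -/
def cauchyTransform (ρ : Measure ℝ) (z : ℂ) : ℂ := ∫ x : ℝ, (z - x)⁻¹ ∂ρ

/-- The reciprocal Cauchy transform `F_ρ = 1 / G_ρ`. -/
def recipCauchy (ρ : Measure ℝ) (z : ℂ) : ℂ := (cauchyTransform ρ z)⁻¹

/-- The truncated cone `Γ_{α,β} = {z : Im z > β, |Re z| < α Im z}`. -/
def truncCone (α β : ℝ) : Set ℂ := {z | β < z.im ∧ |z.re| < α * z.im}

/-- `V` is the Voiculescu transform `V_ρ(z) = F_ρ^{-1}(z) - z` of `ρ`, continued analytically to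
the upper half-plane. The inverse is the branch with `F_ρ^{-1}(z) ~ z` on truncated cones, which
is the only inverse of `F_ρ` there with this asymptotics. -/
structure IsVoiculescuTransform (ρ : Measure ℝ) (V : ℂ → ℂ) : Prop where
  analytic : DifferentiableOn ℂ V {z | 0 < z.im}
  inverse : ∀ α : ℝ, 0 < α → ∃ β : ℝ, 0 < β ∧ ∀ z ∈ truncCone α β,
    0 < (z + V z).im ∧ recipCauchy ρ (z + V z) = z
  sublinear : ∀ α ε : ℝ, 0 < α → 0 < ε → ∃ β : ℝ, 0 < β ∧ ∀ z ∈ truncCone α β,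
    ‖V z‖ ≤ ε * ‖z‖

/-- `V_ρ(it) = f(t)` for all `t > 0`, where `V_ρ` is the Voiculescu transform of `ρ`. -/
def VoiculescuOnAxis (ρ : Measure ℝ) (f : ℝ → ℂ) : Prop :=
  ∃ V : ℂ → ℂ, IsVoiculescuTransform ρ V ∧ ∀ t : ℝ, 0 < t → V (Complex.I * t) = f t

/-- `ρ` is the free-probability counterpart of the infinitely divisible measure `ν`:
`V_ρ(it) = i t² ∫_0^∞ log φ_ν(-u) e^{-tu} du` for `t > 0`. -/
def IsFreeCounterpart (ρ ν : Measure ℝ) : Prop :=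
  IsInfDivisible ν ∧ ∃ ψ : ℝ → ℂ, IsCharExponent ν ψ ∧
    VoiculescuOnAxis ρ (fun t : ℝ =>
      Complex.I * (t : ℂ) ^ 2 * ∫ u in Ioi (0 : ℝ), ψ (-u) * Complex.exp (-(t * u)))

/-! ### The polylogarithm -/

/-- `polylogSucc k z = Li_{k+1}(z)`, given on `ℂ ∖ [1, ∞)` by its integral formula. The lemmas
`hasSum_polylogSucc` and `differentiableOn_polylogSucc` show that it is the analytic continuation
to that domain of `∑_{n ≥ 1} z^n / n^{k+1}`, `|z| < 1`. -/
def polylogSucc (k : ℕ) (z : ℂ) : ℂ :=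
  z * ∫ s in Ioi (0 : ℝ), ((s ^ k / k.factorial * Real.exp (-s) : ℝ) : ℂ) / (1 - z * Real.exp (-s))

theorem integrableOn_pow_mul_exp (k : ℕ) {r : ℝ} (hr : 0 < r) :
    IntegrableOn (fun s : ℝ => s ^ k * Real.exp (-(r * s))) (Ioi 0) ∧
    ∫ s in Ioi (0 : ℝ), s ^ k * Real.exp (-(r * s)) = k.factorial / r ^ (k + 1) := by
  have h := Real.integral_rpow_mul_exp_neg_mul_Ioi (a := (k : ℝ) + 1) (by positivity) hr
  simp only [add_sub_cancel_right, Real.rpow_natCast, Real.Gamma_nat_eq_factorial] at h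
  have e : ((1 / r) ^ ((k : ℝ) + 1) * k.factorial : ℝ) = k.factorial / r ^ (k + 1) := by
    have : ((k : ℝ) + 1) = ((k + 1 : ℕ) : ℝ) := by push_cast; ring
    rw [this, Real.rpow_natCast, div_pow, one_pow]
    field_simp
  rw [e] at h
  refine ⟨?_, h⟩
  by_contra hn
  rw [integral_undef hn] at h
  have : (0 : ℝ) < k.factorial / r ^ (k + 1) := by positivity
  exact this.ne h

theorem hasSum_polylogSucc (k : ℕ) {z : ℂ} (hz : ‖z‖ < 1) :
    HasSum (fun n : ℕ => z ^ (n + 1) / ((n : ℂ) + 1) ^ (k + 1)) (polylogSucc k z) := by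
  have hk : (0 : ℝ) < k.factorial := by positivity
  set F : ℕ → ℝ → ℂ := fun n s =>
    z ^ n / k.factorial * ((s ^ k * Real.exp (-((n + 1 : ℝ) * s)) : ℝ) : ℂ) with hF
  have hb (n : ℕ) := integrableOn_pow_mul_exp k (r := (n + 1 : ℝ)) (by positivity)
  have hint (n : ℕ) : IntegrableOn (F n) (Ioi 0) := ((hb n).1.ofReal).const_mul _
  have hnorm (n : ℕ) : ∫ s in Ioi (0 : ℝ), ‖F n s‖ = ‖z‖ ^ n / (n + 1 : ℝ) ^ (k + 1) := by
    have : ∫ s in Ioi (0 : ℝ), ‖F n s‖ = ∫ s in Ioi (0 : ℝ),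
        ‖z‖ ^ n / k.factorial * (s ^ k * Real.exp (-((n + 1 : ℝ) * s))) := by
      refine setIntegral_congr_fun measurableSet_Ioi fun s hs => ?_
      have hs' : (0 : ℝ) < s := hs
      simp only [hF, norm_mul, norm_div, norm_pow, Complex.norm_natCast, Complex.norm_real,
        Real.norm_eq_abs, abs_of_pos (Real.exp_pos _), abs_of_pos hs']
    rw [this, integral_const_mul, (hb n).2]
    field_simp
  have hval (n : ℕ) : ∫ s in Ioi (0 : ℝ), F n s = z ^ n / ((n : ℂ) + 1) ^ (k + 1) := by
    simp only [hF]
    rw [integral_const_mul, integral_complex_ofReal, (hb n).2]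
    have : (k.factorial : ℂ) ≠ 0 := by exact_mod_cast hk.ne'
    push_cast
    field_simp
  have hsum : Summable fun n => ∫ s in Ioi (0 : ℝ), ‖F n s‖ := by
    simp only [hnorm]
    refine Summable.of_nonneg_of_le (fun n => by positivity) (fun n => ?_)
      (summable_geometric_of_lt_one (norm_nonneg z) hz)
    exact div_le_self (by positivity) (one_le_pow₀ (by linarith [Nat.cast_nonneg (α := ℝ) n]))
  have key := hasSum_integral_of_summable_integral_norm hint hsum
  simp only [hval] at key
  have e : ∫ s in Ioi (0 : ℝ), ∑' n, F n s = ∫ s in Ioi (0 : ℝ),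
      ((s ^ k / k.factorial * Real.exp (-s) : ℝ) : ℂ) / (1 - z * Real.exp (-s)) := by
    refine setIntegral_congr_fun measurableSet_Ioi fun s hs => ?_
    have hs' : (0 : ℝ) < s := hs
    have h1 : ‖z * (Real.exp (-s) : ℂ)‖ < 1 := by
      rw [norm_mul, Complex.norm_real, Real.norm_eq_abs, abs_of_pos (Real.exp_pos _)]
      have : Real.exp (-s) ≤ 1 := Real.exp_le_one_iff.2 (by linarith)
      nlinarith [norm_nonneg z]
    have h2 (n : ℕ) : F n s = ((s ^ k / k.factorial * Real.exp (-s) : ℝ) : ℂ) *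
        (z * (Real.exp (-s) : ℂ)) ^ n := by
      have : Real.exp (-((n + 1 : ℝ) * s)) = Real.exp (-s) * Real.exp (-s) ^ n := by
        rw [← Real.exp_nat_mul, ← Real.exp_add]; congr 1; ring
      simp only [hF, this, mul_pow]
      push_cast
      ring
    simp only [h2]
    rw [tsum_mul_left, tsum_geometric_of_norm_lt_one h1]
    exact (div_eq_mul_inv _ _).symm
  rw [e] at key
  have := key.mul_left z
  simp only [polylogSucc]
  convert! this using 2 with n
  rw [pow_succ']; ring

theorem differentiableOn_polylogSucc (k : ℕ) :
    DifferentiableOn ℂ (polylogSucc k) {z | 1 - z ∈ Complex.slitPlane} := by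
  intro z₀ hz₀
  have hopen : IsOpen {z : ℂ | 1 - z ∈ Complex.slitPlane} :=
    Complex.isOpen_slitPlane.preimage (by fun_prop)
  obtain ⟨ε, hε, hball⟩ := Metric.nhds_basis_closedBall.mem_iff.1 (hopen.mem_nhds hz₀)
  have hne : ∀ z ∈ Metric.closedBall z₀ ε, ∀ r ∈ Icc (0 : ℝ) 1, (1 - z * r : ℂ) ≠ 0 := by
    intro z hz r hr h
    have hz' := hball hz
    simp only [mem_ofPred_eq, Complex.mem_slitPlane_iff, Complex.sub_re, Complex.one_re,
      Complex.sub_im, Complex.one_im] at hz'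
    have hre := congrArg Complex.re h
    have him := congrArg Complex.im h
    simp at hre him
    have hr0 : r ≠ 0 := by rintro rfl; simp at hre
    have him' : z.im = 0 := by tauto
    rcases hz' with h1 | h1
    · nlinarith [hr.1, hr.2, lt_of_le_of_ne hr.1 hr0.symm]
    · exact h1 (by simp [him'])
  obtain ⟨δ, hδ, hδb⟩ : ∃ δ : ℝ, 0 < δ ∧ ∀ z ∈ Metric.closedBall z₀ ε, ∀ r ∈ Icc (0 : ℝ) 1,
      δ ≤ ‖(1 - z * r : ℂ)‖ := by
    have hc : IsCompact (Metric.closedBall z₀ ε ×ˢ Icc (0 : ℝ) 1) :=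
      (isCompact_closedBall z₀ ε).prod isCompact_Icc
    have hn : (Metric.closedBall z₀ ε ×ˢ Icc (0 : ℝ) 1).Nonempty :=
      ⟨(z₀, 0), Metric.mem_closedBall_self hε.le, by simp⟩
    obtain ⟨p, hp, hmin⟩ := hc.exists_isMinOn hn
      (f := fun p : ℂ × ℝ => ‖(1 - p.1 * p.2 : ℂ)‖) (by fun_prop)
    exact ⟨_, norm_pos_iff.2 (hne p.1 hp.1 p.2 hp.2), fun z hz r hr => hmin (mk_mem_prod hz hr)⟩
  have hexp : ∀ s ∈ Ioi (0 : ℝ), Real.exp (-s) ∈ Icc (0 : ℝ) 1 := fun s hs =>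
    ⟨(Real.exp_pos _).le, Real.exp_le_one_iff.2 (by have : (0 : ℝ) < s := hs; linarith)⟩
  have hb1 := (integrableOn_pow_mul_exp k (r := 1) one_pos).1
  simp only [one_mul] at hb1
  set w : ℝ → ℂ := fun s => ((s ^ k / k.factorial * Real.exp (-s) : ℝ) : ℂ) with hw
  have hwint : IntegrableOn (fun s => ‖w s‖) (Ioi 0) := by
    have : IntegrableOn w (Ioi 0) := by
      refine IntegrableOn.congr_fun (hb1.ofReal.const_mul ((k.factorial : ℂ)⁻¹)) ?_
        measurableSet_Ioi
      intro s _
      simp only [hw, RCLike.ofReal_eq_complex_ofReal]; push_cast; ring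
    exact this.norm
  have hwc : Measurable w := by
    have : Continuous w := by fun_prop
    exact this.measurable
  have hmeas (z : ℂ) : AEStronglyMeasurable (fun s : ℝ => w s / (1 - z * Real.exp (-s)))
      (volume.restrict (Ioi 0)) := by
    refine Measurable.aestronglyMeasurable (hwc.div ?_)
    have : Continuous fun s : ℝ => (1 - z * Real.exp (-s) : ℂ) := by fun_prop
    exact this.measurable
  have main := hasDerivAt_integral_of_dominated_loc_of_deriv_le
    (μ := volume.restrict (Ioi (0 : ℝ))) (𝕜 := ℂ) (x₀ := z₀)
    (F := fun z s => w s / (1 - z * Real.exp (-s)))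
    (F' := fun z s => w s * Real.exp (-s) / (1 - z * Real.exp (-s)) ^ 2)
    (bound := fun s => ‖w s‖ * (1 / δ ^ 2))
    (Metric.closedBall_mem_nhds z₀ hε) (Eventually.of_forall hmeas) ?_ ?_ ?_
    (hwint.mul_const _) ?_
  · exact (differentiableAt_id.mul main.2.differentiableAt).differentiableWithinAt
  · refine (hwint.mul_const (1 / δ)).mono' (hmeas z₀) ?_
    filter_upwards [ae_restrict_mem measurableSet_Ioi] with s hs
    rw [norm_div, div_eq_mul_one_div]
    gcongr
    exact hδb z₀ (Metric.mem_closedBall_self hε.le) _ (hexp s hs)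
  · refine Measurable.aestronglyMeasurable ((hwc.mul ?_).div ?_)
    · have : Continuous fun s : ℝ => (Real.exp (-s) : ℂ) := by fun_prop
      exact this.measurable
    · have : Continuous fun s : ℝ => (1 - z₀ * Real.exp (-s) : ℂ) ^ 2 := by fun_prop
      exact this.measurable
  · filter_upwards [ae_restrict_mem measurableSet_Ioi] with s hs z hz
    have h1 := hδb z hz _ (hexp s hs)
    rw [norm_div, norm_mul, norm_pow, div_eq_mul_one_div]
    gcongr
    refine mul_le_of_le_one_right (norm_nonneg _) ?_
    rw [Complex.norm_real, Real.norm_eq_abs, abs_of_pos (Real.exp_pos _)]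
    exact (hexp s hs).2
  · filter_upwards [ae_restrict_mem measurableSet_Ioi] with s hs z hz
    have h1 := hne z hz _ (hexp s hs)
    have h2 : HasDerivAt (fun z : ℂ => 1 - z * (Real.exp (-s) : ℂ)) (-(Real.exp (-s) : ℂ)) z := by
      simpa using ((hasDerivAt_id z).mul_const (Real.exp (-s) : ℂ)).const_sub 1
    have h3 := (hasDerivAt_const z (w s)).div h2 h1
    convert! h3 using 1
    ring

/-! ### The integral representations -/

/-- The kernel `it Li_{k+1}(x/(it)) - x/(1+x²)`. -/
def polylogKernel (k : ℕ) (t x : ℝ) : ℂ :=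
  Complex.I * t * polylogSucc k (x / (Complex.I * t)) - x / (1 + x ^ 2)

/-- `a + 2^{-(k+1)} σ²/(it) + ∫_{ℝ∖{0}} (it Li_{k+1}(x/(it)) - x/(1+x²)) M(dx)`, `v = σ²`. -/
def levyForm (k : ℕ) (a v : ℝ) (M : Measure ℝ) (t : ℝ) : ℂ :=
  a + 1 / 2 ^ (k + 1) * (v / (Complex.I * t)) + ∫ x in ({0} : Set ℝ)ᶜ, polylogKernel k t x ∂M

/-- The weight `log^{k+1}(1 + |x|^{2/(k+1)})`. -/
def logWeight (k : ℕ) (x : ℝ) : ℝ :=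
  Real.log (1 + |x| ^ ((2 : ℝ) / ((k : ℝ) + 1))) ^ (k + 1)

/-- The kernel divided by the weight, with the value `2^{-(k+1)}/(it)` at `x = 0`. -/
def weightedKernel (k : ℕ) (t x : ℝ) : ℂ :=
  if x = 0 then 1 / 2 ^ (k + 1) * (1 / (Complex.I * t)) else polylogKernel k t x / logWeight k x

/-- `a + ∫_ℝ [it Li_{k+1}(x/(it)) - x/(1+x²)] m(dx) / log^{k+1}(1 + |x|^{2/(k+1)})`. -/
def weightedForm (k : ℕ) (a : ℝ) (m : Measure ℝ) (t : ℝ) : ℂ :=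
  a + ∫ x, weightedKernel k t x ∂m

end

/-! Let J be the operator (Jf)(u) = ∫_0^∞ f(e^{-s}u) ds. Its power J^{k+1} averages f(e^{-s}u)
against the Erlang density s^k/k!; in the code `erlangMean (k + 1)` is J^{k+1}, and `lkExp a v M` is
the Lévy–Khintchine exponent ψ of [a, v, M]. The theorem reduces to two facts: the exponents of the
measures in L_k that possess one are exactly the functions J^{k+1}ψ with M satisfying the
logarithmic moment condition, and the transform f ↦ it² ∫_0^∞ f(-u) e^{-tu} du sends J^{k+1}ψ to the
right-hand side of (1). The Voiculescu transform matters only through its values on the imaginary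
axis, so none of its analytic properties is needed.

Integrability is governed by the single quantity ∫∫ min(1, e^{-s}x²) dErlang(s) M(dx)
(`HasTimeMoment`). It is comparable with ∫ (min(1, x²) + 1_{|x|>1} log^{k+1}(1+|x|)) M(dx), hence
with the total mass of the weighted measure in (2). It dominates the Lévy–Khintchine kernel jointly
in x and s, which justifies every use of Fubini.

From J^{k+1}ψ to L_k (`isUrbanik_of_charFun_eq`): for c = e^{-T} and χ = J^{k+1}ψ the increment χ(u)
- χ(cu) is the integral of J^kψ(e^{-s}u) over 0 < s ≤ T. This is J^k of another Lévy–Khintchine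
exponent, because averages over dilations commute and preserve such exponents. So the cofactor
exists and induction on k applies.

From L_k to J^{k+1}ψ (`IsUrbanik.exists_eq_erlangMean`): the cofactors for c = e^{-1/(n+1)} have
exponents χ(u) - χ(cu). Multiplied by n+1 these converge along a subsequence to a Lévy–Khintchine
exponent ψ₀ (`exists_lkExp_of_cofactors`): centre the cofactors Q_n so that a truncated mean
vanishes, and extract a weak limit of the finite measures (n+1) min(1, x²) dQ_n. No derivative of χ
is assumed; averaging over frequencies turns continuity of χ into the required mass and tail bounds.
Integrating ψ₀ along dilations gives back the increments of χ. For k ≥ 1 the law with exponent ψ₀ is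
a limit of convolution powers of cofactors in L_{k-1}, so ψ₀ = J^kψ by induction. Boundedness of χ
near 0 then supplies the missing power of the logarithm (`HasTimeMoment.succ_of_increments`), and
continuity at 0 gives χ = J^{k+1}ψ.

The transform itself (`HasTimeMoment.free_transform_eq`) is Fubini and a Laplace integral: a kernel
dilated by e^{-s} becomes a rational function of e^{-s}x, whose Erlang average is the integral
formula for Li_{k+1}. The drift keeps its value since e^{-s} has Erlang mean 1, and the Gaussian
term acquires the mean 2^{-(k+1)} of e^{-2s}. -/

noncomputable section

/-! ### The Lévy–Khintchine kernel -/

/-- The integrand of the Lévy–Khintchine representation. -/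
def lkKernel (u x : ℝ) : ℂ :=
  Complex.exp (Complex.I * u * x) - 1 - Complex.I * u * x / (1 + x ^ 2)

/-- The Lévy–Khintchine exponent of the triple `(a, v, M)`. -/
def lkExp (a v : ℝ) (M : Measure ℝ) (u : ℝ) : ℂ :=
  Complex.I * u * a - (1 / 2) * v * u ^ 2 + ∫ x in ({0} : Set ℝ)ᶜ, lkKernel u x ∂M

theorem one_add_sq_ne_zero (x : ℝ) : (1 + (x : ℂ) ^ 2) ≠ 0 := by
  have : (1 + x ^ 2 : ℝ) ≠ 0 := by positivity
  exact_mod_cast this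

theorem continuous_lkKernel : Continuous fun p : ℝ × ℝ => lkKernel p.1 p.2 := by
  unfold lkKernel
  refine Continuous.sub (by fun_prop) (Continuous.div (by fun_prop) (by fun_prop) fun p => ?_)
  exact one_add_sq_ne_zero p.2

theorem lkKernel_zero_left (x : ℝ) : lkKernel 0 x = 0 := by simp [lkKernel]

theorem lkKernel_re (u x : ℝ) : (lkKernel u x).re = Real.cos (u * x) - 1 := by
  have h1 : Complex.exp (Complex.I * u * x) = Complex.exp ((u * x : ℝ) * Complex.I) := by
    congr 1; push_cast; ring
  have h2 : Complex.I * u * x / (1 + (x : ℂ) ^ 2) = ((u * x / (1 + x ^ 2) : ℝ) : ℂ) * Complex.I := by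
    push_cast; ring
  rw [lkKernel, h1, h2, Complex.sub_re, Complex.sub_re, Complex.exp_ofReal_mul_I_re,
    Complex.re_ofReal_mul]
  simp

theorem norm_exp_I_mul_sub_one_le_two (z : ℝ) : ‖Complex.exp (Complex.I * z) - 1‖ ≤ 2 := by
  refine (norm_sub_le _ _).trans ?_
  rw [mul_comm, Complex.norm_exp_ofReal_mul_I]; norm_num

theorem norm_exp_I_mul_sub_one_sub_le (z : ℝ) :
    ‖Complex.exp (Complex.I * z) - 1 - Complex.I * z‖ ≤ 3 * z ^ 2 := by
  have hn : ‖Complex.I * (z : ℂ)‖ = |z| := by simp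
  rcases le_or_gt |z| 1 with h | h
  · have := Complex.norm_exp_sub_one_sub_id_le (x := Complex.I * z) (by rw [hn]; exact h)
    rw [hn, sq_abs] at this
    nlinarith [sq_nonneg z]
  · refine (norm_sub_le _ _).trans ?_
    rw [hn]
    have := norm_exp_I_mul_sub_one_le_two z
    rw [← sq_abs z]
    nlinarith

/-- The bound is used with e = e^{-s}. It is linear in e, not quadratic, because the compensator is
linear in the frequency: near x = 0 it leaves a remainder of size e|u||x|³, and for large x it is of
size e|u|/|x|. -/
theorem norm_lkKernel_le {e : ℝ} (he : 0 ≤ e) (he1 : e ≤ 1) (u x : ℝ) :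
    ‖lkKernel (e * u) x‖ ≤ 4 * (1 + u ^ 2) * min 1 (e * x ^ 2) := by
  have hx2 : 0 < 1 + x ^ 2 := by positivity
  have hcast : ∀ y : ℝ, Complex.I * y * x / (1 + (x : ℂ) ^ 2) =
      Complex.I * ((y * x / (1 + x ^ 2) : ℝ) : ℂ) := by intro y; push_cast; ring
  have hcast2 : ∀ y : ℝ, Complex.I * (y : ℂ) * x = Complex.I * ((y * x : ℝ) : ℂ) := by
    intro y; push_cast; ring
  have hI : ∀ y : ℝ, ‖Complex.I * (y : ℂ)‖ = |y| := by intro y; simp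
  have hu : |u| ≤ 1 + u ^ 2 := by rw [← sq_abs u]; nlinarith [sq_nonneg (|u| - 1), abs_nonneg u]
  have hu0 := abs_nonneg u
  rcases le_or_gt |x| 1 with h | h
  · have hxx : x ^ 2 ≤ 1 := by rw [← sq_abs]; nlinarith [abs_nonneg x]
    have hmin : min 1 (e * x ^ 2) = e * x ^ 2 := min_eq_right (by nlinarith [sq_nonneg x])
    rw [hmin]
    have key : lkKernel (e * u) x = (Complex.exp (Complex.I * ((e * u * x : ℝ) : ℂ)) - 1 -
        Complex.I * ((e * u * x : ℝ) : ℂ)) + Complex.I * ((e * u * x * (x ^ 2 / (1 + x ^ 2)) : ℝ) : ℂ) := by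
      have := one_add_sq_ne_zero x
      rw [lkKernel, hcast, hcast2]
      push_cast
      field_simp
      ring
    rw [key]
    refine (norm_add_le _ _).trans ?_
    have h1 := norm_exp_I_mul_sub_one_sub_le (e * u * x)
    have h2 : |e * u * x * (x ^ 2 / (1 + x ^ 2))| ≤ e * |u| * x ^ 2 := by
      rw [abs_mul, abs_mul, abs_mul, abs_of_nonneg he, abs_of_nonneg (by positivity : 0 ≤ x ^ 2 / (1 + x ^ 2))]
      have h3 : x ^ 2 / (1 + x ^ 2) ≤ x ^ 2 := div_le_self (by positivity) (by nlinarith [sq_nonneg x])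
      calc e * |u| * |x| * (x ^ 2 / (1 + x ^ 2)) ≤ e * |u| * 1 * x ^ 2 := by gcongr
        _ = _ := by ring
    rw [hI]
    have h4 : (e * u * x) ^ 2 ≤ e * u ^ 2 * x ^ 2 := by
      have : e ^ 2 ≤ e := by nlinarith
      calc (e * u * x) ^ 2 = e ^ 2 * (u ^ 2 * x ^ 2) := by ring
        _ ≤ e * (u ^ 2 * x ^ 2) := by gcongr
        _ = _ := by ring
    have h5 : e * |u| * x ^ 2 ≤ e * (1 + u ^ 2) * x ^ 2 := by gcongr
    have h6 : 0 ≤ e * x ^ 2 := by positivity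
    nlinarith
  · have hx1 : 1 ≤ x ^ 2 := by rw [← sq_abs]; nlinarith
    have hxx : |x| ≤ x ^ 2 := by rw [← sq_abs x]; nlinarith
    have h1 : ‖lkKernel (e * u) x‖ ≤ ‖Complex.exp (Complex.I * ((e * u * x : ℝ) : ℂ)) - 1‖ + e * |u| := by
      rw [lkKernel, hcast, hcast2]
      refine (norm_sub_le _ _).trans ?_
      gcongr
      rw [hI, abs_div, abs_of_pos hx2, div_le_iff₀ hx2, abs_mul, abs_mul, abs_of_nonneg he]
      have : 0 ≤ e * |u| := by positivity
      nlinarith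
    rcases min_choice 1 (e * x ^ 2) with hm | hm <;> rw [hm]
    · have := norm_exp_I_mul_sub_one_le_two (e * u * x)
      have : e * |u| ≤ |u| := by nlinarith
      nlinarith [sq_nonneg u]
    · have h2 : ‖Complex.exp (Complex.I * ((e * u * x : ℝ) : ℂ)) - 1‖ ≤ e * |u| * x ^ 2 := by
        refine Real.norm_exp_I_mul_ofReal_sub_one_le.trans ?_
        rw [Real.norm_eq_abs, abs_mul, abs_mul, abs_of_nonneg he]
        gcongr
      have h3 : e * |u| ≤ e * |u| * x ^ 2 := le_mul_of_one_le_right (by positivity) hx1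
      have h5 : e * |u| * x ^ 2 ≤ e * (1 + u ^ 2) * x ^ 2 := by gcongr
      have h6 : 0 ≤ e * (1 + u ^ 2) * x ^ 2 := by positivity
      nlinarith

theorem norm_lkKernel_le' (u x : ℝ) : ‖lkKernel u x‖ ≤ 4 * (1 + u ^ 2) * min 1 (x ^ 2) := by
  simpa using norm_lkKernel_le zero_le_one le_rfl u x

/-- This difference is the drift created when a dilation is moved from the frequency u to the jump
size x. -/
theorem abs_compensator_sub_le {e : ℝ} (he : 0 ≤ e) (he1 : e ≤ 1) (x : ℝ) :
    |e * x / (1 + (e * x) ^ 2) - e * x / (1 + x ^ 2)| ≤ 2 * min 1 (e * x ^ 2) := by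
  have hx2 : 0 < 1 + x ^ 2 := by positivity
  have hex2 : 0 < 1 + (e * x) ^ 2 := by positivity
  rcases le_or_gt |x| 1 with h | h
  · have hxx : x ^ 2 ≤ 1 := by rw [← sq_abs]; nlinarith [abs_nonneg x]
    have hmin : min 1 (e * x ^ 2) = e * x ^ 2 := min_eq_right (by nlinarith [sq_nonneg x])
    have key : e * x / (1 + (e * x) ^ 2) - e * x / (1 + x ^ 2) =
        e * x * (x ^ 2 * (1 - e ^ 2)) / ((1 + (e * x) ^ 2) * (1 + x ^ 2)) := by field_simp; ring
    have he2 : 0 ≤ 1 - e ^ 2 := by nlinarith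
    rw [hmin, key, abs_div, abs_of_pos (by positivity : 0 < (1 + (e * x) ^ 2) * (1 + x ^ 2)), abs_mul,
      abs_mul, abs_of_nonneg he, abs_of_nonneg (by positivity : 0 ≤ x ^ 2 * (1 - e ^ 2))]
    refine (div_le_self (by positivity) ?_).trans ?_
    · nlinarith [sq_nonneg (e * x), sq_nonneg x, mul_nonneg (sq_nonneg (e * x)) (sq_nonneg x)]
    · calc e * |x| * (x ^ 2 * (1 - e ^ 2)) ≤ e * 1 * (x ^ 2 * 1) := by
            gcongr; nlinarith [sq_nonneg e]
        _ ≤ _ := by nlinarith [mul_nonneg he (sq_nonneg x)]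
  · have hx1 : 1 ≤ x ^ 2 := by rw [← sq_abs]; nlinarith
    have hxx : |x| ≤ x ^ 2 := by rw [← sq_abs x]; nlinarith
    have h1 : |e * x / (1 + (e * x) ^ 2)| ≤ min 1 (e * x ^ 2) := by
      rw [abs_div, abs_of_pos hex2]
      refine le_min ?_ ?_
      · rw [div_le_one hex2, ← sq_abs (e * x)]
        nlinarith [sq_nonneg (|e * x| - 1), abs_nonneg (e * x)]
      · refine (div_le_self (abs_nonneg _) (by nlinarith [sq_nonneg (e * x)])).trans ?_
        rw [abs_mul, abs_of_nonneg he]; gcongr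
    have h2 : |e * x / (1 + x ^ 2)| ≤ min 1 (e * x ^ 2) := by
      rw [abs_div, abs_of_pos hx2, abs_mul, abs_of_nonneg he]
      refine le_min ?_ ?_
      · rw [div_le_one hx2]; nlinarith [abs_nonneg x]
      · refine (div_le_self (by positivity) (by nlinarith)).trans ?_
        gcongr
    have h3 : ∀ p q : ℝ, |p - q| ≤ |p| + |q| := fun p q => abs_sub p q
    linarith [h3 (e * x / (1 + (e * x) ^ 2)) (e * x / (1 + x ^ 2))]

theorem integral_one_sub_cos_mul {y : ℝ} (hy : y ≠ 0) :
    ∫ u in (0 : ℝ)..1, (1 - Real.cos (u * y)) = 1 - Real.sin y / y := by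
  rw [intervalIntegral.integral_sub (by simp) (by apply Continuous.intervalIntegrable; fun_prop),
    intervalIntegral.integral_comp_mul_right _ hy]
  simp [div_eq_inv_mul]

/-- This converts bounds on characteristic functions into bounds on truncated second moments and
tails. For |y| ≤ 2 one has 1 - cos θ ≥ (2/π²)θ² ≥ θ²/5, and ∫_0^1 u² du = 1/3 produces the 15; for
|y| > 2 the average 1 - sin y / y is at least 1/2. -/
theorem min_one_sq_le_integral_one_sub_cos (y : ℝ) :
    min 1 (y ^ 2) ≤ 15 * ∫ u in (0 : ℝ)..1, (1 - Real.cos (u * y)) := by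
  rcases le_or_gt |y| 2 with h | h
  · refine (min_le_right _ _).trans ?_
    have h1 : ∫ u in (0 : ℝ)..1, (y ^ 2 / 5) * u ^ 2 ≤ ∫ u in (0 : ℝ)..1, (1 - Real.cos (u * y)) := by
      refine intervalIntegral.integral_mono_on zero_le_one
        (by apply Continuous.intervalIntegrable; fun_prop)
        (by apply Continuous.intervalIntegrable; fun_prop) fun u hu => ?_
      have hle : |u * y| ≤ Real.pi := by
        rw [abs_mul, abs_of_nonneg hu.1]
        nlinarith [hu.2, abs_nonneg y, Real.pi_gt_three]
      have hcos := Real.cos_le_one_sub_mul_cos_sq hle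
      have hpi : 1 / 5 ≤ 2 / Real.pi ^ 2 := by
        rw [div_le_div_iff₀ (by norm_num) (by positivity)]
        nlinarith [Real.pi_lt_d2, Real.pi_gt_three]
      have : 1 / 5 * (u * y) ^ 2 ≤ 2 / Real.pi ^ 2 * (u * y) ^ 2 := by gcongr
      nlinarith
    rw [intervalIntegral.integral_const_mul, integral_pow] at h1
    norm_num at h1
    linarith
  · refine (min_le_left _ _).trans ?_
    have hy : y ≠ 0 := by rintro rfl; norm_num at h
    rw [integral_one_sub_cos_mul hy]
    have : Real.sin y / y ≤ 1 / 2 := by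
      refine (le_abs_self _).trans ?_
      rw [abs_div, div_le_iff₀ (by positivity)]
      linarith [Real.abs_sin_le_one y]
    linarith

/-! ### Erlang measures -/

/-- The convolution powers of Lebesgue measure on `(0, ∞)`. -/
def erlang : ℕ → Measure ℝ
  | 0 => Measure.dirac 0
  | k + 1 => (volume.restrict (Ioi (0 : ℝ))).conv (erlang k)

instance sFinite_erlang (k : ℕ) : SFinite (erlang k) := by
  induction k with
  | zero => unfold erlang; infer_instance
  | succ k ih => unfold erlang; infer_instance

theorem lintegral_erlang_zero (f : ℝ → ENNReal) : ∫⁻ s, f s ∂erlang 0 = f 0 := by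
  simp [erlang]

theorem lintegral_erlang_succ (k : ℕ) {f : ℝ → ENNReal} (hf : Measurable f) :
    ∫⁻ s, f s ∂erlang (k + 1) = ∫⁻ s in Ioi (0 : ℝ), ∫⁻ r, f (s + r) ∂erlang k := by
  rw [erlang, Measure.lintegral_conv hf]

theorem setLIntegral_Ioi_comp_add (s : ℝ) (f : ℝ → ENNReal) :
    ∫⁻ r in Ioi (0 : ℝ), f (s + r) = ∫⁻ q in Ioi s, f q := by
  rw [← lintegral_indicator measurableSet_Ioi, ← lintegral_indicator measurableSet_Ioi,
    ← lintegral_add_left_eq_self ((Ioi s).indicator f) s]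
  refine lintegral_congr fun r => ?_
  simp [indicator]

/-- Convolving with Lebesgue measure on the half-line integrates the density over (0, q), turning
s^k/k! into q^{k+1}/(k+1)!. The convolution form drives the inductions; the density matches the
random integral and the polylogarithm. -/
theorem erlang_succ_eq_withDensity (k : ℕ) :
    erlang (k + 1) = (volume.restrict (Ioi (0 : ℝ))).withDensity
      (fun s => ENNReal.ofReal (s ^ k / k.factorial)) := by
  induction k with
  | zero =>
    simp only [erlang, Measure.conv_dirac_zero, pow_zero, Nat.factorial_zero, Nat.cast_one,
      div_one, ENNReal.ofReal_one]
    exact withDensity_one.symm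
  | succ k ih =>
    refine Measure.ext_of_lintegral _ fun f hf => ?_
    have hm : Measurable fun p : ℝ × ℝ => (Ioi p.1).indicator
        (fun q => ENNReal.ofReal (p.1 ^ k / k.factorial) * f q) p.2 := by
      have : (fun p : ℝ × ℝ => (Ioi p.1).indicator
        (fun q => ENNReal.ofReal (p.1 ^ k / k.factorial) * f q) p.2) = {p : ℝ × ℝ | p.1 < p.2}.indicator
          (fun p => ENNReal.ofReal (p.1 ^ k / k.factorial) * f p.2) := by
        ext p; simp [indicator]
      rw [this]
      exact (by fun_prop : Measurable fun p : ℝ × ℝ => _).indicator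
        (measurableSet_lt measurable_fst measurable_snd)
    have hvol : (volume.restrict (Ioi (0 : ℝ))).withDensity (fun _ => (1 : ENNReal)) =
      volume.restrict (Ioi (0 : ℝ)) := withDensity_one
    have hcomm : erlang (k + 1 + 1) = (erlang (k + 1)).conv (volume.restrict (Ioi (0 : ℝ))) := by
      conv_lhs => rw [erlang]
      rw [Measure.conv_comm]
    rw [hcomm, Measure.lintegral_conv hf, ih,
      lintegral_withDensity_eq_lintegral_mul _ (by fun_prop)
        (by exact Measurable.lintegral_prod_right' (f := fun p : ℝ × ℝ => f (p.1 + p.2)) (by fun_prop)),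
      lintegral_withDensity_eq_lintegral_mul _ (by fun_prop) hf]
    calc ∫⁻ s in Ioi (0 : ℝ), ((fun s => ENNReal.ofReal (s ^ k / k.factorial)) *
            fun x => ∫⁻ y in Ioi (0 : ℝ), f (x + y)) s
        = ∫⁻ s in Ioi (0 : ℝ), ∫⁻ q in Ioi (0 : ℝ), (Ioi s).indicator
            (fun q => ENNReal.ofReal (s ^ k / k.factorial) * f q) q := by
          refine setLIntegral_congr_fun measurableSet_Ioi fun s hs => ?_
          simp only [Pi.mul_apply]
          rw [lintegral_indicator measurableSet_Ioi, Measure.restrict_restrict measurableSet_Ioi,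
            inter_eq_left.2 (Ioi_subset_Ioi (le_of_lt hs)), setLIntegral_Ioi_comp_add,
            lintegral_const_mul _ hf]
      _ = ∫⁻ q in Ioi (0 : ℝ), ∫⁻ s in Ioi (0 : ℝ), (Ioi s).indicator
            (fun q => ENNReal.ofReal (s ^ k / k.factorial) * f q) q :=
          lintegral_lintegral_swap hm.aemeasurable
      _ = _ := by
          refine setLIntegral_congr_fun measurableSet_Ioi fun q hq => ?_
          have hq' : (0 : ℝ) < q := hq
          have : ∀ s, (Ioi s).indicator (fun q => ENNReal.ofReal (s ^ k / k.factorial) * f q) q =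
              (Iio q).indicator (fun s => ENNReal.ofReal (s ^ k / k.factorial)) s * f q := by
            intro s; by_cases h : s < q <;> simp [indicator, h]
          simp only [this, Pi.mul_apply]
          rw [lintegral_mul_const _ ((by fun_prop : Measurable _).indicator measurableSet_Iio),
            lintegral_indicator measurableSet_Iio, Measure.restrict_restrict measurableSet_Iio]
          congr 1
          have hset : Iio q ∩ Ioi 0 = Ioo 0 q := by ext; simp [and_comm]
          rw [hset, restrict_Ioo_eq_restrict_Ioc, ← ofReal_integral_eq_lintegral_ofReal
            (by
              rw [← IntegrableOn, ← intervalIntegrable_iff_integrableOn_Ioc_of_le hq'.le]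
              apply Continuous.intervalIntegrable; fun_prop)
            (by
              filter_upwards [ae_restrict_mem measurableSet_Ioc] with s hs
              have := hs.1
              positivity),
            ← intervalIntegral.integral_of_le hq'.le, intervalIntegral.integral_div, integral_pow]
          congr 1
          rw [Nat.factorial_succ]; push_cast
          field_simp; simp

theorem ae_erlang_nonneg (k : ℕ) : ∀ᵐ s ∂erlang k, 0 ≤ s := by
  cases k with
  | zero => rw [erlang, ae_dirac_iff measurableSet_Ici]
  | succ k =>
    rw [erlang_succ_eq_withDensity]
    refine (withDensity_absolutelyContinuous _ _).ae_le ?_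
    filter_upwards [ae_restrict_mem measurableSet_Ioi] with s hs using le_of_lt hs

theorem integral_erlang_succ {E : Type*} [NormedAddCommGroup E] [NormedSpace ℝ E] (k : ℕ)
    (f : ℝ → E) :
    ∫ s, f s ∂erlang (k + 1) = ∫ s in Ioi (0 : ℝ), (s ^ k / k.factorial) • f s := by
  rw [erlang_succ_eq_withDensity, integral_withDensity_eq_integral_toReal_smul (by fun_prop) (by simp)]
  refine setIntegral_congr_fun measurableSet_Ioi fun s hs => ?_
  have : (0 : ℝ) < s := hs
  rw [ENNReal.toReal_ofReal (by positivity)]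

theorem integrable_erlang_succ_iff {E : Type*} [NormedAddCommGroup E] [NormedSpace ℝ E] (k : ℕ)
    (f : ℝ → E) :
    Integrable f (erlang (k + 1)) ↔
      IntegrableOn (fun s : ℝ => (s ^ k / k.factorial : ℝ) • f s) (Ioi (0 : ℝ)) := by
  rw [erlang_succ_eq_withDensity, integrable_withDensity_iff_integrable_smul' (by fun_prop) (by simp)]
  refine integrableOn_congr_fun (fun s (hs : s ∈ Ioi (0 : ℝ)) => ?_) measurableSet_Ioi
  have : (0 : ℝ) < s := hs
  rw [ENNReal.toReal_ofReal (by positivity)]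

/-- Laplace transforms multiply under convolution. The values r = 1 and r = 2 later give the factors
1 and 2^{-k} on the drift and the Gaussian part. -/
theorem lintegral_erlang_exp (k : ℕ) {r : ℝ} (hr : 0 < r) :
    ∫⁻ s, ENNReal.ofReal (Real.exp (-(r * s))) ∂erlang k = ENNReal.ofReal (1 / r ^ k) := by
  induction k with
  | zero => simp [lintegral_erlang_zero]
  | succ k ih =>
    rw [lintegral_erlang_succ k (by fun_prop)]
    have h1 : ∀ s : ℝ, ∫⁻ q, ENNReal.ofReal (Real.exp (-(r * (s + q)))) ∂erlang k =
        ENNReal.ofReal (Real.exp (-(r * s))) * ENNReal.ofReal (1 / r ^ k) := by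
      intro s
      rw [← ih, ← lintegral_const_mul _ (by fun_prop)]
      refine lintegral_congr fun q => ?_
      rw [← ENNReal.ofReal_mul (Real.exp_pos _).le, ← Real.exp_add]
      congr 2; ring
    simp only [h1]
    have h2 := integrableOn_pow_mul_exp 0 hr
    simp only [pow_zero, one_mul, Nat.factorial_zero, Nat.cast_one, zero_add, pow_one] at h2
    rw [lintegral_mul_const _ (by fun_prop), ← ofReal_integral_eq_lintegral_ofReal h2.1
      (Eventually.of_forall fun s => (Real.exp_pos _).le), h2.2, ← ENNReal.ofReal_mul (by positivity)]
    congr 1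
    rw [pow_succ]; field_simp

theorem integrable_erlang_exp (k : ℕ) {r : ℝ} (hr : 0 < r) :
    Integrable (fun s => Real.exp (-(r * s))) (erlang k) := by
  refine ⟨by fun_prop, ?_⟩
  rw [hasFiniteIntegral_iff_ofReal (Eventually.of_forall fun s => (Real.exp_pos _).le),
    lintegral_erlang_exp k hr]
  exact ENNReal.ofReal_lt_top

theorem integral_erlang_exp (k : ℕ) {r : ℝ} (hr : 0 < r) :
    ∫ s, Real.exp (-(r * s)) ∂erlang k = 1 / r ^ k := by
  rw [integral_eq_lintegral_of_nonneg_ae (Eventually.of_forall fun s => (Real.exp_pos _).le)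
    (by fun_prop), lintegral_erlang_exp k hr, ENNReal.toReal_ofReal (by positivity)]

theorem setLIntegral_Ioi_eq_two_mul {g : ℝ → ENNReal} (hg : Measurable g) :
    ∫⁻ s in Ioi (0 : ℝ), g s = 2 * ∫⁻ s in Ioi (0 : ℝ), g (2 * s) := by
  have h := lintegral_image_eq_lintegral_abs_deriv_mul (s := Ioi (0 : ℝ)) (f := fun s => 2 * s)
    (f' := fun _ => 2) measurableSet_Ioi
    (fun s _ => by simpa using ((hasDerivAt_id s).const_mul 2).hasDerivWithinAt)
    (fun a _ b _ hab => by simpa using hab) g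
  have him : (fun s : ℝ => 2 * s) '' Ioi 0 = Ioi 0 := by
    rw [image_mul_left_Ioi two_pos]; simp
  rw [him] at h
  rw [h, lintegral_const_mul _ (by fun_prop)]
  simp

/-- Each of the k Lebesgue factors scales by 2. The substitution is needed because cosine estimates
yield min(1, (e^{-s}x)²), with e^{-2s}, whereas the time moment is written with e^{-s}. -/
theorem lintegral_erlang_le_two_pow_mul (k : ℕ) {f : ℝ → ENNReal} (hf : Measurable f) :
    ∫⁻ s, f s ∂erlang k ≤ 2 ^ k * ∫⁻ s, f (2 * s) ∂erlang k := by
  induction k generalizing f with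
  | zero => simp [lintegral_erlang_zero]
  | succ k ih =>
    rw [lintegral_erlang_succ k hf, lintegral_erlang_succ k (by fun_prop),
      setLIntegral_Ioi_eq_two_mul (by
        exact Measurable.lintegral_prod_right' (f := fun p : ℝ × ℝ => f (p.1 + p.2)) (by fun_prop)),
      pow_succ', mul_assoc]
    gcongr
    rw [← lintegral_const_mul _ (by
        exact Measurable.lintegral_prod_right' (f := fun p : ℝ × ℝ => f (2 * (p.1 + p.2))) (by fun_prop))]
    refine lintegral_mono fun s => ?_
    refine (ih (f := fun r => f (2 * s + r)) (by fun_prop)).trans_eq ?_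
    simp only [mul_add]

/-! ### Moment conditions -/

/-- The measure `M` has no atom at `0` and integrates `∫ min(1, e^{-s} x²) s^{k-1}/(k-1)! ds`. -/
def HasTimeMoment (k : ℕ) (M : Measure ℝ) : Prop :=
  M {0} = 0 ∧ ∫⁻ x, ∫⁻ s, ENNReal.ofReal (min 1 (Real.exp (-s) * x ^ 2)) ∂erlang k ∂M < ⊤

theorem hasTimeMoment_zero_iff (M : Measure ℝ) : HasTimeMoment 0 M ↔ IsLevyMeasure M := by
  simp [HasTimeMoment, IsLevyMeasure, lintegral_erlang_zero]

theorem measurable_lintegral_min (κ : Measure ℝ) [SFinite κ] :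
    Measurable fun x : ℝ => ∫⁻ s, ENNReal.ofReal (min 1 (Real.exp (-s) * x ^ 2)) ∂κ :=
  Measurable.lintegral_prod_right'
    (f := fun p : ℝ × ℝ => ENNReal.ofReal (min 1 (Real.exp (-p.2) * p.1 ^ 2))) (by fun_prop)

/-- The density e^{-s} has mass 1 on the half-line, and e^{-s} min(1, y) ≤ min(1, e^{-s}y) for s >
0. -/
theorem lintegral_erlang_min_le_succ (k : ℕ) (x : ℝ) :
    ∫⁻ s, ENNReal.ofReal (min 1 (Real.exp (-s) * x ^ 2)) ∂erlang k ≤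
      ∫⁻ s, ENNReal.ofReal (min 1 (Real.exp (-s) * x ^ 2)) ∂erlang (k + 1) := by
  rw [lintegral_erlang_succ k (by fun_prop)]
  have h1 := lintegral_erlang_exp 1 one_pos
  simp only [one_mul, pow_one, div_one, ENNReal.ofReal_one] at h1
  rw [erlang, erlang, Measure.conv_dirac_zero] at h1
  calc _ = ∫⁻ s in Ioi (0 : ℝ), ENNReal.ofReal (Real.exp (-s)) *
        ∫⁻ s, ENNReal.ofReal (min 1 (Real.exp (-s) * x ^ 2)) ∂erlang k := by
        rw [lintegral_mul_const _ (by fun_prop), h1, one_mul]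
    _ ≤ _ := by
        refine setLIntegral_mono' measurableSet_Ioi fun s hs => ?_
        have hs' : (0 : ℝ) < s := hs
        rw [← lintegral_const_mul _ (by fun_prop)]
        refine lintegral_mono fun r => ?_
        rw [← ENNReal.ofReal_mul (Real.exp_pos _).le]
        refine ENNReal.ofReal_le_ofReal ?_
        rw [mul_min_of_nonneg _ _ (Real.exp_pos _).le, neg_add, Real.exp_add, mul_one, mul_assoc]
        exact min_le_min_right _ (Real.exp_le_one_iff.2 (by linarith))

theorem HasTimeMoment.of_succ {k : ℕ} {M : Measure ℝ} (h : HasTimeMoment (k + 1) M) :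
    HasTimeMoment k M :=
  ⟨h.1, (lintegral_mono fun x => lintegral_erlang_min_le_succ k x).trans_lt h.2⟩

theorem HasTimeMoment.isLevyMeasure {k : ℕ} {M : Measure ℝ} (h : HasTimeMoment k M) :
    IsLevyMeasure M := by
  induction k with
  | zero => exact (hasTimeMoment_zero_iff M).1 h
  | succ k ih => exact ih h.of_succ

/-- The function `min(1, x²) + 1_{|x|>1} log^{k+1}(1 + |x|)`. -/
def logSize (k : ℕ) (x : ℝ) : ℝ :=
  min 1 (x ^ 2) + {x : ℝ | 1 < |x|}.indicator (fun x => Real.log (1 + |x|) ^ (k + 1)) x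

theorem measurableSet_one_lt_abs : MeasurableSet {x : ℝ | 1 < |x|} :=
  measurableSet_lt measurable_const measurable_abs

theorem logSize_of_le {k : ℕ} {x : ℝ} (h : |x| ≤ 1) : logSize k x = x ^ 2 := by
  have : x ^ 2 ≤ 1 := by rw [← sq_abs]; nlinarith [abs_nonneg x]
  simp [logSize, this, h.not_gt]

theorem logSize_of_gt {k : ℕ} {x : ℝ} (h : 1 < |x|) :
    logSize k x = 1 + Real.log (1 + |x|) ^ (k + 1) := by
  have : 1 ≤ x ^ 2 := by rw [← sq_abs]; nlinarith
  simp [logSize, this, h]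

theorem half_le_log_one_add {x : ℝ} (h : 1 ≤ x) : 1 / 2 ≤ Real.log (1 + x) := by
  have := Real.log_le_log two_pos (by linarith : 2 ≤ 1 + x)
  linarith [Real.log_two_gt_d9]

theorem one_le_two_pow_mul_log_pow (n : ℕ) {x : ℝ} (h : 1 ≤ x) :
    1 ≤ 2 ^ n * Real.log (1 + x) ^ n := by
  rw [← mul_pow]
  exact one_le_pow₀ (by linarith [half_le_log_one_add h])

/-- For |x| > 1 put A = log x². Then min(1, e^{A-s}) ≤ e · e^{-εs} with ε = 1/(1+A), and the Laplace
transform at this ε equals (1+A)^{k+1}, which is the required power of the logarithm. For |x| ≤ 1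
the minimum is bounded by e^{-s}x². -/
theorem lintegral_erlang_min_le_logSize (k : ℕ) : ∃ C : ℝ, 0 < C ∧ ∀ x : ℝ,
    ∫⁻ s, ENNReal.ofReal (min 1 (Real.exp (-s) * x ^ 2)) ∂erlang (k + 1) ≤
      ENNReal.ofReal (C * logSize k x) := by
  refine ⟨Real.exp 1 * 4 ^ (k + 1), by positivity, fun x => ?_⟩
  have he1 : 1 ≤ Real.exp 1 := Real.one_le_exp zero_le_one
  rcases le_or_gt |x| 1 with h | h
  · calc _ ≤ ∫⁻ s, ENNReal.ofReal (Real.exp (-(1 * s))) * ENNReal.ofReal (x ^ 2) ∂erlang (k + 1) := by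
          refine lintegral_mono fun s => ?_
          rw [← ENNReal.ofReal_mul (Real.exp_pos _).le, one_mul]
          exact ENNReal.ofReal_le_ofReal (min_le_right _ _)
      _ = ENNReal.ofReal (x ^ 2) := by
          rw [lintegral_mul_const _ (by fun_prop), lintegral_erlang_exp _ one_pos]; simp
      _ ≤ _ := by
          rw [logSize_of_le h]
          refine ENNReal.ofReal_le_ofReal (le_mul_of_one_le_left (sq_nonneg x) ?_)
          exact one_le_mul_of_one_le_of_one_le he1 (one_le_pow₀ (by norm_num))
  · have hx0 : x ≠ 0 := by rintro rfl; norm_num at h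
    set A : ℝ := Real.log (x ^ 2) with hA
    have hA' : A = 2 * Real.log |x| := by rw [hA, ← sq_abs, Real.log_pow]; norm_num
    have hlog : 0 < Real.log |x| := Real.log_pos h
    have hA0 : 0 ≤ A := by linarith
    set ε : ℝ := 1 / (1 + A) with hε
    have hε0 : 0 < ε := by positivity
    have hε1 : ε ≤ 1 := by rw [hε, div_le_one (by positivity)]; linarith
    have hεA : ε * A ≤ 1 := by
      rw [hε, one_div_mul_eq_div, div_le_one (by positivity)]; linarith
    have hxA : x ^ 2 = Real.exp A := (Real.exp_log (by positivity)).symm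
    calc _ ≤ ∫⁻ s, ENNReal.ofReal (Real.exp (-(ε * s))) * ENNReal.ofReal (Real.exp 1) ∂erlang (k + 1) := by
          refine lintegral_mono fun s => ?_
          rw [← ENNReal.ofReal_mul (Real.exp_pos _).le, ← Real.exp_add]
          refine ENNReal.ofReal_le_ofReal ?_
          rw [hxA, ← Real.exp_add]
          rcases le_or_gt s A with hs | hs
          · refine (min_le_left _ _).trans (Real.one_le_exp ?_)
            nlinarith
          · refine (min_le_right _ _).trans (Real.exp_le_exp.2 ?_)
            nlinarith
      _ = ENNReal.ofReal (Real.exp 1 * (1 + A) ^ (k + 1)) := by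
          rw [lintegral_mul_const _ (by fun_prop), lintegral_erlang_exp _ hε0,
            ← ENNReal.ofReal_mul (by positivity), hε]
          congr 1
          rw [div_pow]; field_simp; simp
      _ ≤ _ := by
          refine ENNReal.ofReal_le_ofReal ?_
          rw [logSize_of_gt h, mul_assoc]
          gcongr
          have h2 := half_le_log_one_add h.le
          have h3 : Real.log |x| ≤ Real.log (1 + |x|) := Real.log_le_log (by positivity) (by linarith)
          calc (1 + A) ^ (k + 1) ≤ (4 * Real.log (1 + |x|)) ^ (k + 1) := by
                gcongr; linarith
            _ = 4 ^ (k + 1) * Real.log (1 + |x|) ^ (k + 1) := mul_pow _ _ _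
            _ ≤ _ := by gcongr; linarith

theorem min_one_sq_le_lintegral_erlang (k : ℕ) (x : ℝ) : ENNReal.ofReal (min 1 (x ^ 2)) ≤
    ∫⁻ s, ENNReal.ofReal (min 1 (Real.exp (-s) * x ^ 2)) ∂erlang k := by
  induction k with
  | zero => simp [lintegral_erlang_zero]
  | succ k ih => exact ih.trans (lintegral_erlang_min_le_succ k x)

/-- For |x| > 1 the minimum equals 1 as long as s ≤ log x². The shorter interval (0, log|x|] already
has Erlang mass log^{k+1}|x| / (k+1)!, and replacing log(1+|x|) by 1 + log|x| costs the factor 2^k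
from convexity of the power. -/
theorem logSize_le_lintegral_erlang_min (k : ℕ) : ∃ C : ℝ, 0 < C ∧ ∀ x : ℝ,
    ENNReal.ofReal (logSize k x) ≤ ENNReal.ofReal C *
      ∫⁻ s, ENNReal.ofReal (min 1 (Real.exp (-s) * x ^ 2)) ∂erlang (k + 1) := by
  refine ⟨1 + 2 ^ k * (1 + (k + 1).factorial), by positivity, fun x => ?_⟩
  set q := ∫⁻ s, ENNReal.ofReal (min 1 (Real.exp (-s) * x ^ 2)) ∂erlang (k + 1) with hq
  have h1 := min_one_sq_le_lintegral_erlang (k + 1) x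
  rw [← hq] at h1
  rcases le_or_gt |x| 1 with h | h
  · rw [logSize_of_le h]
    have : x ^ 2 ≤ 1 := by rw [← sq_abs]; nlinarith [abs_nonneg x]
    rw [min_eq_right this] at h1
    refine h1.trans (le_mul_of_one_le_left zero_le ?_)
    rw [ENNReal.one_le_ofReal]
    have : (0 : ℝ) ≤ 2 ^ k * (1 + (k + 1).factorial) := by positivity
    linarith
  · have hx1 : 1 ≤ x ^ 2 := by rw [← sq_abs]; nlinarith
    rw [min_eq_left hx1, ENNReal.ofReal_one] at h1
    set A : ℝ := Real.log |x| with hA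
    have hA0 : 0 < A := Real.log_pos h
    have hx : |x| = Real.exp A := (Real.exp_log (by positivity)).symm
    have h2 : ENNReal.ofReal (A ^ (k + 1)) ≤ ENNReal.ofReal (k + 1).factorial * q := by
      have h3 : ENNReal.ofReal (A ^ (k + 1) / (k + 1).factorial) ≤ q := by
        have e : ENNReal.ofReal (A ^ (k + 1) / (k + 1).factorial) =
            ∫⁻ s in Ioc 0 A, ENNReal.ofReal (s ^ k / k.factorial) := by
          rw [← ofReal_integral_eq_lintegral_ofReal
            (by
              rw [← IntegrableOn, ← intervalIntegrable_iff_integrableOn_Ioc_of_le hA0.le]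
              apply Continuous.intervalIntegrable; fun_prop)
            (by
              filter_upwards [ae_restrict_mem measurableSet_Ioc] with s hs
              have := hs.1
              positivity),
            ← intervalIntegral.integral_of_le hA0.le, intervalIntegral.integral_div, integral_pow]
          congr 1
          rw [Nat.factorial_succ]; push_cast
          field_simp; simp
        rw [e, hq, erlang_succ_eq_withDensity,
          lintegral_withDensity_eq_lintegral_mul _ (by fun_prop) (by fun_prop)]
        refine (setLIntegral_mono' measurableSet_Ioc fun s hs => ?_).trans
          (lintegral_mono_set Ioc_subset_Ioi_self)
        have : min 1 (Real.exp (-s) * x ^ 2) = 1 := by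
          refine min_eq_left ?_
          rw [← sq_abs, hx, ← Real.exp_nat_mul, ← Real.exp_add]
          refine Real.one_le_exp ?_
          push_cast
          linarith [hs.2]
        simp only [Pi.mul_apply]
        rw [this]; simp
      have hf : (0 : ℝ) < (k + 1).factorial := by positivity
      calc ENNReal.ofReal (A ^ (k + 1)) = ENNReal.ofReal (k + 1).factorial *
            ENNReal.ofReal (A ^ (k + 1) / (k + 1).factorial) := by
            rw [← ENNReal.ofReal_mul hf.le]; congr 1; field_simp
        _ ≤ _ := by gcongr
    have hlog : Real.log (1 + |x|) ≤ 1 + A := by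
      have : Real.log (1 + |x|) ≤ Real.log (2 * |x|) := Real.log_le_log (by positivity) (by linarith)
      rw [Real.log_mul two_ne_zero (by positivity)] at this
      linarith [Real.log_two_lt_d9]
    have hlog0 : 0 ≤ Real.log (1 + |x|) := Real.log_nonneg (by linarith)
    have hpow : Real.log (1 + |x|) ^ (k + 1) ≤ 2 ^ k * (1 + A ^ (k + 1)) := by
      have := add_pow_le zero_le_one hA0.le (k + 1)
      rw [one_pow, Nat.add_sub_cancel] at this
      exact (pow_le_pow_left₀ hlog0 hlog _).trans this
    rw [logSize_of_gt h]
    calc ENNReal.ofReal (1 + Real.log (1 + |x|) ^ (k + 1))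
        ≤ ENNReal.ofReal (1 + 2 ^ k * (1 + A ^ (k + 1))) := ENNReal.ofReal_le_ofReal (by linarith)
      _ = 1 + 2 ^ k * (1 + ENNReal.ofReal (A ^ (k + 1))) := by
          rw [ENNReal.ofReal_add (by positivity) (by positivity), ENNReal.ofReal_mul (by positivity),
            ENNReal.ofReal_add (by positivity) (by positivity), ENNReal.ofReal_pow (by positivity)]
          simp
      _ ≤ q + 2 ^ k * (q + ENNReal.ofReal (k + 1).factorial * q) := by gcongr
      _ = _ := by
          rw [ENNReal.ofReal_add (by positivity) (by positivity), ENNReal.ofReal_mul (by positivity),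
            ENNReal.ofReal_add (by positivity) (by positivity), ENNReal.ofReal_pow (by positivity)]
          simp
          ring

/-! ### Comparison of the weight in (2) with the logarithmic moment. -/

theorem logWeight_nonneg (k : ℕ) (x : ℝ) : 0 ≤ logWeight k x :=
  pow_nonneg (Real.log_nonneg (by linarith [Real.rpow_nonneg (abs_nonneg x) ((2 : ℝ) / ((k : ℝ) + 1))])) _

theorem logWeight_pos (k : ℕ) {x : ℝ} (hx : x ≠ 0) : 0 < logWeight k x := by
  have := Real.rpow_pos_of_pos (abs_pos.2 hx) ((2 : ℝ) / ((k : ℝ) + 1))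
  exact pow_pos (Real.log_pos (by linarith)) _

theorem measurable_logWeight (k : ℕ) : Measurable (logWeight k) := by
  unfold logWeight; fun_prop

theorem rpow_two_div_pow (k : ℕ) (x : ℝ) :
    (|x| ^ ((2 : ℝ) / ((k : ℝ) + 1))) ^ (k + 1) = x ^ 2 := by
  rw [← Real.rpow_natCast, ← Real.rpow_mul (abs_nonneg x)]
  have : (2 : ℝ) / ((k : ℝ) + 1) * ((k + 1 : ℕ) : ℝ) = (2 : ℕ) := by
    push_cast; field_simp
  rw [this, Real.rpow_natCast, sq_abs]

/-- With y = |x|^{2/(k+1)} one has y^{k+1} = x². Hence log^{k+1}(1+y) behaves like x² near 0,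
because log(1+y) ~ y, and like a multiple of log^{k+1}|x| at infinity. This is the reason for the
exponent 2/(k+1), here and in the reverse inequality. -/
theorem logWeight_le_logSize (k : ℕ) (x : ℝ) : logWeight k x ≤ 2 ^ (k + 1) * logSize k x := by
  set y := |x| ^ ((2 : ℝ) / ((k : ℝ) + 1)) with hy
  have hy0 : 0 ≤ y := Real.rpow_nonneg (abs_nonneg x) _
  have hlog0 : 0 ≤ Real.log (1 + y) := Real.log_nonneg (by linarith)
  have hW : logWeight k x = Real.log (1 + y) ^ (k + 1) := rfl
  rw [hW]
  rcases le_or_gt |x| 1 with h | h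
  · rw [logSize_of_le h, ← rpow_two_div_pow k x, ← mul_pow]
    have : Real.log (1 + y) ≤ y := by
      have := Real.log_le_sub_one_of_pos (by linarith : 0 < 1 + y); linarith
    gcongr
    linarith
  · rw [logSize_of_gt h]
    have hyx : y ≤ x ^ 2 := by
      rw [← sq_abs, ← Real.rpow_two]
      refine Real.rpow_le_rpow_of_exponent_le h.le ?_
      exact div_le_self zero_le_two (by linarith [Nat.cast_nonneg (α := ℝ) k])
    have : Real.log (1 + y) ≤ 2 * Real.log (1 + |x|) := by
      have h2 : Real.log (1 + y) ≤ Real.log ((1 + |x|) ^ 2) := by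
        refine Real.log_le_log (by linarith) ?_
        rw [← sq_abs] at hyx
        nlinarith [abs_nonneg x]
      rwa [Real.log_pow] at h2
    calc Real.log (1 + y) ^ (k + 1) ≤ (2 * Real.log (1 + |x|)) ^ (k + 1) := by gcongr
      _ = 2 ^ (k + 1) * Real.log (1 + |x|) ^ (k + 1) := mul_pow _ _ _
      _ ≤ _ := by gcongr; linarith

theorem logSize_le_logWeight (k : ℕ) : ∃ C : ℝ, 0 < C ∧ ∀ x : ℝ, logSize k x ≤ C * logWeight k x := by
  set p : ℝ := (2 : ℝ) / ((k : ℝ) + 1) with hp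
  have hp0 : 0 < p := by positivity
  refine ⟨2 ^ (k + 1) + (1 + 1 / p) ^ (k + 1), by positivity, fun x => ?_⟩
  set y := |x| ^ p with hy
  have hy0 : 0 ≤ y := Real.rpow_nonneg (abs_nonneg x) _
  have hlog0 : 0 ≤ Real.log (1 + y) := Real.log_nonneg (by linarith)
  have hW : logWeight k x = Real.log (1 + y) ^ (k + 1) := rfl
  rw [hW]
  rcases le_or_gt |x| 1 with h | h
  · rw [logSize_of_le h, ← rpow_two_div_pow k x, ← hp, ← hy]
    have hy1 : y ≤ 1 := Real.rpow_le_one (abs_nonneg x) h hp0.le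
    have h1 : y ≤ 2 * Real.log (1 + y) := by
      have h2 := Real.one_sub_inv_le_log_of_pos (by linarith : 0 < 1 + y)
      have h3 : 1 - (1 + y)⁻¹ = y / (1 + y) := by field_simp; ring
      have h4 : y / 2 ≤ y / (1 + y) := by gcongr; linarith
      linarith
    calc y ^ (k + 1) ≤ (2 * Real.log (1 + y)) ^ (k + 1) := by gcongr
      _ = 2 ^ (k + 1) * Real.log (1 + y) ^ (k + 1) := mul_pow _ _ _
      _ ≤ _ := by
        gcongr
        have : 0 ≤ (1 + 1 / p) ^ (k + 1) := by positivity
        linarith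
  · rw [logSize_of_gt h]
    have hy1 : 1 ≤ y := Real.one_le_rpow h.le hp0.le
    have h1 := one_le_two_pow_mul_log_pow (k + 1) hy1
    have h2 : Real.log (1 + |x|) ≤ (1 + 1 / p) * Real.log (1 + y) := by
      have e1 : Real.log (1 + |x|) ≤ Real.log (2 * |x|) := Real.log_le_log (by positivity) (by linarith)
      rw [Real.log_mul two_ne_zero (by positivity)] at e1
      have e2 : Real.log 2 ≤ Real.log (1 + y) := Real.log_le_log two_pos (by linarith)
      have e3 : p * Real.log |x| ≤ Real.log (1 + y) := by
        rw [← Real.log_rpow (by positivity)]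
        exact Real.log_le_log (by positivity) (by linarith)
      have e4 : Real.log |x| ≤ 1 / p * Real.log (1 + y) := by
        rw [one_div_mul_eq_div, le_div_iff₀ hp0]; linarith
      linarith
    have hl0 : 0 ≤ Real.log (1 + |x|) := Real.log_nonneg (by linarith)
    have h3 : Real.log (1 + |x|) ^ (k + 1) ≤ (1 + 1 / p) ^ (k + 1) * Real.log (1 + y) ^ (k + 1) := by
      rw [← mul_pow]; gcongr
    linarith

theorem measurable_logSize (k : ℕ) : Measurable (logSize k) := by
  unfold logSize
  exact (by fun_prop : Measurable fun x : ℝ => min 1 (x ^ 2)).add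
    ((by fun_prop : Measurable fun x : ℝ => Real.log (1 + |x|) ^ (k + 1)).indicator
      measurableSet_one_lt_abs)

theorem lintegral_logSize (k : ℕ) (M : Measure ℝ) :
    ∫⁻ x, ENNReal.ofReal (logSize k x) ∂M = ∫⁻ x, ENNReal.ofReal (min 1 (x ^ 2)) ∂M +
      ∫⁻ x in {x : ℝ | 1 < |x|}, ENNReal.ofReal (Real.log (1 + |x|) ^ (k + 1)) ∂M := by
  rw [← lintegral_indicator measurableSet_one_lt_abs, ← lintegral_add_left (by fun_prop)]
  refine lintegral_congr fun x => ?_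
  rw [logSize, ENNReal.ofReal_add (by positivity)]
  · congr 1
    by_cases h : x ∈ {x : ℝ | 1 < |x|} <;> simp [indicator, h]
  · refine indicator_nonneg (fun x hx => ?_) x
    have : 0 ≤ Real.log (1 + |x|) := Real.log_nonneg (by linarith [abs_nonneg x])
    positivity

theorem lintegral_logSize_lt_top_iff (k : ℕ) {M : Measure ℝ} (hM : M {0} = 0) :
    ∫⁻ x, ENNReal.ofReal (logSize k x) ∂M < ⊤ ↔ IsLevyMeasure M ∧ HasLogMoment k M := by
  rw [lintegral_logSize, ENNReal.add_lt_top, IsLevyMeasure, HasLogMoment]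
  tauto

theorem lintegral_lt_top_of_le {M : Measure ℝ} {f g : ℝ → ENNReal} (hg : Measurable g) {C : ℝ}
    (h : ∀ x, f x ≤ ENNReal.ofReal C * g x) (hfin : ∫⁻ x, g x ∂M < ⊤) : ∫⁻ x, f x ∂M < ⊤ := by
  refine (lintegral_mono h).trans_lt ?_
  rw [lintegral_const_mul _ hg]
  exact ENNReal.mul_lt_top ENNReal.ofReal_lt_top hfin

theorem lintegral_logSize_lt_top_iff_hasTimeMoment (k : ℕ) {M : Measure ℝ} (hM : M {0} = 0) :
    ∫⁻ x, ENNReal.ofReal (logSize k x) ∂M < ⊤ ↔ HasTimeMoment (k + 1) M := by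
  obtain ⟨C, hC, h1⟩ := lintegral_erlang_min_le_logSize k
  obtain ⟨D, hD, h2⟩ := logSize_le_lintegral_erlang_min k
  refine ⟨fun h => ⟨hM, ?_⟩, fun h => lintegral_lt_top_of_le (measurable_lintegral_min _) h2 h.2⟩
  refine lintegral_lt_top_of_le (measurable_logSize k).ennreal_ofReal (C := C) (fun x => ?_) h
  rw [← ENNReal.ofReal_mul hC.le]
  exact h1 x

theorem hasTimeMoment_succ_iff (k : ℕ) {M : Measure ℝ} (hM : M {0} = 0) :
    HasTimeMoment (k + 1) M ↔ IsLevyMeasure M ∧ HasLogMoment k M := by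
  rw [← lintegral_logSize_lt_top_iff_hasTimeMoment k hM, lintegral_logSize_lt_top_iff k hM]

theorem lintegral_logWeight_lt_top_iff (k : ℕ) {M : Measure ℝ} (hM : M {0} = 0) :
    ∫⁻ x, ENNReal.ofReal (logWeight k x) ∂M < ⊤ ↔ IsLevyMeasure M ∧ HasLogMoment k M := by
  rw [← lintegral_logSize_lt_top_iff k hM]
  obtain ⟨C, hC, h1⟩ := logSize_le_logWeight k
  constructor
  · refine lintegral_lt_top_of_le (measurable_logWeight k).ennreal_ofReal (C := C) fun x => ?_
    rw [← ENNReal.ofReal_mul hC.le]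
    exact ENNReal.ofReal_le_ofReal (h1 x)
  · refine lintegral_lt_top_of_le (measurable_logSize k).ennreal_ofReal (C := 2 ^ (k + 1)) fun x => ?_
    rw [← ENNReal.ofReal_mul (by positivity)]
    exact ENNReal.ofReal_le_ofReal (logWeight_le_logSize k x)

/-! ### Existence of measures with a given characteristic function -/

/-- `φ` is the characteristic function of a probability measure. -/
def IsCharFun (φ : ℝ → ℂ) : Prop := ∃ P : Measure ℝ, IsProbabilityMeasure P ∧ charFun P = φ

theorem IsCharFun.mul {φ₁ φ₂ : ℝ → ℂ} (h₁ : IsCharFun φ₁) (h₂ : IsCharFun φ₂) :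
    IsCharFun (fun u => φ₁ u * φ₂ u) := by
  obtain ⟨P, hP, rfl⟩ := h₁
  obtain ⟨Q, hQ, rfl⟩ := h₂
  exact ⟨P.conv Q, inferInstance, funext fun u => charFun_conv u⟩

theorem isProbabilityMeasure_convPower (μ : Measure ℝ) [IsProbabilityMeasure μ] (n : ℕ) :
    IsProbabilityMeasure (convPower μ n) := by
  induction n with
  | zero => unfold convPower; infer_instance
  | succ n ih => unfold convPower; infer_instance

theorem charFun_convPower (μ : Measure ℝ) [IsProbabilityMeasure μ] (n : ℕ) (u : ℝ) :
    charFun (convPower μ n) u = charFun μ u ^ n := by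
  induction n with
  | zero => simp [convPower]
  | succ n ih =>
    have := isProbabilityMeasure_convPower μ n
    rw [convPower, charFun_conv, ih, pow_succ]

/-- Lévy's continuity theorem, with no limit law given in advance. Continuity of the limit at 0
forces tightness, so the laws have a limit along an ultrafilter, and its characteristic function
must be φ. -/
theorem isCharFun_of_tendsto {P : ℕ → Measure ℝ} (hP : ∀ n, IsProbabilityMeasure (P n)) {φ : ℝ → ℂ}
    (hφ : ContinuousAt φ 0) (h : ∀ u, Tendsto (fun n => charFun (P n) u) atTop (𝓝 (φ u))) :
    IsCharFun φ := by
  set μ : ℕ → ProbabilityMeasure ℝ := fun n => ⟨P n, hP n⟩ with hμ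
  have htight : IsTightMeasureSet {((μ n : ProbabilityMeasure ℝ) : Measure ℝ) | n} :=
    isTightMeasureSet_of_tendsto_charFun hφ h
  have h_compact : IsCompact (closure {μ n | n}) :=
    isCompact_closure_of_isTightMeasureSet (by simpa using htight)
  obtain ⟨ν, -, hν : Tendsto _ _ _⟩ := h_compact.ultrafilter_le_nhds ((hyperfilter ℕ).map μ)
    (.trans (by simp) (monotone_principal subset_closure))
  refine ⟨ν, inferInstance, funext fun u => ?_⟩
  rw [ProbabilityMeasure.tendsto_iff_forall_integral_rclike_tendsto ℂ] at hν
  have h1 := hν (BoundedContinuousFunction.innerProbChar u)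
  have h2 : Tendsto (fun n => charFun (P n) u) (hyperfilter ℕ) (𝓝 (φ u)) :=
    (h u).mono_left (by rw [← Nat.cofinite_eq_atTop]; exact hyperfilter_le_cofinite)
  rw [charFun_eq_integral_innerProbChar]
  refine tendsto_nhds_unique h1 ?_
  simp only [charFun_eq_integral_innerProbChar] at h2
  exact h2

theorem isCharFun_dirac (b : ℝ) : IsCharFun (fun u => Complex.exp (Complex.I * u * b)) := by
  refine ⟨Measure.dirac b, inferInstance, funext fun u => ?_⟩
  rw [charFun_dirac]
  congr 1
  simp; ring

theorem isCharFun_gaussian (a : ℝ) {v : ℝ} (hv : 0 ≤ v) :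
    IsCharFun (fun u => Complex.exp (Complex.I * u * a - (1 / 2) * v * u ^ 2)) := by
  refine ⟨ProbabilityTheory.gaussianReal a v.toNNReal, inferInstance, funext fun u => ?_⟩
  rw [ProbabilityTheory.charFun_gaussianReal]
  congr 1
  rw [Real.coe_toNNReal v hv]
  ring

theorem integrable_exp_I_mul (l : Measure ℝ) [IsFiniteMeasure l] (u : ℝ) :
    Integrable (fun x : ℝ => Complex.exp (Complex.I * u * x)) l := by
  refine Integrable.of_bound (C := 1) (by fun_prop) (Eventually.of_forall fun x => ?_)
  have : Complex.I * u * x = ((u * x : ℝ) : ℂ) * Complex.I := by push_cast; ring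
  rw [this, Complex.norm_exp_ofReal_mul_I]

theorem charFun_eq_integral_exp (l : Measure ℝ) (u : ℝ) :
    charFun l u = ∫ x, Complex.exp (Complex.I * u * x) ∂l := by
  rw [charFun_apply_real]
  congr with x
  congr 1; ring

/-- Poisson approximation: with r the mass of l, the n-th convolution power of (1 - r/n)δ_0 + l/n
has characteristic function (1 + (φ_l - r)/n)^n, which tends to exp(φ_l - r). -/
theorem isCharFun_compoundPoisson (l : Measure ℝ) [IsFiniteMeasure l] :
    IsCharFun (fun u => Complex.exp (∫ x, (Complex.exp (Complex.I * u * x) - 1) ∂l)) := by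
  set r : ℝ := l.real univ with hr
  have hr0 : 0 ≤ r := measureReal_nonneg
  -- The shift by N keeps the weight 1 - r/(n+N) nonnegative, and the denominator positive, for all
  -- n.
  set N : ℕ := ⌈r⌉₊ + 1 with hN
  have hint : ∀ u : ℝ, ∫ x, (Complex.exp (Complex.I * u * x) - 1) ∂l = charFun l u - r := by
    intro u
    rw [integral_sub (integrable_exp_I_mul l u) (integrable_const _), charFun_eq_integral_exp]
    simp [hr]
  set Q : ℕ → Measure ℝ := fun n => ENNReal.ofReal (1 - r / (n + N : ℕ)) • Measure.dirac 0 +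
    ENNReal.ofReal (1 / (n + N : ℕ)) • l with hQ
  have hpos : ∀ n : ℕ, (0 : ℝ) < (n + N : ℕ) := fun n => by positivity
  have hle : ∀ n : ℕ, r / (n + N : ℕ) ≤ 1 := fun n => by
    rw [div_le_one (hpos n)]
    refine (Nat.le_ceil r).trans ?_
    exact_mod_cast (by omega : ⌈r⌉₊ ≤ n + N)
  have hQp : ∀ n, IsProbabilityMeasure (Q n) := fun n => ⟨by
    have h1 : l univ = ENNReal.ofReal r := by simp [hr]
    simp only [hQ, Measure.add_apply, Measure.smul_apply, h1, measure_univ, smul_eq_mul, mul_one]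
    rw [← ENNReal.ofReal_mul (by positivity), ← ENNReal.ofReal_add (by linarith [hle n]) (by positivity),
      ← ENNReal.ofReal_one]
    congr 1
    ring⟩
  have hQc : ∀ n u, charFun (Q n) u = 1 + (charFun l u - r) / (n + N : ℕ) := by
    intro n u
    have hf1 : IsFiniteMeasure (ENNReal.ofReal (1 - r / (n + N : ℕ)) • Measure.dirac (0 : ℝ)) :=
      Measure.smul_finite _ ENNReal.ofReal_ne_top
    have hf2 : IsFiniteMeasure (ENNReal.ofReal (1 / (n + N : ℕ)) • l) :=
      Measure.smul_finite _ ENNReal.ofReal_ne_top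
    have hn : ((n + N : ℕ) : ℂ) ≠ 0 := by exact_mod_cast (hpos n).ne'
    rw [charFun_eq_integral_exp, hQ, integral_add_measure (integrable_exp_I_mul _ u)
      (integrable_exp_I_mul _ u), integral_smul_measure, integral_smul_measure,
      ← charFun_eq_integral_exp, ← charFun_eq_integral_exp,
      ENNReal.toReal_ofReal (by linarith [hle n]), ENNReal.toReal_ofReal (by positivity), charFun_dirac]
    simp only [Complex.real_smul, inner_zero_left, Complex.ofReal_zero, zero_mul, Complex.exp_zero]
    push_cast at hn ⊢
    field_simp
    ring
  refine isCharFun_of_tendsto (P := fun n => convPower (Q n) (n + N))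
    (fun n => isProbabilityMeasure_convPower _ _) ?_ fun u => ?_
  · simp only [hint]
    fun_prop
  · simp only [charFun_convPower, hQc, hint]
    exact (Complex.tendsto_one_add_div_pow_exp (charFun l u - r)).comp (tendsto_add_atTop_nat N)

/-! ### The Lévy–Khintchine exponent -/

theorem IsLevyMeasure.integrable_min {M : Measure ℝ} (hM : IsLevyMeasure M) :
    Integrable (fun x : ℝ => min 1 (x ^ 2)) M := by
  refine ⟨by fun_prop, ?_⟩
  rw [hasFiniteIntegral_iff_ofReal (Eventually.of_forall fun x => by positivity)]
  exact hM.2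

theorem continuous_lkKernel_left (x : ℝ) : Continuous fun u => lkKernel u x :=
  continuous_lkKernel.comp (by fun_prop : Continuous fun u : ℝ => (u, x))

theorem continuous_lkKernel_right (u : ℝ) : Continuous fun x => lkKernel u x :=
  continuous_lkKernel.comp (by fun_prop : Continuous fun x : ℝ => (u, x))

theorem IsLevyMeasure.integrable_lkKernel {M : Measure ℝ} (hM : IsLevyMeasure M) (u : ℝ) :
    Integrable (fun x => lkKernel u x) M :=
  (hM.integrable_min.const_mul (4 * (1 + u ^ 2))).mono'
    (continuous_lkKernel_right u).aestronglyMeasurable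
    (Eventually.of_forall fun x => norm_lkKernel_le' u x)

theorem setIntegral_compl_zero {E : Type*} [NormedAddCommGroup E] [NormedSpace ℝ E] {M : Measure ℝ}
    (hM : M {0} = 0) (f : ℝ → E) : ∫ x in ({0} : Set ℝ)ᶜ, f x ∂M = ∫ x, f x ∂M := by
  rw [Measure.restrict_eq_self_of_ae_mem]
  exact compl_mem_ae_iff.2 hM

theorem lkExp_eq (a v : ℝ) {M : Measure ℝ} (hM : M {0} = 0) (u : ℝ) :
    lkExp a v M u = Complex.I * u * a - (1 / 2) * v * u ^ 2 + ∫ x, lkKernel u x ∂M := by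
  rw [lkExp, setIntegral_compl_zero hM]

theorem IsLevyMeasure.continuous_integral_lkKernel {M : Measure ℝ} (hM : IsLevyMeasure M) :
    Continuous fun u => ∫ x, lkKernel u x ∂M := by
  refine continuous_iff_continuousAt.2 fun u₀ => ?_
  refine continuousAt_of_dominated (bound := fun x => 4 * (1 + (|u₀| + 1) ^ 2) * min 1 (x ^ 2))
    (Eventually.of_forall fun u => (continuous_lkKernel_right u).aestronglyMeasurable) ?_
    (hM.integrable_min.const_mul _)
    (Eventually.of_forall fun x => (continuous_lkKernel_left x).continuousAt)
  filter_upwards [Metric.ball_mem_nhds u₀ one_pos] with u hu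
  refine Eventually.of_forall fun x => (norm_lkKernel_le' u x).trans ?_
  have h1 : |u| ≤ |u₀| + 1 := by
    rw [Metric.mem_ball, Real.dist_eq] at hu
    linarith [abs_sub_abs_le_abs_sub u u₀]
  have h2 : u ^ 2 ≤ (|u₀| + 1) ^ 2 := by rw [← sq_abs u]; gcongr
  gcongr

theorem IsLevyMeasure.continuous_lkExp {M : Measure ℝ} (hM : IsLevyMeasure M) (a v : ℝ) :
    Continuous (lkExp a v M) := by
  have : lkExp a v M = fun u : ℝ => Complex.I * u * a - (1 / 2) * v * u ^ 2 + ∫ x, lkKernel u x ∂M :=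
    funext fun u => lkExp_eq a v hM.1 u
  rw [this]
  exact Continuous.add (by fun_prop) hM.continuous_integral_lkKernel

theorem lkExp_zero (a v : ℝ) (M : Measure ℝ) : lkExp a v M 0 = 0 := by
  simp [lkExp, lkKernel_zero_left]

theorem IsLevyMeasure.measure_lt_top {M : Measure ℝ} (hM : IsLevyMeasure M) {ε : ℝ} (hε : 0 < ε) :
    M {x | ε ≤ |x|} < ⊤ := by
  have h0 : 0 < min 1 (ε ^ 2) := by positivity
  have h := mul_meas_ge_le_lintegral₀ (μ := M)
    (by fun_prop : AEMeasurable (fun x : ℝ => ENNReal.ofReal (min 1 (x ^ 2))) M)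
    (ENNReal.ofReal (min 1 (ε ^ 2)))
  have hsub : {x : ℝ | ε ≤ |x|} ⊆
      {x | ENNReal.ofReal (min 1 (ε ^ 2)) ≤ ENNReal.ofReal (min 1 (x ^ 2))} := by
    intro x hx
    have : ε ^ 2 ≤ x ^ 2 := by rw [← sq_abs x]; exact pow_le_pow_left₀ hε.le hx 2
    exact ENNReal.ofReal_le_ofReal (min_le_min_left _ this)
  refine (measure_mono hsub).trans_lt ?_
  refine (ENNReal.mul_lt_top_iff.1 (h.trans_lt hM.2)).elim And.right fun h => ?_
  rcases h with h | h
  · simp only [ENNReal.ofReal_eq_zero] at h; linarith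
  · rw [h]; exact ENNReal.zero_lt_top

theorem measurableSet_le_abs (ε : ℝ) : MeasurableSet {x : ℝ | ε ≤ |x|} :=
  measurableSet_le measurable_const measurable_abs

theorem iUnion_le_abs : ⋃ n : ℕ, {x : ℝ | 1 / ((n : ℝ) + 1) ≤ |x|} = {0}ᶜ := by
  ext x
  simp only [mem_iUnion, mem_ofPred_eq, mem_compl_iff, mem_singleton_iff]
  constructor
  · rintro ⟨n, hn⟩ rfl
    have : 0 < 1 / ((n : ℝ) + 1) := by positivity
    simp at hn; linarith
  · intro hx
    obtain ⟨n, hn⟩ := exists_nat_one_div_lt (abs_pos.2 hx)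
    exact ⟨n, hn.le⟩

theorem IsLevyMeasure.sigmaFinite {M : Measure ℝ} (hM : IsLevyMeasure M) : SigmaFinite M := by
  refine ⟨⟨⟨fun n => Nat.casesOn n {0} fun n => {x : ℝ | 1 / ((n : ℝ) + 1) ≤ |x|}, fun _ => trivial,
    fun n => ?_, ?_⟩⟩⟩
  · cases n with
    | zero => simp [hM.1]
    | succ n => exact hM.measure_lt_top (by positivity)
  · refine eq_univ_of_forall fun x => ?_
    rw [mem_iUnion]
    by_cases hx : x = 0
    · exact ⟨0, hx⟩
    · have : x ∈ ⋃ n : ℕ, {x : ℝ | 1 / ((n : ℝ) + 1) ≤ |x|} := by rw [iUnion_le_abs]; exact hx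
      obtain ⟨n, hn⟩ := mem_iUnion.1 this
      exact ⟨n + 1, hn⟩

/-- The sufficiency half of the Lévy–Khintchine formula. On |x| ≥ 1/(n+1) the measure is finite, so
the restricted exponent belongs to a compound Poisson law shifted by the compensator; let n → ∞ and
convolve with a Gaussian law. -/
theorem isCharFun_exp_lkExp (a : ℝ) {v : ℝ} (hv : 0 ≤ v) {M : Measure ℝ} (hM : IsLevyMeasure M) :
    IsCharFun (fun u => Complex.exp (lkExp a v M u)) := by
  set S : ℕ → Set ℝ := fun n => {x : ℝ | 1 / ((n : ℝ) + 1) ≤ |x|} with hS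
  have hSm : ∀ n, MeasurableSet (S n) := fun n => measurableSet_le_abs _
  have hmono : Monotone S := fun m n hmn x hx => by
    have : 1 / ((n : ℝ) + 1) ≤ 1 / ((m : ℝ) + 1) :=
      one_div_le_one_div_of_le (by positivity) (by gcongr)
    exact this.trans hx
  have hfin : ∀ n, IsFiniteMeasure (M.restrict (S n)) := fun n =>
    ⟨by rw [Measure.restrict_apply_univ]; exact hM.measure_lt_top (by positivity)⟩
  have hstep : ∀ n, IsCharFun (fun u => Complex.exp (∫ x in S n, lkKernel u x ∂M)) := by
    intro n
    have hb : Integrable (fun x : ℝ => x / (1 + x ^ 2)) (M.restrict (S n)) := by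
      refine Integrable.of_bound (C := 1) (Measurable.aestronglyMeasurable (by fun_prop))
        (Eventually.of_forall fun x => ?_)
      rw [Real.norm_eq_abs, abs_div, abs_of_pos (by positivity : 0 < 1 + x ^ 2), div_le_one (by positivity),
        ← sq_abs]
      nlinarith [sq_nonneg (|x| - 1), abs_nonneg x]
    have := (isCharFun_compoundPoisson (M.restrict (S n))).mul
      (isCharFun_dirac (-∫ x in S n, x / (1 + x ^ 2) ∂M))
    refine (congrArg IsCharFun (funext fun u => ?_)).mp this
    rw [← Complex.exp_add]
    congr 1
    have e : ∀ x : ℝ, lkKernel u x = (Complex.exp (Complex.I * u * x) - 1) -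
        Complex.I * u * ((x / (1 + x ^ 2) : ℝ) : ℂ) := by
      intro x; rw [lkKernel]; push_cast; ring
    have i1 : Integrable (fun x : ℝ => Complex.exp (Complex.I * u * x) - 1) (M.restrict (S n)) :=
      (integrable_exp_I_mul _ u).sub (integrable_const _)
    have i2 : Integrable (fun x : ℝ => Complex.I * u * ((x / (1 + x ^ 2) : ℝ) : ℂ))
      (M.restrict (S n)) := hb.ofReal.const_mul _
    simp only [e]
    rw [integral_sub i1 i2, integral_const_mul, integral_complex_ofReal]
    push_cast
    ring
  choose P hP hPc using hstep
  have hlim : IsCharFun (fun u => Complex.exp (∫ x, lkKernel u x ∂M)) := by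
    refine isCharFun_of_tendsto hP ?_ fun u => ?_
    · exact (Complex.continuous_exp.comp hM.continuous_integral_lkKernel).continuousAt
    · simp only [hPc]
      refine (Complex.continuous_exp.tendsto _).comp ?_
      rw [← setIntegral_compl_zero hM.1, ← iUnion_le_abs]
      exact tendsto_setIntegral_of_monotone hSm hmono (hM.integrable_lkKernel u).integrableOn
  refine (congrArg IsCharFun (funext fun u => ?_)).mp ((isCharFun_gaussian a hv).mul hlim)
  rw [← Complex.exp_add, lkExp_eq a v hM.1]

theorem IsLevyMeasure.smul {M : Measure ℝ} (hM : IsLevyMeasure M) {c : ENNReal} (hc : c ≠ ⊤) :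
    IsLevyMeasure (c • M) := by
  refine ⟨by simp [hM.1], ?_⟩
  rw [lintegral_smul_measure]
  exact ENNReal.mul_lt_top hc.lt_top hM.2

theorem lkExp_smul (a v : ℝ) (M : Measure ℝ) {c : ℝ} (hc : 0 ≤ c) (u : ℝ) :
    lkExp (c * a) (c * v) (ENNReal.ofReal c • M) u = c * lkExp a v M u := by
  rw [lkExp, lkExp, Measure.restrict_smul, integral_smul_measure, ENNReal.toReal_ofReal hc,
    Complex.real_smul]
  push_cast; ring

/-- The triple divided by n is again admissible and provides the n-th convolution root. -/
theorem isInfDivisible_of_charFun_eq {a v : ℝ} (hv : 0 ≤ v) {M : Measure ℝ} (hM : IsLevyMeasure M)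
    {P : Measure ℝ} (hP : IsProbabilityMeasure P) (h : ∀ u, charFun P u = Complex.exp (lkExp a v M u)) :
    IsInfDivisible P := by
  refine ⟨hP, fun n hn => ?_⟩
  have hn' : (0 : ℝ) < n := by exact_mod_cast hn
  have hc : (0 : ℝ) ≤ 1 / n := by positivity
  obtain ⟨Q, hQ, hQc⟩ := isCharFun_exp_lkExp (1 / n * a) (mul_nonneg hc hv)
    (hM.smul (c := ENNReal.ofReal (1 / n)) ENNReal.ofReal_ne_top)
  refine ⟨Q, hQ, ?_⟩
  have := isProbabilityMeasure_convPower Q n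
  refine Measure.ext_of_charFun (funext fun u => ?_)
  rw [charFun_convPower, congrFun hQc u, h, lkExp_smul _ _ _ hc, ← Complex.exp_nat_mul]
  congr 1
  have : (n : ℂ) ≠ 0 := by exact_mod_cast hn.ne'
  push_cast
  field_simp

/-! ### Averaging a Lévy–Khintchine exponent over dilations -/

/-- `∫ f(e^{-s} u) s^{k-1}/(k-1)! ds`, and `f` for `k = 0`. -/
def erlangMean (k : ℕ) (f : ℝ → ℂ) (u : ℝ) : ℂ := ∫ s, f (Real.exp (-s) * u) ∂erlang k

theorem erlangMean_zero_right (k : ℕ) {f : ℝ → ℂ} (hf : f 0 = 0) : erlangMean k f 0 = 0 := by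
  simp [erlangMean, hf]

theorem erlangMean_zero_left (f : ℝ → ℂ) : erlangMean 0 f = f := by
  ext u; simp [erlangMean, erlang]

/-- The image of `M ⊗ κ` under `(x, s) ↦ e^{-s} x`. -/
def dilationMix (M κ : Measure ℝ) : Measure ℝ := (M.prod κ).map (fun p => Real.exp (-p.2) * p.1)

section Mix

variable {M κ : Measure ℝ}

theorem lintegral_dilationMix [SFinite κ] {f : ℝ → ENNReal} (hf : Measurable f) :
    ∫⁻ x, f x ∂dilationMix M κ = ∫⁻ x, ∫⁻ s, f (Real.exp (-s) * x) ∂κ ∂M := by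
  rw [dilationMix, lintegral_map hf (by fun_prop), lintegral_prod _ (by fun_prop)]

theorem ae_prod_nonneg (hκ : ∀ᵐ s ∂κ, 0 ≤ s) : ∀ᵐ p ∂M.prod κ, 0 ≤ p.2 :=
  Measure.quasiMeasurePreserving_snd.ae hκ

theorem integrable_min_prod [SFinite κ]
    (h : ∫⁻ x, ∫⁻ s, ENNReal.ofReal (min 1 (Real.exp (-s) * x ^ 2)) ∂κ ∂M < ⊤) :
    Integrable (fun p : ℝ × ℝ => min 1 (Real.exp (-p.2) * p.1 ^ 2)) (M.prod κ) := by
  refine ⟨by fun_prop, ?_⟩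
  rw [hasFiniteIntegral_iff_ofReal (Eventually.of_forall fun x => by positivity),
    lintegral_prod _ (by fun_prop)]
  exact h

variable [SFinite κ]

theorem integrable_lkKernel_prod (hκ : ∀ᵐ s ∂κ, 0 ≤ s)
    (h : ∫⁻ x, ∫⁻ s, ENNReal.ofReal (min 1 (Real.exp (-s) * x ^ 2)) ∂κ ∂M < ⊤) (u : ℝ) :
    Integrable (fun p : ℝ × ℝ => lkKernel (Real.exp (-p.2) * u) p.1) (M.prod κ) := by
  refine ((integrable_min_prod h).const_mul (4 * (1 + u ^ 2))).mono' ?_ ?_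
  · exact (continuous_lkKernel.comp
      (by fun_prop : Continuous fun p : ℝ × ℝ => (Real.exp (-p.2) * u, p.1))).aestronglyMeasurable
  · filter_upwards [ae_prod_nonneg hκ] with p hp
    exact norm_lkKernel_le (Real.exp_pos _).le (Real.exp_le_one_iff.2 (by linarith)) u p.1

theorem isLevyMeasure_dilationMix (hM : M {0} = 0) (hκ : ∀ᵐ s ∂κ, 0 ≤ s)
    (h : ∫⁻ x, ∫⁻ s, ENNReal.ofReal (min 1 (Real.exp (-s) * x ^ 2)) ∂κ ∂M < ⊤) :
    IsLevyMeasure (dilationMix M κ) := by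
  constructor
  · have : (fun p : ℝ × ℝ => Real.exp (-p.2) * p.1) ⁻¹' {0} = {0} ×ˢ univ := by
      ext p; simp [Real.exp_ne_zero]
    rw [dilationMix, Measure.map_apply (by fun_prop) (measurableSet_singleton 0), this,
      Measure.prod_prod, hM, zero_mul]
  · rw [lintegral_dilationMix (by fun_prop)]
    refine (lintegral_mono fun x => lintegral_mono_ae ?_).trans_lt h
    filter_upwards [hκ] with s hs
    refine ENNReal.ofReal_le_ofReal (min_le_min_left _ ?_)
    have he : Real.exp (-s) ≤ 1 := Real.exp_le_one_iff.2 (by linarith)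
    have he0 := Real.exp_pos (-s)
    rw [mul_pow]
    gcongr
    nlinarith

theorem hasTimeMoment_dilationMix (hκ : ∀ᵐ s ∂κ, 0 ≤ s) [IsFiniteMeasure κ] {k : ℕ}
    (h : HasTimeMoment k M) : HasTimeMoment k (dilationMix M κ) := by
  have hpt : ∀ x, ∀ᵐ s ∂κ, ∫⁻ r, ENNReal.ofReal (min 1 (Real.exp (-r) * (Real.exp (-s) * x) ^ 2))
      ∂erlang k ≤ ∫⁻ r, ENNReal.ofReal (min 1 (Real.exp (-r) * x ^ 2)) ∂erlang k := by
    intro x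
    filter_upwards [hκ] with s hs
    refine lintegral_mono fun r => ENNReal.ofReal_le_ofReal (min_le_min_left _ ?_)
    have he : Real.exp (-s) ≤ 1 := Real.exp_le_one_iff.2 (by linarith)
    have he0 := Real.exp_pos (-s)
    gcongr ?_ * ?_
    rw [mul_pow]
    exact mul_le_of_le_one_left (sq_nonneg x) (by nlinarith)
  refine ⟨(isLevyMeasure_dilationMix h.1 hκ ?_).1, ?_⟩
  · calc _ ≤ ∫⁻ x, ∫⁻ s, ENNReal.ofReal (min 1 (x ^ 2)) ∂κ ∂M := by
          refine lintegral_mono fun x => lintegral_mono_ae ?_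
          filter_upwards [hκ] with s hs
          refine ENNReal.ofReal_le_ofReal (min_le_min_left _ ?_)
          exact mul_le_of_le_one_left (sq_nonneg x) (Real.exp_le_one_iff.2 (by linarith))
      _ < ⊤ := by
          simp only [lintegral_const]
          rw [lintegral_mul_const _ (by fun_prop)]
          exact ENNReal.mul_lt_top h.isLevyMeasure.2 (measure_lt_top _ _)
  · rw [lintegral_dilationMix (measurable_lintegral_min _)]
    calc _ ≤ ∫⁻ x, ∫⁻ s, ∫⁻ r, ENNReal.ofReal (min 1 (Real.exp (-r) * x ^ 2)) ∂erlang k ∂κ ∂M :=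
          lintegral_mono fun x => lintegral_mono_ae (hpt x)
      _ < ⊤ := by
          simp only [lintegral_const]
          rw [lintegral_mul_const _ (measurable_lintegral_min _)]
          exact ENNReal.mul_lt_top h.2 (measure_lt_top _ _)

theorem integrable_compensator_prod (hκ : ∀ᵐ s ∂κ, 0 ≤ s)
    (h : ∫⁻ x, ∫⁻ s, ENNReal.ofReal (min 1 (Real.exp (-s) * x ^ 2)) ∂κ ∂M < ⊤) :
    Integrable (fun p : ℝ × ℝ => Real.exp (-p.2) * p.1 / (1 + (Real.exp (-p.2) * p.1) ^ 2) -
      Real.exp (-p.2) * p.1 / (1 + p.1 ^ 2)) (M.prod κ) := by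
  refine ((integrable_min_prod h).const_mul 2).mono' ?_ ?_
  · exact Measurable.aestronglyMeasurable (by fun_prop)
  · filter_upwards [ae_prod_nonneg hκ] with p hp
    exact abs_compensator_sub_le (Real.exp_pos _).le (Real.exp_le_one_iff.2 (by linarith)) p.1

variable [SFinite M]

/-- The average of a Lévy–Khintchine exponent over dilations is one as well. -/
theorem exists_integral_lkExp_eq (hM : M {0} = 0) (hκ : ∀ᵐ s ∂κ, 0 ≤ s)
    (hκ1 : Integrable (fun s => Real.exp (-s)) κ)
    (h : ∫⁻ x, ∫⁻ s, ENNReal.ofReal (min 1 (Real.exp (-s) * x ^ 2)) ∂κ ∂M < ⊤) (a : ℝ) {v : ℝ}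
    (hv : 0 ≤ v) : ∃ a' v' : ℝ, 0 ≤ v' ∧ ∀ u : ℝ,
      Integrable (fun s => lkExp a v M (Real.exp (-s) * u)) κ ∧
      ∫ s, lkExp a v M (Real.exp (-s) * u) ∂κ = lkExp a' v' (dilationMix M κ) u := by
  have hκ2 : Integrable (fun s => Real.exp (-s) ^ 2) κ := by
    refine hκ1.mono' (by fun_prop) ?_
    filter_upwards [hκ] with s hs
    have he : Real.exp (-s) ≤ 1 := Real.exp_le_one_iff.2 (by linarith)
    have he0 := Real.exp_pos (-s)
    rw [Real.norm_eq_abs, abs_of_nonneg (by positivity)]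
    nlinarith
  -- Dilation by e^{-s} multiplies the drift by e^{-s} and the variance by e^{-2s}. The additional
  -- drift appears because the compensator x/(1+x²) does not commute with dilations of x.
  refine ⟨a * (∫ s, Real.exp (-s) ∂κ) + ∫ p, (Real.exp (-p.2) * p.1 /
    (1 + (Real.exp (-p.2) * p.1) ^ 2) - Real.exp (-p.2) * p.1 / (1 + p.1 ^ 2)) ∂M.prod κ,
    v * ∫ s, Real.exp (-s) ^ 2 ∂κ, mul_nonneg hv (integral_nonneg fun s => by positivity), fun u => ?_⟩
  have hL := isLevyMeasure_dilationMix hM hκ h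
  have e : (fun s => lkExp a v M (Real.exp (-s) * u)) = fun s =>
      Complex.I * u * a * ((Real.exp (-s) : ℝ) : ℂ) - (1 / 2) * v * u ^ 2 * ((Real.exp (-s) ^ 2 : ℝ) : ℂ)
        + ∫ x, lkKernel (Real.exp (-s) * u) x ∂M := by
    ext s
    rw [lkExp_eq a v hM]
    push_cast; ring
  have i1 : Integrable (fun s => Complex.I * u * a * ((Real.exp (-s) : ℝ) : ℂ)) κ :=
    hκ1.ofReal.const_mul _
  have i2 : Integrable (fun s => (1 / 2) * v * (u : ℂ) ^ 2 * ((Real.exp (-s) ^ 2 : ℝ) : ℂ)) κ :=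
    hκ2.ofReal.const_mul _
  have i3 : Integrable (fun s => ∫ x, lkKernel (Real.exp (-s) * u) x ∂M) κ :=
    (integrable_lkKernel_prod hκ h u).integral_prod_right
  have i12 : Integrable (fun s => Complex.I * u * a * ((Real.exp (-s) : ℝ) : ℂ) -
    (1 / 2) * v * (u : ℂ) ^ 2 * ((Real.exp (-s) ^ 2 : ℝ) : ℂ)) κ := i1.sub i2
  refine ⟨by rw [e]; exact i12.add i3, ?_⟩
  rw [e, integral_add i12 i3, integral_sub i1 i2, integral_const_mul, integral_const_mul,
    integral_complex_ofReal, integral_complex_ofReal, lkExp_eq _ _ hL.1,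
    ← integral_prod_symm _ (integrable_lkKernel_prod hκ h u), dilationMix,
    integral_map (by fun_prop) (continuous_lkKernel_right u).aestronglyMeasurable]
  have e2 : ∀ p : ℝ × ℝ, lkKernel u (Real.exp (-p.2) * p.1) = lkKernel (Real.exp (-p.2) * u) p.1 -
      Complex.I * u * ((Real.exp (-p.2) * p.1 / (1 + (Real.exp (-p.2) * p.1) ^ 2) -
      Real.exp (-p.2) * p.1 / (1 + p.1 ^ 2) : ℝ) : ℂ) := by
    intro p
    have e3 : Complex.I * (u : ℂ) * ((Real.exp (-p.2) * p.1 : ℝ) : ℂ) =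
        Complex.I * ((Real.exp (-p.2) * u : ℝ) : ℂ) * p.1 := by push_cast; ring
    rw [lkKernel, lkKernel, e3]
    push_cast; ring
  have i4 : Integrable (fun p : ℝ × ℝ => Complex.I * (u : ℂ) * ((Real.exp (-p.2) * p.1 /
      (1 + (Real.exp (-p.2) * p.1) ^ 2) - Real.exp (-p.2) * p.1 / (1 + p.1 ^ 2) : ℝ) : ℂ))
      (M.prod κ) := (integrable_compensator_prod hκ h).ofReal.const_mul _
  simp only [e2]
  rw [integral_sub (integrable_lkKernel_prod hκ h u) i4, integral_const_mul, integral_complex_ofReal]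
  push_cast
  ring

end Mix

theorem integrable_exp_neg_erlang (k : ℕ) : Integrable (fun s => Real.exp (-s)) (erlang k) := by
  simpa using integrable_erlang_exp k one_pos

theorem HasTimeMoment.exists_erlangMean_eq {k : ℕ} {M : Measure ℝ} (h : HasTimeMoment k M) (a : ℝ)
    {v : ℝ} (hv : 0 ≤ v) : ∃ (a' v' : ℝ) (M' : Measure ℝ), 0 ≤ v' ∧ IsLevyMeasure M' ∧
      erlangMean k (lkExp a v M) = lkExp a' v' M' := by
  have := h.isLevyMeasure.sigmaFinite
  obtain ⟨a', v', hv', h'⟩ := exists_integral_lkExp_eq h.1 (ae_erlang_nonneg k)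
    (integrable_exp_neg_erlang k) h.2 a hv
  exact ⟨a', v', _, hv', isLevyMeasure_dilationMix h.1 (ae_erlang_nonneg k) h.2,
    funext fun u => (h' u).2⟩

theorem HasTimeMoment.integrable_erlang {k : ℕ} {M : Measure ℝ} (h : HasTimeMoment k M) (a : ℝ)
    {v : ℝ} (hv : 0 ≤ v) (u : ℝ) :
    Integrable (fun s => lkExp a v M (Real.exp (-s) * u)) (erlang k) := by
  have := h.isLevyMeasure.sigmaFinite
  obtain ⟨a', v', hv', h'⟩ := exists_integral_lkExp_eq h.1 (ae_erlang_nonneg k)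
    (integrable_exp_neg_erlang k) h.2 a hv
  exact (h' u).1

theorem HasTimeMoment.continuous_erlangMean {k : ℕ} {M : Measure ℝ} (h : HasTimeMoment k M) (a : ℝ)
    {v : ℝ} (hv : 0 ≤ v) : Continuous (erlangMean k (lkExp a v M)) := by
  obtain ⟨a', v', M', -, hM', e⟩ := h.exists_erlangMean_eq a hv
  rw [e]
  exact hM'.continuous_lkExp a' v'

theorem integrable_erlang_succ_iff_conv {k : ℕ} {g : ℝ → ℂ} (hg : Integrable g (erlang (k + 1))) :
    IntegrableOn (fun s => ∫ r, g (s + r) ∂erlang k) (Ioi 0) ∧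
    ∫ s, g s ∂erlang (k + 1) = ∫ s in Ioi (0 : ℝ), ∫ r, g (s + r) ∂erlang k := by
  rw [erlang] at hg ⊢
  refine ⟨?_, integral_conv hg⟩
  rw [Measure.conv] at hg
  exact ((integrable_map_measure hg.aestronglyMeasurable (by fun_prop)).1 hg).integral_prod_left

theorem HasTimeMoment.erlangMean_succ {k : ℕ} {M : Measure ℝ} (h : HasTimeMoment (k + 1) M) (a : ℝ)
    {v : ℝ} (hv : 0 ≤ v) (u : ℝ) :
    IntegrableOn (fun s => erlangMean k (lkExp a v M) (Real.exp (-s) * u)) (Ioi 0) ∧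
    erlangMean (k + 1) (lkExp a v M) u =
      ∫ s in Ioi (0 : ℝ), erlangMean k (lkExp a v M) (Real.exp (-s) * u) := by
  have := integrable_erlang_succ_iff_conv (h.integrable_erlang a hv u)
  have e : ∀ s r : ℝ, Real.exp (-(s + r)) * u = Real.exp (-r) * (Real.exp (-s) * u) := by
    intro s r; rw [neg_add, Real.exp_add]; ring
  simp only [e] at this
  exact this

theorem setIntegral_Ioi_comp_add (T : ℝ) (f : ℝ → ℂ) :
    ∫ r in Ioi (0 : ℝ), f (r + T) = ∫ q in Ioi T, f q := by
  rw [← integral_indicator measurableSet_Ioi, ← integral_indicator measurableSet_Ioi,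
    ← integral_add_right_eq_self ((Ioi T).indicator f) T]
  congr with r
  simp [indicator]

/-- The increments of an iterated average along dilations. -/
theorem HasTimeMoment.erlangMean_sub {k : ℕ} {M : Measure ℝ} (h : HasTimeMoment (k + 1) M) (a : ℝ)
    {v : ℝ} (hv : 0 ≤ v) (u : ℝ) {T : ℝ} (hT : 0 ≤ T) :
    erlangMean (k + 1) (lkExp a v M) u - erlangMean (k + 1) (lkExp a v M) (Real.exp (-T) * u) =
      ∫ s in Ioc 0 T, erlangMean k (lkExp a v M) (Real.exp (-s) * u) := by
  obtain ⟨hi, he⟩ := h.erlangMean_succ a hv u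
  set G := erlangMean k (lkExp a v M) with hG
  have e2 : erlangMean (k + 1) (lkExp a v M) (Real.exp (-T) * u) =
      ∫ s in Ioi T, G (Real.exp (-s) * u) := by
    rw [(h.erlangMean_succ a hv _).2]
    rw [← setIntegral_Ioi_comp_add T (fun s => G (Real.exp (-s) * u))]
    refine integral_congr_ae (Eventually.of_forall fun s => ?_)
    simp only [neg_add, Real.exp_add]
    rw [← hG]
    congr 1; ring
  rw [he, e2, ← Ioc_union_Ioi_eq_Ioi hT, setIntegral_union (Ioc_disjoint_Ioi le_rfl) measurableSet_Ioi
    (hi.mono_set Ioc_subset_Ioi_self) (hi.mono_set (Ioi_subset_Ioi hT))]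
  ring

/-! ### Urbanik's classes -/

theorem IsUrbanik.isProbabilityMeasure {k : ℕ} {ν : Measure ℝ} (h : IsUrbanik k ν) :
    IsProbabilityMeasure ν := by
  cases k <;> exact h.1

theorem eq_conv_iff_charFun {ν νc : Measure ℝ} [IsProbabilityMeasure ν] [IsProbabilityMeasure νc] {c : ℝ} :
    ν = (ν.map (fun x => c * x)).conv νc ↔ ∀ u, charFun ν u = charFun ν (c * u) * charFun νc u := by
  have : IsProbabilityMeasure (ν.map (fun x => c * x)) :=
    Measure.isProbabilityMeasure_map (by fun_prop)
  have e : ∀ u, charFun ((ν.map (fun x => c * x)).conv νc) u = charFun ν (c * u) * charFun νc u := by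
    intro u; rw [charFun_conv, charFun_map_mul]
  constructor
  · intro h u
    rw [← e, ← h]
  · intro h
    exact Measure.ext_of_charFun (funext fun u => by rw [h, e])

theorem isUrbanik_zero_iff {ν : Measure ℝ} : IsUrbanik 0 ν ↔ IsProbabilityMeasure ν ∧
    ∀ c : ℝ, 0 < c → c < 1 → ∃ νc : Measure ℝ, IsProbabilityMeasure νc ∧
      ∀ u, charFun ν u = charFun ν (c * u) * charFun νc u := by
  refine and_congr_right fun hν => forall_congr' fun c => forall_congr' fun _ => forall_congr' fun _ =>
    exists_congr fun νc => and_congr_right fun hνc => eq_conv_iff_charFun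

theorem isUrbanik_succ_iff {k : ℕ} {ν : Measure ℝ} : IsUrbanik (k + 1) ν ↔ IsProbabilityMeasure ν ∧
    ∀ c : ℝ, 0 < c → c < 1 → ∃ νc : Measure ℝ, IsUrbanik k νc ∧
      ∀ u, charFun ν u = charFun ν (c * u) * charFun νc u := by
  refine and_congr_right fun hν => forall_congr' fun c => forall_congr' fun _ => forall_congr' fun _ =>
    exists_congr fun νc => and_congr_right fun hνc => ?_
  have := hνc.isProbabilityMeasure
  exact eq_conv_iff_charFun

theorem isUrbanik_dirac_zero (k : ℕ) : IsUrbanik k (Measure.dirac 0) := by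
  induction k with
  | zero =>
    rw [isUrbanik_zero_iff]
    exact ⟨inferInstance, fun c _ _ => ⟨Measure.dirac 0, inferInstance, fun u => by simp⟩⟩
  | succ k ih =>
    rw [isUrbanik_succ_iff]
    exact ⟨inferInstance, fun c _ _ => ⟨Measure.dirac 0, ih, fun u => by simp⟩⟩

theorem IsUrbanik.conv {k : ℕ} {ν₁ ν₂ : Measure ℝ} (h₁ : IsUrbanik k ν₁) (h₂ : IsUrbanik k ν₂) :
    IsUrbanik k (ν₁.conv ν₂) := by
  induction k generalizing ν₁ ν₂ with
  | zero =>
    rw [isUrbanik_zero_iff] at *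
    have := h₁.1
    have := h₂.1
    refine ⟨inferInstance, fun c h0 h1 => ?_⟩
    obtain ⟨ρ₁, hρ₁, e₁⟩ := h₁.2 c h0 h1
    obtain ⟨ρ₂, hρ₂, e₂⟩ := h₂.2 c h0 h1
    refine ⟨ρ₁.conv ρ₂, inferInstance, fun u => ?_⟩
    rw [charFun_conv, charFun_conv, charFun_conv, e₁, e₂]; ring
  | succ k ih =>
    rw [isUrbanik_succ_iff] at *
    have := h₁.1
    have := h₂.1
    refine ⟨inferInstance, fun c h0 h1 => ?_⟩
    obtain ⟨ρ₁, hρ₁, e₁⟩ := h₁.2 c h0 h1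
    obtain ⟨ρ₂, hρ₂, e₂⟩ := h₂.2 c h0 h1
    have := hρ₁.isProbabilityMeasure
    have := hρ₂.isProbabilityMeasure
    refine ⟨ρ₁.conv ρ₂, ih hρ₁ hρ₂, fun u => ?_⟩
    rw [charFun_conv, charFun_conv, charFun_conv, e₁, e₂]; ring

theorem IsUrbanik.convPower {k : ℕ} {ν : Measure ℝ} (h : IsUrbanik k ν) (n : ℕ) :
    IsUrbanik k (convPower ν n) := by
  induction n with
  | zero => exact isUrbanik_dirac_zero k
  | succ n ih => exact ih.conv h

/-- Since the characteristic functions do not vanish, those of the cofactors are determined as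
quotients. The quotients converge pointwise to a continuous function, so the continuity theorem
provides the limiting cofactor. -/
theorem exists_tendsto_cofactor {ν : Measure ℝ} [IsProbabilityMeasure ν] (hν0 : ∀ u, charFun ν u ≠ 0)
    {νn : ℕ → Measure ℝ} (hn0 : ∀ n u, charFun (νn n) u ≠ 0)
    (hlim : ∀ u, Tendsto (fun n => charFun (νn n) u) atTop (𝓝 (charFun ν u))) {c : ℝ}
    {ρ : ℕ → Measure ℝ} (hρ : ∀ n, IsProbabilityMeasure (ρ n))
    (e : ∀ n u, charFun (νn n) u = charFun (νn n) (c * u) * charFun (ρ n) u) :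
    ∃ νc : Measure ℝ, IsProbabilityMeasure νc ∧
      (∀ u, charFun ν u = charFun ν (c * u) * charFun νc u) ∧
      ∀ u, Tendsto (fun n => charFun (ρ n) u) atTop (𝓝 (charFun νc u)) := by
  have e' : ∀ n u, charFun (ρ n) u = charFun (νn n) u / charFun (νn n) (c * u) := fun n u => by
    rw [e n u, mul_div_cancel_left₀ _ (hn0 _ _)]
  have hl : ∀ u, Tendsto (fun n => charFun (ρ n) u) atTop (𝓝 (charFun ν u / charFun ν (c * u))) := by
    intro u
    simp only [e']
    exact (hlim u).div (hlim _) (hν0 _)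
  obtain ⟨νc, hνc, h⟩ := isCharFun_of_tendsto hρ (φ := fun u => charFun ν u / charFun ν (c * u))
    (Continuous.continuousAt (Continuous.div (by fun_prop) (by fun_prop) fun u => hν0 _)) hl
  refine ⟨νc, hνc, fun u => ?_, fun u => ?_⟩
  · rw [h, mul_div_cancel₀ _ (hν0 _)]
  · rw [h]; exact hl u

/-- Induction on k: the limiting cofactor is a limit of cofactors in the class below. The
nonvanishing hypotheses pass to cofactors, which are factors of nonvanishing functions. -/
theorem isUrbanik_of_tendsto {k : ℕ} {ν : Measure ℝ} [IsProbabilityMeasure ν]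
    (hν0 : ∀ u, charFun ν u ≠ 0) {νn : ℕ → Measure ℝ} (hn : ∀ n, IsUrbanik k (νn n))
    (hn0 : ∀ n u, charFun (νn n) u ≠ 0)
    (hlim : ∀ u, Tendsto (fun n => charFun (νn n) u) atTop (𝓝 (charFun ν u))) : IsUrbanik k ν := by
  induction k generalizing ν νn with
  | zero =>
    simp only [isUrbanik_zero_iff] at *
    refine ⟨inferInstance, fun c h0 h1 => ?_⟩
    choose ρ hρ e using fun n => (hn n).2 c h0 h1
    obtain ⟨νc, hνc, h, -⟩ := exists_tendsto_cofactor hν0 hn0 hlim hρ e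
    exact ⟨νc, hνc, h⟩
  | succ k ih =>
    simp only [isUrbanik_succ_iff] at *
    refine ⟨inferInstance, fun c h0 h1 => ?_⟩
    choose ρ hρ e using fun n => (hn n).2 c h0 h1
    obtain ⟨νc, hνc, h, h'⟩ := exists_tendsto_cofactor hν0 hn0 hlim
      (fun n => (hρ n).isProbabilityMeasure) e
    exact ⟨νc, ih (fun u h0 => hν0 u (by rw [h, h0, mul_zero])) hρ
      (fun n u h0 => hn0 n u (by rw [e, h0, mul_zero])) h', h⟩

/-! ### Laws of random integrals are in Urbanik's classes -/

/-- Averaging over dilations with 0 < s ≤ T commutes with the Erlang average. Being an average over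
a finite measure of contractions, it turns the triple into another one with the same k-th time
moment. Thus an increment of a (k+1)-fold average is a k-fold average. -/
theorem HasTimeMoment.integral_Ioc_erlangMean {k : ℕ} {M : Measure ℝ} (h : HasTimeMoment (k + 1) M)
    (a : ℝ) {v : ℝ} (hv : 0 ≤ v) (T : ℝ) : ∃ (a' v' : ℝ) (M' : Measure ℝ), 0 ≤ v' ∧
      HasTimeMoment k M' ∧ ∀ u, ∫ s in Ioc 0 T, erlangMean k (lkExp a v M) (Real.exp (-s) * u) =
        erlangMean k (lkExp a' v' M') u := by
  have hσ := h.isLevyMeasure.sigmaFinite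
  set κ : Measure ℝ := volume.restrict (Ioc 0 T) with hκ
  have hκ0 : ∀ᵐ s ∂κ, 0 ≤ s := by
    filter_upwards [ae_restrict_mem measurableSet_Ioc] with s hs using hs.1.le
  have hκ1 : Integrable (fun s => Real.exp (-s)) κ := by
    refine Integrable.of_bound (C := 1) (by fun_prop) ?_
    filter_upwards [hκ0] with s hs
    rw [Real.norm_eq_abs, abs_of_pos (Real.exp_pos _)]
    exact Real.exp_le_one_iff.2 (by linarith)
  have hfin : ∫⁻ x, ∫⁻ s, ENNReal.ofReal (min 1 (Real.exp (-s) * x ^ 2)) ∂κ ∂M < ⊤ := by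
    calc _ ≤ ∫⁻ x, ∫⁻ s, ENNReal.ofReal (min 1 (x ^ 2)) ∂κ ∂M := by
          refine lintegral_mono fun x => lintegral_mono_ae ?_
          filter_upwards [hκ0] with s hs
          refine ENNReal.ofReal_le_ofReal (min_le_min_left _ ?_)
          exact mul_le_of_le_one_left (sq_nonneg x) (Real.exp_le_one_iff.2 (by linarith))
      _ < ⊤ := by
          simp only [lintegral_const]
          rw [lintegral_mul_const _ (by fun_prop)]
          exact ENNReal.mul_lt_top h.isLevyMeasure.2 (measure_lt_top _ _)
  obtain ⟨a', v', hv', e⟩ := exists_integral_lkExp_eq h.1 hκ0 hκ1 hfin a hv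
  refine ⟨a', v', _, hv', hasTimeMoment_dilationMix hκ0 h.of_succ, fun u => ?_⟩
  have hint := h.integrable_erlang a hv u
  rw [erlang, Measure.conv] at hint
  have hint2 : Integrable (fun p : ℝ × ℝ => lkExp a v M (Real.exp (-(p.1 + p.2)) * u))
      ((volume.restrict (Ioi (0 : ℝ))).prod (erlang k)) :=
    (integrable_map_measure hint.aestronglyMeasurable (by fun_prop)).1 hint
  have hint3 : Integrable (fun p : ℝ × ℝ => lkExp a v M (Real.exp (-(p.1 + p.2)) * u))
      (κ.prod (erlang k)) :=
    hint2.mono_measure (Measure.prod_mono (Measure.restrict_mono Ioc_subset_Ioi_self le_rfl) le_rfl)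
  simp only [erlangMean]
  have e1 : ∀ s r : ℝ, Real.exp (-r) * (Real.exp (-s) * u) = Real.exp (-(s + r)) * u := by
    intro s r; rw [neg_add, Real.exp_add]; ring
  simp only [e1]
  rw [integral_integral_swap hint3]
  refine integral_congr_ae (Eventually.of_forall fun r => ?_)
  simp only
  rw [← (e _).2]
  refine integral_congr_ae (Eventually.of_forall fun s => ?_)
  simp only
  rw [neg_add, Real.exp_add, mul_assoc]

/-- For c ∈ (0,1) take T = -log c: the increment χ(u) - χ(cu) is a k-fold average and thus the
exponent of a probability measure, the cofactor. The induction runs over all triples, since the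
cofactor is driven by a different one. -/
theorem isUrbanik_of_charFun_eq {k : ℕ} {a v : ℝ} (hv : 0 ≤ v) {M : Measure ℝ}
    (h : HasTimeMoment (k + 1) M) {ν : Measure ℝ} (hν : IsProbabilityMeasure ν)
    (hc : ∀ u, charFun ν u = Complex.exp (erlangMean (k + 1) (lkExp a v M) u)) : IsUrbanik k ν := by
  induction k generalizing a v M ν with
  | zero =>
    rw [isUrbanik_zero_iff]
    refine ⟨hν, fun c h0 h1 => ?_⟩
    obtain ⟨a', v', M', hv', hM', e⟩ := h.integral_Ioc_erlangMean a hv (-Real.log c)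
    obtain ⟨νc, hνc, e'⟩ := isCharFun_exp_lkExp a' hv' ((hasTimeMoment_zero_iff M').1 hM')
    refine ⟨νc, hνc, fun u => ?_⟩
    have hT : 0 ≤ -Real.log c := by linarith [Real.log_neg h0 h1]
    have := h.erlangMean_sub a hv u hT
    rw [e, erlangMean_zero_left, neg_neg, Real.exp_log h0] at this
    rw [hc, hc, congrFun e' u, ← this, ← Complex.exp_add]
    congr 1; ring
  | succ k ih =>
    rw [isUrbanik_succ_iff]
    refine ⟨hν, fun c h0 h1 => ?_⟩
    obtain ⟨a', v', M', hv', hM', e⟩ := h.integral_Ioc_erlangMean a hv (-Real.log c)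
    obtain ⟨a'', v'', M'', hv'', hM'', e''⟩ := hM'.exists_erlangMean_eq a' hv'
    obtain ⟨νc, hνc, e'⟩ := isCharFun_exp_lkExp a'' hv'' hM''
    refine ⟨νc, ih hv' hM' hνc fun u => by rw [e'', congrFun e' u], fun u => ?_⟩
    have hT : 0 ≤ -Real.log c := by linarith [Real.log_neg h0 h1]
    have := h.erlangMean_sub a hv u hT
    rw [e, e'', neg_neg, Real.exp_log h0] at this
    rw [hc, hc, congrFun e' u, ← this, ← Complex.exp_add]
    congr 1; ring

/-! ### Continuous logarithms -/

/-- All values of f lie in 2πiℤ. If f 1 were nonzero, ‖f‖ would reach the value π by the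
intermediate value theorem, but π is no multiple of 2π. -/
theorem eq_zero_of_exp_eq_one {f : ℝ → ℂ} (hf : ContinuousOn f (Icc 0 1))
    (h : ∀ t ∈ Icc (0 : ℝ) 1, Complex.exp (f t) = 1) (h0 : f 0 = 0) : f 1 = 0 := by
  by_contra hne
  have hval : ∀ t ∈ Icc (0 : ℝ) 1, ∃ n : ℤ, ‖f t‖ = |(n : ℝ)| * (2 * Real.pi) := by
    intro t ht
    obtain ⟨n, hn⟩ := Complex.exp_eq_one_iff.1 (h t ht)
    refine ⟨n, ?_⟩
    rw [hn]
    simp [abs_of_pos Real.pi_pos]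
  have hpi := Real.pi_pos
  have hbig : Real.pi ≤ ‖f 1‖ := by
    obtain ⟨n, hn⟩ := hval 1 (by simp)
    have hn0 : n ≠ 0 := by
      rintro rfl
      simp at hn
      exact hne hn
    have : (1 : ℝ) ≤ |(n : ℝ)| := by exact_mod_cast Int.one_le_abs hn0
    rw [hn]; nlinarith
  obtain ⟨t, ht, htp⟩ := intermediate_value_Icc zero_le_one hf.norm
    (show Real.pi ∈ Icc ‖f 0‖ ‖f 1‖ from ⟨by simp [h0, hpi.le], hbig⟩)
  obtain ⟨n, hn⟩ := hval t ht
  simp only at htp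
  rw [htp] at hn
  have h2 : 2 * |(n : ℝ)| = 1 := by
    have : Real.pi * (2 * |(n : ℝ)| - 1) = 0 := by linarith
    rcases mul_eq_zero.1 this with h | h
    · exact absurd h hpi.ne'
    · linarith
  have h3 : 2 * |n| = 1 := by exact_mod_cast h2
  omega

theorem continuousLog_unique {f g : ℝ → ℂ} (hf : Continuous f) (hg : Continuous g) (hf0 : f 0 = 0)
    (hg0 : g 0 = 0) (h : ∀ u, Complex.exp (f u) = Complex.exp (g u)) : f = g := by
  funext u
  have := eq_zero_of_exp_eq_one (f := fun t => f (t * u) - g (t * u)) (by fun_prop)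
    (fun t _ => by rw [Complex.exp_sub, h, div_self (Complex.exp_ne_zero _)]) (by simp [hf0, hg0])
  simp only [one_mul] at this
  exact sub_eq_zero.1 this

theorem IsCharExponent.unique {μ : Measure ℝ} {f g : ℝ → ℂ} (hf : IsCharExponent μ f)
    (hg : IsCharExponent μ g) : f = g :=
  continuousLog_unique hf.1 hg.1 hf.2.1 hg.2.1 fun u => by rw [← hf.2.2, hg.2.2]

/-- Along the segment from 0 to u the exponential stays in the disc of radius 1/2 about 1, where the
principal logarithm is continuous. It therefore agrees with r, as both are continuous logarithms
starting at 0. -/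
theorem eq_log_exp_of_norm_le {r : ℝ → ℂ} (hr : Continuous r) (hr0 : r 0 = 0) {u : ℝ}
    (h : ∀ t ∈ Icc (0 : ℝ) 1, ‖Complex.exp (r (t * u)) - 1‖ ≤ 1 / 2) :
    r u = Complex.log (Complex.exp (r u)) := by
  have hslit : ∀ t ∈ Icc (0 : ℝ) 1, Complex.exp (r (t * u)) ∈ Complex.slitPlane := by
    intro t ht
    refine Complex.mem_slitPlane_of_norm_lt_one (z := Complex.exp (r (t * u)) - 1)
      ((h t ht).trans_lt (by norm_num)) |> fun h => ?_
    simpa using h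
  have := eq_zero_of_exp_eq_one (f := fun t => r (t * u) - Complex.log (Complex.exp (r (t * u))))
    (ContinuousOn.sub (by fun_prop) (ContinuousOn.clog (by fun_prop) hslit))
    (fun t _ => by
      rw [Complex.exp_sub, Complex.exp_log (Complex.exp_ne_zero _), div_self (Complex.exp_ne_zero _)])
    (by simp [hr0])
  simp only [one_mul] at this
  exact sub_eq_zero.1 this

theorem norm_sub_exp_sub_one_le {r : ℝ → ℂ} (hr : Continuous r) (hr0 : r 0 = 0) {u δ : ℝ}
    (hδ : δ ≤ 1 / 2) (h : ∀ t ∈ Icc (0 : ℝ) 1, ‖Complex.exp (r (t * u)) - 1‖ ≤ δ) :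
    ‖r u - (Complex.exp (r u) - 1)‖ ≤ δ ^ 2 := by
  set z := Complex.exp (r u) - 1 with hz
  have hzδ : ‖z‖ ≤ δ := by simpa using h 1 (by simp)
  have e : r u = Complex.log (1 + z) := by
    rw [eq_log_exp_of_norm_le hr hr0 fun t ht => (h t ht).trans hδ]
    congr 1; rw [hz]; ring
  rw [e]
  refine (Complex.norm_log_one_add_sub_self_le (by linarith)).trans ?_
  have h1 : (1 - ‖z‖)⁻¹ ≤ 2 := by
    rw [inv_le_comm₀ (by linarith) two_pos]; linarith
  calc ‖z‖ ^ 2 * (1 - ‖z‖)⁻¹ / 2 ≤ ‖z‖ ^ 2 * 2 / 2 := by gcongr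
    _ = ‖z‖ ^ 2 := by ring
    _ ≤ δ ^ 2 := by gcongr

/-! ### Truncation and centering -/

/-- The truncation of `x` to `[-1, 1]`. -/
def clip (x : ℝ) : ℝ := max (-1) (min 1 x)

theorem continuous_clip : Continuous clip := by unfold clip; fun_prop

theorem abs_clip_le_one (x : ℝ) : |clip x| ≤ 1 := by
  rw [abs_le, clip]
  exact ⟨le_max_left _ _, max_le (by norm_num) (min_le_left _ _)⟩

theorem clip_of_abs_le {x : ℝ} (h : |x| ≤ 1) : clip x = x := by
  rw [abs_le] at h
  rw [clip, min_eq_right h.2, max_eq_right h.1]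

theorem clip_sq (x : ℝ) : clip x ^ 2 = min 1 (x ^ 2) := by
  rcases le_or_gt |x| 1 with h | h
  · rw [clip_of_abs_le h, min_eq_right]
    rw [← sq_abs]; nlinarith [abs_nonneg x]
  · have h1 : 1 ≤ x ^ 2 := by rw [← sq_abs]; nlinarith
    rw [min_eq_left h1]
    rcases lt_abs.1 h with h2 | h2
    · rw [clip, min_eq_left h2.le]; norm_num
    · rw [clip, min_eq_right (by linarith), max_eq_left (by linarith)]; norm_num

theorem abs_clip_sub_clip_le (x y : ℝ) : |clip x - clip y| ≤ |x - y| := by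
  unfold clip
  refine (abs_max_sub_max_le_max _ _ _ _).trans ?_
  simp only [sub_self, abs_zero]
  refine max_le (abs_nonneg _) ((abs_min_sub_min_le_max _ _ _ _).trans ?_)
  simp

theorem clip_sub_clip_sq_le (x y : ℝ) : (clip x - clip y) ^ 2 ≤ 4 * min 1 ((x - y) ^ 2) := by
  have h1 := abs_clip_sub_clip_le x y
  have h2 : |clip x - clip y| ≤ 2 := (abs_sub _ _).trans (by
    linarith [abs_clip_le_one x, abs_clip_le_one y])
  rw [mul_min_of_nonneg _ _ (by norm_num), ← sq_abs]
  refine le_min ?_ ?_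
  · nlinarith [abs_nonneg (clip x - clip y)]
  · rw [← sq_abs (x - y)]
    nlinarith [abs_nonneg (clip x - clip y), abs_nonneg (x - y)]

theorem integrable_clip (P : Measure ℝ) [IsFiniteMeasure P] (y : ℝ) :
    Integrable (fun x => clip (x - y)) P :=
  Integrable.of_bound (C := 1) (continuous_clip.comp (by fun_prop)).aestronglyMeasurable
    (Eventually.of_forall fun x => abs_clip_le_one _)

/-- The integral depends continuously on y and tends to 1 as y → -∞ and to -1 as y → ∞. Since the
truncation is bounded, a centre exists without any moment assumption. -/
theorem exists_integral_clip_sub_eq_zero (P : Measure ℝ) [IsProbabilityMeasure P] :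
    ∃ y, ∫ x, clip (x - y) ∂P = 0 := by
  have hm : ∀ y : ℝ, AEStronglyMeasurable (fun x => clip (x - y)) P := fun y =>
    (integrable_clip P y).aestronglyMeasurable
  have hcont : Continuous fun y => ∫ x, clip (x - y) ∂P :=
    continuous_of_dominated (bound := fun _ => 1) hm
      (fun y => Eventually.of_forall fun x => abs_clip_le_one _) (integrable_const _)
      (Eventually.of_forall fun x => continuous_clip.comp (by fun_prop))
  have hbot : Tendsto (fun y => ∫ x, clip (x - y) ∂P) atBot (𝓝 (∫ _, (1 : ℝ) ∂P)) := by
    refine tendsto_integral_filter_of_dominated_convergence (fun _ => 1) (Eventually.of_forall hm)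
      (Eventually.of_forall fun y => Eventually.of_forall fun x => abs_clip_le_one _)
      (integrable_const _) (Eventually.of_forall fun x => tendsto_const_nhds.congr' ?_)
    filter_upwards [eventually_le_atBot (x - 1)] with y hy
    rw [clip, min_eq_left (by linarith)]; norm_num
  have htop : Tendsto (fun y => ∫ x, clip (x - y) ∂P) atTop (𝓝 (∫ _, (-1 : ℝ) ∂P)) := by
    refine tendsto_integral_filter_of_dominated_convergence (fun _ => 1) (Eventually.of_forall hm)
      (Eventually.of_forall fun y => Eventually.of_forall fun x => abs_clip_le_one _)
      (integrable_const _) (Eventually.of_forall fun x => tendsto_const_nhds.congr' ?_)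
    filter_upwards [eventually_ge_atTop (x + 1)] with y hy
    rw [clip, min_eq_right (by linarith), max_eq_left (by linarith)]
  simp only [integral_const, probReal_univ, smul_eq_mul, one_mul] at hbot htop
  obtain ⟨y₁, h₁⟩ := (hbot.eventually_const_lt (show (0 : ℝ) < 1 by norm_num)).exists
  obtain ⟨y₂, h₂⟩ := (htop.eventually_lt_const (show (-1 : ℝ) < 0 by norm_num)).exists
  exact mem_range_of_exists_le_of_exists_ge hcont ⟨y₂, h₂.le⟩ ⟨y₁, h₁.le⟩

theorem integral_cos_sub_prod (P : Measure ℝ) [IsFiniteMeasure P] (u : ℝ) :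
    ∫ p : ℝ × ℝ, Real.cos (u * (p.1 - p.2)) ∂P.prod P = ‖charFun P u‖ ^ 2 := by
  have hb : ∀ f : ℝ → ℝ, Continuous f → (∀ x, |f x| ≤ 1) → Integrable f P := fun f hf h =>
    Integrable.of_bound (C := 1) hf.aestronglyMeasurable (Eventually.of_forall h)
  have hc := hb (fun x => Real.cos (u * x)) (by fun_prop) fun x => Real.abs_cos_le_one _
  have hs := hb (fun x => Real.sin (u * x)) (by fun_prop) fun x => Real.abs_sin_le_one _
  have e : ∀ p : ℝ × ℝ, Real.cos (u * (p.1 - p.2)) = Real.cos (u * p.1) * Real.cos (u * p.2) +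
      Real.sin (u * p.1) * Real.sin (u * p.2) := fun p => by rw [mul_sub, Real.cos_sub]
  have hchar : charFun P u = ((∫ x, Real.cos (u * x) ∂P : ℝ) : ℂ) +
      ((∫ x, Real.sin (u * x) ∂P : ℝ) : ℂ) * Complex.I := by
    rw [charFun_apply_real, ← integral_complex_ofReal, ← integral_complex_ofReal,
      ← integral_mul_const, ← integral_add hc.ofReal (hs.ofReal.mul_const _)]
    congr with x
    rw [← Complex.ofReal_mul, Complex.exp_mul_I]
    simp
  simp only [e]
  rw [integral_add (hc.mul_prod hc) (hs.mul_prod hs), integral_prod_mul (fun x => Real.cos (u * x)) fun x => Real.cos (u * x),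
    integral_prod_mul (fun x => Real.sin (u * x)) fun x => Real.sin (u * x), hchar, Complex.sq_norm, Complex.normSq_add_mul_I]
  ring

/-- Symmetrisation. For independent X, X' with law P, centring gives E(clip X - clip X')² = 2 E
clip²(X). The left side is at most 4 E min(1, (X - X')²), because `clip` is 1-Lipschitz and bounded
by 1, and X - X' has characteristic function |φ|². The averaged cosine bound contributes 15, so the
constant is 4·15/2 = 30. -/
theorem integral_clip_sq_le (P : Measure ℝ) [IsProbabilityMeasure P] (h0 : ∫ x, clip x ∂P = 0) :
    ∫ x, clip x ^ 2 ∂P ≤ 30 * ∫ u in (0 : ℝ)..1, (1 - ‖charFun P u‖ ^ 2) := by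
  have hc : Integrable clip P := by simpa using integrable_clip P 0
  have hc2 : Integrable (fun x => clip x ^ 2) P :=
    Integrable.of_bound (C := 1) (by have := continuous_clip; fun_prop) (Eventually.of_forall fun x => by
      rw [Real.norm_eq_abs, abs_pow]; exact pow_le_one₀ (abs_nonneg _) (abs_clip_le_one x))
  have h1 : ∫ p : ℝ × ℝ, (clip p.1 - clip p.2) ^ 2 ∂P.prod P = 2 * ∫ x, clip x ^ 2 ∂P := by
    have e : ∀ p : ℝ × ℝ, (clip p.1 - clip p.2) ^ 2 =
        clip p.1 ^ 2 * 1 + 1 * clip p.2 ^ 2 - 2 * (clip p.1 * clip p.2) := fun p => by ring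
    have i1 : Integrable (fun p : ℝ × ℝ => clip p.1 ^ 2 * (1 : ℝ)) (P.prod P) :=
      hc2.mul_prod (integrable_const 1)
    have i2 : Integrable (fun p : ℝ × ℝ => (1 : ℝ) * clip p.2 ^ 2) (P.prod P) :=
      (integrable_const (1 : ℝ)).mul_prod hc2
    have i12 : Integrable (fun p : ℝ × ℝ => clip p.1 ^ 2 * (1 : ℝ) + (1 : ℝ) * clip p.2 ^ 2)
      (P.prod P) := i1.add i2
    have i3 : Integrable (fun p : ℝ × ℝ => 2 * (clip p.1 * clip p.2)) (P.prod P) :=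
      (hc.mul_prod hc).const_mul 2
    simp only [e]
    rw [integral_sub i12 i3, integral_add i1 i2, integral_const_mul (2 : ℝ), integral_prod_mul clip clip,
      integral_prod_mul (fun x => clip x ^ 2) fun _ => (1 : ℝ),
      integral_prod_mul (fun _ => (1 : ℝ)) fun x => clip x ^ 2, h0]
    simp
    ring
  have hcos : ∀ u : ℝ, Integrable (fun p : ℝ × ℝ => Real.cos (u * (p.1 - p.2))) (P.prod P) := fun u =>
    Integrable.of_bound (C := 1) (by fun_prop) (Eventually.of_forall fun p => Real.abs_cos_le_one _)
  have hF : Integrable (Function.uncurry fun (p : ℝ × ℝ) (u : ℝ) => 1 - Real.cos (u * (p.1 - p.2)))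
      ((P.prod P).prod (volume.restrict (Ioc 0 1))) := by
    refine Integrable.of_bound (C := 2) (by unfold Function.uncurry; fun_prop)
      (Eventually.of_forall fun p => ?_)
    simp only [Function.uncurry]
    rw [Real.norm_eq_abs, abs_le]
    constructor <;> linarith [Real.cos_le_one (p.2 * (p.1.1 - p.1.2)),
      Real.neg_one_le_cos (p.2 * (p.1.1 - p.1.2))]
  have h2 : ∫ p : ℝ × ℝ, (clip p.1 - clip p.2) ^ 2 ∂P.prod P ≤
      ∫ p : ℝ × ℝ, 60 * (∫ u in Ioc (0 : ℝ) 1, (1 - Real.cos (u * (p.1 - p.2)))) ∂P.prod P := by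
    refine integral_mono_of_nonneg (Eventually.of_forall fun p => sq_nonneg _)
      (hF.integral_prod_left.const_mul 60) (Eventually.of_forall fun p => ?_)
    simp only
    rw [← intervalIntegral.integral_of_le zero_le_one]
    linarith [clip_sub_clip_sq_le p.1 p.2, min_one_sq_le_integral_one_sub_cos (p.1 - p.2)]
  have hswap := integral_integral_swap hF
  rw [integral_const_mul, hswap] at h2
  have h3 : ∫ u in Ioc (0 : ℝ) 1, ∫ p : ℝ × ℝ, (1 - Real.cos (u * (p.1 - p.2))) ∂P.prod P =
      ∫ u in (0 : ℝ)..1, (1 - ‖charFun P u‖ ^ 2) := by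
    rw [intervalIntegral.integral_of_le zero_le_one]
    refine integral_congr_ae (Eventually.of_forall fun u => ?_)
    simp only
    rw [integral_sub (integrable_const _) (hcos u), integral_cos_sub_prod]
    simp
  rw [h1, h3] at h2
  linarith

/-- The Lévy–Khintchine integrand compensated by the truncation. -/
def clipKernel (u x : ℝ) : ℂ := Complex.exp (Complex.I * u * x) - 1 - Complex.I * u * clip x

theorem norm_clipKernel_le (u x : ℝ) : ‖clipKernel u x‖ ≤ 3 * (1 + u ^ 2) * clip x ^ 2 := by
  have e1 : Complex.I * (u : ℂ) * x = Complex.I * ((u * x : ℝ) : ℂ) := by push_cast; ring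
  have e2 : Complex.I * (u : ℂ) * clip x = Complex.I * ((u * clip x : ℝ) : ℂ) := by push_cast; ring
  rcases le_or_gt |x| 1 with h | h
  · rw [clipKernel, clip_of_abs_le h, e1]
    refine (norm_exp_I_mul_sub_one_sub_le _).trans ?_
    nlinarith [sq_nonneg x]
  · have h1 : 1 ≤ x ^ 2 := by rw [← sq_abs]; nlinarith
    rw [clip_sq, min_eq_left h1, mul_one, clipKernel, e1, e2]
    refine (norm_sub_le _ _).trans ?_
    have h2 := norm_exp_I_mul_sub_one_le_two (u * x)
    have h3 : ‖Complex.I * ((u * clip x : ℝ) : ℂ)‖ ≤ |u| := by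
      rw [norm_mul, Complex.norm_I, one_mul, Complex.norm_real, Real.norm_eq_abs, abs_mul]
      exact mul_le_of_le_one_right (abs_nonneg u) (abs_clip_le_one x)
    rw [← sq_abs u]
    nlinarith [sq_nonneg (|u| - 1), abs_nonneg u]

/-- `clipKernel u x / clip x ^ 2`, continued to `x = 0`. -/
def normKernel (u x : ℝ) : ℂ := if x = 0 then -(u : ℂ) ^ 2 / 2 else clipKernel u x / (clip x : ℂ) ^ 2

theorem clip_eq_zero_iff {x : ℝ} : clip x = 0 ↔ x = 0 := by
  rw [← sq_eq_zero_iff, clip_sq]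
  constructor
  · intro h
    rcases min_choice 1 (x ^ 2) with h' | h' <;> rw [h'] at h
    · norm_num at h
    · exact sq_eq_zero_iff.1 h
  · rintro rfl; simp

theorem clip_sq_mul_normKernel (u x : ℝ) : (clip x : ℂ) ^ 2 * normKernel u x = clipKernel u x := by
  by_cases hx : x = 0
  · have : clip 0 = 0 := clip_eq_zero_iff.2 rfl
    subst hx
    simp [clipKernel, this]
  · have : (clip x : ℂ) ≠ 0 := by exact_mod_cast mt clip_eq_zero_iff.1 hx
    rw [normKernel, if_neg hx]; field_simp

theorem norm_normKernel_le (u x : ℝ) : ‖normKernel u x‖ ≤ 3 * (1 + u ^ 2) := by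
  by_cases hx : x = 0
  · rw [normKernel, if_pos hx]
    simp only [norm_div, norm_neg, norm_pow, Complex.norm_real, Real.norm_eq_abs, sq_abs,
      RCLike.norm_ofNat]
    nlinarith [sq_nonneg u]
  · have h0 : 0 < clip x ^ 2 := by have := mt clip_eq_zero_iff.1 hx; positivity
    rw [normKernel, if_neg hx, norm_div, norm_pow, Complex.norm_real, Real.norm_eq_abs, sq_abs,
      div_le_iff₀ h0]
    exact norm_clipKernel_le u x

theorem norm_exp_I_mul_sub_quadratic_le {z : ℝ} (hz : |z| ≤ 1) :
    ‖Complex.exp (Complex.I * z) - 1 - Complex.I * z + (z : ℂ) ^ 2 / 2‖ ≤ |z| ^ 3 := by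
  have hn : ‖Complex.I * (z : ℂ)‖ = |z| := by simp
  have h := Complex.exp_bound (x := Complex.I * z) (by rw [hn]; exact hz) (n := 3) (by norm_num)
  rw [hn] at h
  have e : ∑ m ∈ Finset.range 3, (Complex.I * (z : ℂ)) ^ m / (m.factorial : ℂ) =
      1 + Complex.I * z - (z : ℂ) ^ 2 / 2 := by
    simp [Finset.sum_range_succ, mul_pow, Nat.factorial]
    ring
  rw [e] at h
  have h' : |z| ^ 3 * (((3 : ℕ).succ : ℝ) * (((3 : ℕ).factorial : ℝ) * ((3 : ℕ) : ℝ))⁻¹) ≤ |z| ^ 3 := by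
    refine mul_le_of_le_one_right (by positivity) ?_
    norm_num [Nat.factorial]
  refine (le_of_eq ?_).trans (h.trans h')
  congr 1; ring

/-- The value -u²/2 at 0 is the Taylor limit of the quotient. With it the kernel is a bounded
continuous test function, and mass that collects at 0 in a weak limit becomes the Gaussian part. -/
theorem continuous_normKernel (u : ℝ) : Continuous (normKernel u) := by
  refine continuous_iff_continuousAt.2 fun x => ?_
  by_cases hx : x = 0
  · subst hx
    rw [ContinuousAt, normKernel, if_pos rfl, tendsto_iff_norm_sub_tendsto_zero]
    have hlim : Tendsto (fun x : ℝ => |u| ^ 3 * |x|) (𝓝 0) (𝓝 0) := by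
      have : Continuous fun x : ℝ => |u| ^ 3 * |x| := by fun_prop
      simpa using this.tendsto 0
    refine squeeze_zero' (Eventually.of_forall fun x => norm_nonneg _) ?_ hlim
    have hu : ∀ᶠ x : ℝ in 𝓝 0, |u * x| < 1 := by
      have : Continuous fun x : ℝ => |u * x| := by fun_prop
      exact (this.tendsto 0).eventually_lt_const (by simp)
    have h1 : ∀ᶠ x : ℝ in 𝓝 0, |x| < 1 := by
      have : Continuous fun x : ℝ => |x| := by fun_prop
      exact (this.tendsto 0).eventually_lt_const (by simp)
    filter_upwards [hu, h1] with x hux hx1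
    by_cases hx : x = 0
    · simp [normKernel, hx]
    · have hxc : (x : ℂ) ≠ 0 := by exact_mod_cast hx
      rw [normKernel, if_neg hx, clipKernel, clip_of_abs_le hx1.le]
      have e : (Complex.exp (Complex.I * u * x) - 1 - Complex.I * u * x) / (x : ℂ) ^ 2 - -(u : ℂ) ^ 2 / 2
          = (Complex.exp (Complex.I * ((u * x : ℝ) : ℂ)) - 1 - Complex.I * ((u * x : ℝ) : ℂ) +
            ((u * x : ℝ) : ℂ) ^ 2 / 2) / (x : ℂ) ^ 2 := by
        push_cast
        rw [← mul_assoc]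
        field_simp
        ring
      rw [e, norm_div, norm_pow, Complex.norm_real, Real.norm_eq_abs, div_le_iff₀ (by positivity)]
      refine (norm_exp_I_mul_sub_quadratic_le hux.le).trans_eq ?_
      rw [abs_mul]; ring
  · have hc : ContinuousAt (fun x => clipKernel u x / (clip x : ℂ) ^ 2) x := by
      have hcl := continuous_clip
      refine ContinuousAt.div (by unfold clipKernel; fun_prop) (by fun_prop) ?_
      have := mt clip_eq_zero_iff.1 hx
      exact pow_ne_zero _ (by exact_mod_cast this)
    refine hc.congr ?_
    filter_upwards [isOpen_ne.mem_nhds hx] with y hy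
    rw [normKernel, if_neg hy]

theorem abs_compensator_sub_clip_le (x : ℝ) : |x / (1 + x ^ 2) - clip x| ≤ 2 * min 1 (x ^ 2) := by
  have hx2 : 0 < 1 + x ^ 2 := by positivity
  rcases le_or_gt |x| 1 with h | h
  · have hxx : x ^ 2 ≤ 1 := by rw [← sq_abs]; nlinarith [abs_nonneg x]
    rw [clip_of_abs_le h, min_eq_right hxx]
    have e : x / (1 + x ^ 2) - x = -(x * x ^ 2 / (1 + x ^ 2)) := by field_simp; ring
    rw [e, abs_neg, abs_div, abs_of_pos hx2, abs_mul, abs_of_nonneg (sq_nonneg x)]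
    refine (div_le_self (by positivity) (by nlinarith)).trans ?_
    nlinarith [sq_nonneg x]
  · have hx1 : 1 ≤ x ^ 2 := by rw [← sq_abs]; nlinarith
    rw [min_eq_left hx1]
    have h1 : |x / (1 + x ^ 2)| ≤ 1 := by
      rw [abs_div, abs_of_pos hx2, div_le_one hx2, ← sq_abs]
      nlinarith [sq_nonneg (|x| - 1), abs_nonneg x]
    linarith [abs_sub (x / (1 + x ^ 2)) (clip x), abs_clip_le_one x]

/-! ### Limit lemmas -/

theorem tendsto_one_div_succ_nhdsNE :
    Tendsto (fun n : ℕ => 1 / ((n : ℝ) + 1)) atTop (𝓝[≠] 0) :=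
  tendsto_nhdsWithin_iff.2 ⟨tendsto_one_div_add_atTop_nhds_zero_nat,
    Eventually.of_forall fun n => by simp only [mem_compl_iff, mem_singleton_iff]; positivity⟩

/-- The difference quotient telescopes under the integral into the mean of f just after 0 minus its
mean just after T. Continuity of f suffices. -/
theorem tendsto_integral_difference {f : ℝ → ℂ} (hf : Continuous f) (T : ℝ) :
    Tendsto (fun n : ℕ => ∫ s in (0 : ℝ)..T, ((n : ℝ) + 1 : ℝ) • (f s - f (s + 1 / ((n : ℝ) + 1))))
      atTop (𝓝 (f 0 - f T)) := by
  set Φ : ℝ → ℂ := fun x => ∫ s in (0 : ℝ)..x, f s with hΦ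
  have hd : ∀ x, HasDerivAt Φ (f x) x := fun x =>
    intervalIntegral.integral_hasDerivAt_right (hf.intervalIntegrable _ _)
      hf.aestronglyMeasurable.stronglyMeasurableAtFilter hf.continuousAt
  have hs : ∀ x, Tendsto (fun n : ℕ => ((n : ℝ) + 1 : ℝ) • (Φ (x + 1 / ((n : ℝ) + 1)) - Φ x)) atTop
      (𝓝 (f x)) := by
    intro x
    refine ((hasDerivAt_iff_tendsto_slope_zero.1 (hd x)).comp tendsto_one_div_succ_nhdsNE).congr
      fun n => ?_
    simp
  refine ((hs 0).sub (hs T)).congr fun n => ?_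
  rw [intervalIntegral.integral_smul, intervalIntegral.integral_sub (hf.intervalIntegrable _ _)
    (Continuous.intervalIntegrable (by fun_prop) _ _), intervalIntegral.integral_comp_add_right,
    ← smul_sub]
  congr 1
  have h1 := intervalIntegral.integral_interval_sub_left (hf.intervalIntegrable 0 (T + 1 / ((n : ℝ) + 1)) (μ := volume))
    (hf.intervalIntegrable 0 (0 + 1 / ((n : ℝ) + 1)))
  rw [← h1]
  simp only [hΦ, intervalIntegral.integral_same]
  ring

/-- The change of variables u ↦ cu leaves the integral over [cδ, δ] and a multiple 1/c - 1 of the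
integral over [0, cδ]. Both are of order 1 - c, even though g is only continuous. -/
theorem integral_sub_comp_mul_le {g : ℝ → ℝ} (hg : Continuous g) {c δ S : ℝ} (hc : 0 < c) (hc1 : c ≤ 1)
    (hδ : 0 ≤ δ) (hS : ∀ u ∈ Icc 0 δ, |g u| ≤ S) :
    ∫ u in (0 : ℝ)..δ, (g u - g (c * u)) ≤ 2 * S * δ * (1 - c) := by
  have hcδ : c * δ ≤ δ := mul_le_of_le_one_left hδ hc1
  have hcδ0 : 0 ≤ c * δ := by positivity
  rw [intervalIntegral.integral_sub (hg.intervalIntegrable _ _)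
    (Continuous.intervalIntegrable (by fun_prop) _ _), intervalIntegral.integral_comp_mul_left _ hc.ne',
    mul_zero, ← intervalIntegral.integral_add_adjacent_intervals (hg.intervalIntegrable 0 (c * δ))
    (hg.intervalIntegrable (c * δ) δ)]
  have h1 : ‖∫ u in (c * δ)..δ, g u‖ ≤ S * |δ - c * δ| :=
    intervalIntegral.norm_integral_le_of_norm_le_const fun u hu => by
      rw [uIoc_of_le hcδ] at hu
      exact hS u ⟨hcδ0.trans hu.1.le, hu.2⟩
  have h2 : ‖∫ u in (0 : ℝ)..(c * δ), g u‖ ≤ S * |c * δ - 0| :=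
    intervalIntegral.norm_integral_le_of_norm_le_const fun u hu => by
      rw [uIoc_of_le hcδ0] at hu
      exact hS u ⟨hu.1.le, hu.2.trans hcδ⟩
  rw [abs_of_nonneg (by linarith), Real.norm_eq_abs] at h1
  rw [sub_zero, abs_of_nonneg hcδ0, Real.norm_eq_abs] at h2
  have h3 := (abs_le.1 h1).2
  have h4 := (abs_le.1 h2).1
  have h5 : 0 ≤ c⁻¹ - 1 := by linarith [(one_le_inv₀ hc).2 hc1]
  have h6 : (c⁻¹ - 1) * -(∫ u in (0 : ℝ)..(c * δ), g u) ≤ (c⁻¹ - 1) * (S * (c * δ)) := by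
    gcongr; linarith
  have h7 : (c⁻¹ - 1) * (S * (c * δ)) = S * δ * (1 - c) := by field_simp
  rw [smul_eq_mul]
  nlinarith

/-- Prokhorov's theorem for finite measures: first make the masses converge. If they tend to 0, the
limit is the zero measure; otherwise normalise, extract a limit of probability measures and multiply
by the limiting mass. -/
theorem exists_subseq_tendsto_of_tight {m : ℕ → Measure ℝ} [∀ n, IsFiniteMeasure (m n)] {K : ℝ}
    (hK : ∀ n, (m n).real univ ≤ K)
    (ht : ∀ ε > 0, ∃ R : ℝ, ∃ n₀ : ℕ, ∀ n ≥ n₀, (m n).real {x | R < |x|} ≤ ε) :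
    ∃ φ : ℕ → ℕ, StrictMono φ ∧ ∃ μ : Measure ℝ, IsFiniteMeasure μ ∧
      ∀ f : BoundedContinuousFunction ℝ ℂ,
        Tendsto (fun j => ∫ x, f x ∂m (φ j)) atTop (𝓝 (∫ x, f x ∂μ)) := by
  obtain ⟨L, hL, φ₁, hφ₁, hlim⟩ := isCompact_Icc.tendsto_subseq
    (x := fun n => (m n).real univ) (s := Icc 0 K) fun n => ⟨measureReal_nonneg, hK n⟩
  rcases hL.1.eq_or_lt with hL0 | hL0
  · subst hL0
    refine ⟨φ₁, hφ₁, 0, inferInstance, fun f => ?_⟩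
    rw [integral_zero_measure]
    have : Tendsto (fun j => ‖f‖ * (m (φ₁ j)).real univ) atTop (𝓝 0) := by
      simpa using hlim.const_mul ‖f‖
    refine squeeze_zero_norm (fun j => ?_) this
    exact norm_integral_le_of_norm_le_const (Eventually.of_forall fun x => f.norm_coe_le_norm x)
  · obtain ⟨N, hN⟩ := eventually_atTop.1 (hlim.eventually_const_lt (half_lt_self hL0))
    simp only [Function.comp_apply] at hN
    set φ₂ : ℕ → ℕ := fun j => φ₁ (j + N) with hφ₂
    have hφ₂m : StrictMono φ₂ := fun i j hij => hφ₁ (by omega)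
    have hmass : ∀ j, L / 2 < (m (φ₂ j)).real univ := fun j => hN _ (by omega)
    have hlim₂ : Tendsto (fun j => (m (φ₂ j)).real univ) atTop (𝓝 L) :=
      hlim.comp (tendsto_add_atTop_nat N)
    have hne : ∀ j, NeZero (m (φ₂ j)) := fun j => ⟨fun h => by
      have := hmass j; rw [h] at this; simp at this; linarith⟩
    set p : ℕ → ProbabilityMeasure ℝ := fun j =>
      ⟨(m (φ₂ j) univ)⁻¹ • m (φ₂ j), inferInstance⟩ with hp
    have hpr : ∀ j (s : Set ℝ), (p j : Measure ℝ).real s = ((m (φ₂ j)).real univ)⁻¹ * (m (φ₂ j)).real s := by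
      intro j s
      simp [hp, Measure.real, ENNReal.toReal_mul, ENNReal.toReal_inv]
    have htight : IsTightMeasureSet (range fun j => (p j : Measure ℝ)) := by
      refine isTightMeasureSet_range_of_tendsto_limsup_measure_norm_gt ?_
      rw [ENNReal.tendsto_nhds_zero]
      intro ε hε
      rcases eq_or_ne ε ⊤ with rfl | hεt
      · exact Eventually.of_forall fun _ => le_top
      · have hε' : 0 < ε.toReal := ENNReal.toReal_pos hε.ne' hεt
        obtain ⟨R, n₀, hR⟩ := ht (L / 2 * ε.toReal) (by positivity)
        filter_upwards [eventually_ge_atTop R] with r hr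
        refine limsup_le_of_le (h := ?_)
        filter_upwards [eventually_ge_atTop n₀] with j hj
        rw [← ENNReal.ofReal_toReal hεt, ← ofReal_measureReal]
        refine ENNReal.ofReal_le_ofReal ?_
        rw [hpr, inv_mul_le_iff₀ (by linarith [hmass j])]
        have h1 : (m (φ₂ j)).real {x : ℝ | r < ‖x‖} ≤ (m (φ₂ j)).real {x | R < |x|} :=
          measureReal_mono fun x hx => lt_of_le_of_lt hr hx
        have h2 := hR (φ₂ j) (hj.trans (hφ₂m.id_le j))
        have h3 := hmass j
        nlinarith
    have hcomp : IsCompact (closure (range p)) :=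
      isCompact_closure_of_isTightMeasureSet (by
        convert! htight using 1; ext; simp)
    obtain ⟨q, -, φ₃, hφ₃, hq⟩ := hcomp.tendsto_subseq (x := p) fun j => subset_closure (mem_range_self j)
    rw [ProbabilityMeasure.tendsto_iff_forall_integral_rclike_tendsto ℂ] at hq
    refine ⟨φ₂ ∘ φ₃, hφ₂m.comp hφ₃, ENNReal.ofReal L • (q : Measure ℝ),
      Measure.smul_finite _ ENNReal.ofReal_ne_top, fun f => ?_⟩
    rw [integral_smul_measure, ENNReal.toReal_ofReal hL0.le]
    refine ((hlim₂.comp hφ₃.tendsto_atTop).smul (hq f)).congr fun j => ?_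
    have hm0 : (m (φ₂ (φ₃ j))).real univ ≠ 0 := by linarith [hmass (φ₃ j)]
    have hpj : (((p ∘ φ₃) j : ProbabilityMeasure ℝ) : Measure ℝ) =
      (m (φ₂ (φ₃ j)) univ)⁻¹ • m (φ₂ (φ₃ j)) := rfl
    simp only [Function.comp_apply] at hpj ⊢
    rw [hpj, integral_smul_measure, ENNReal.toReal_inv, smul_smul]
    change ((m (φ₂ (φ₃ j))).real univ * ((m (φ₂ (φ₃ j))).real univ)⁻¹) • _ = _
    rw [mul_inv_cancel₀ hm0, one_smul]

/-! ### From finite measures to Lévy measures -/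

/-- The measure `W⁻¹ m` on the complement of `0`. -/
def unweight (W : ℝ → ℝ) (m : Measure ℝ) : Measure ℝ :=
  (m.restrict {0}ᶜ).withDensity (fun x => ENNReal.ofReal (1 / W x))

theorem unweight_singleton_zero (W : ℝ → ℝ) (m : Measure ℝ) : unweight W m {0} = 0 := by
  refine withDensity_absolutelyContinuous _ _ ?_
  rw [Measure.restrict_apply (measurableSet_singleton 0)]
  simp

theorem withDensity_unweight {W : ℝ → ℝ} (hW : Measurable W) (hpos : ∀ x, x ≠ 0 → 0 < W x)
    (m : Measure ℝ) :
    (unweight W m).withDensity (fun x => ENNReal.ofReal (W x)) = m.restrict {0}ᶜ := by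
  rw [unweight, ← withDensity_mul _ (by fun_prop) (by fun_prop)]
  refine Eq.trans (withDensity_congr_ae ?_) withDensity_one
  filter_upwards [ae_restrict_mem (measurableSet_singleton (0 : ℝ)).compl] with x hx
  have := hpos x hx
  simp only [Pi.mul_apply, Pi.one_apply]
  rw [← ENNReal.ofReal_mul (by positivity), one_div_mul_cancel this.ne', ENNReal.ofReal_one]

theorem eq_dirac_add_restrict_compl (m : Measure ℝ) :
    m = m {0} • Measure.dirac 0 + m.restrict {0}ᶜ := by
  conv_lhs => rw [← Measure.restrict_add_restrict_compl (μ := m) (measurableSet_singleton (0 : ℝ)),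
    Measure.restrict_singleton]

theorem isLevyMeasure_unweight_clip (m : Measure ℝ) [IsFiniteMeasure m] :
    IsLevyMeasure (unweight (fun x => clip x ^ 2) m) := by
  have hc := continuous_clip
  refine ⟨unweight_singleton_zero _ _, ?_⟩
  have h := withDensity_unweight (W := fun x => clip x ^ 2) (by fun_prop)
    (fun x hx => by have := mt clip_eq_zero_iff.1 hx; positivity) m
  have h2 := congrArg (fun μ : Measure ℝ => μ univ) h
  simp only [withDensity_apply _ MeasurableSet.univ, Measure.restrict_univ, clip_sq] at h2
  simp only [clip_sq]
  rw [h2]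
  exact measure_lt_top _ _

/-- The atom of m at 0 becomes the variance and the remaining part divided by clip² becomes the Lévy
measure. Replacing the compensator clip x by x/(1+x²) changes only the drift. -/
theorem exists_lkExp_eq_integral_normKernel (a : ℝ) (m : Measure ℝ) [IsFiniteMeasure m] :
    ∃ (a' v : ℝ) (M : Measure ℝ), 0 ≤ v ∧ IsLevyMeasure M ∧
      ∀ u, Complex.I * u * a + ∫ x, normKernel u x ∂m = lkExp a' v M u := by
  have hc := continuous_clip
  set M := unweight (fun x => clip x ^ 2) m with hM
  have hL : IsLevyMeasure M := isLevyMeasure_unweight_clip m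
  have hi : Integrable (fun x : ℝ => x / (1 + x ^ 2) - clip x) M :=
    (hL.integrable_min.const_mul 2).mono' (Measurable.aestronglyMeasurable (by fun_prop))
      (Eventually.of_forall abs_compensator_sub_clip_le)
  have hnk : ∀ u, Integrable (normKernel u) m := fun u =>
    Integrable.of_bound (C := 3 * (1 + u ^ 2)) (continuous_normKernel u).aestronglyMeasurable
      (Eventually.of_forall (norm_normKernel_le u))
  refine ⟨a + ∫ x, (x / (1 + x ^ 2) - clip x) ∂M, m.real {0}, M, measureReal_nonneg, hL, fun u => ?_⟩
  have e1 : ∫ x, normKernel u x ∂m = m.real {0} • normKernel u 0 +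
      ∫ x in ({0} : Set ℝ)ᶜ, normKernel u x ∂m := by
    rw [← integral_singleton, integral_add_compl (measurableSet_singleton 0) (hnk u)]
  have e2 : ∫ x in ({0} : Set ℝ)ᶜ, normKernel u x ∂m = ∫ x, clipKernel u x ∂M := by
    rw [← withDensity_unweight (W := fun x => clip x ^ 2) (by fun_prop)
      (fun x hx => by have := mt clip_eq_zero_iff.1 hx; positivity) m,
      integral_withDensity_eq_integral_toReal_smul (by fun_prop) (by simp)]
    refine integral_congr_ae (Eventually.of_forall fun x => ?_)
    simp only
    rw [ENNReal.toReal_ofReal (sq_nonneg _), Complex.real_smul, ← clip_sq_mul_normKernel]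
    push_cast; rfl
  have e3 : ∀ x, clipKernel u x = lkKernel u x +
      Complex.I * u * ((x / (1 + x ^ 2) - clip x : ℝ) : ℂ) := by
    intro x; rw [clipKernel, lkKernel]; push_cast; ring
  have i2 : Integrable (fun x : ℝ => Complex.I * (u : ℂ) * ((x / (1 + x ^ 2) - clip x : ℝ) : ℂ)) M :=
    hi.ofReal.const_mul _
  rw [e1, e2, lkExp_eq _ _ hL.1]
  simp only [e3]
  rw [integral_add (hL.integrable_lkKernel u) i2, integral_const_mul, integral_complex_ofReal,
    normKernel, if_pos rfl, Complex.real_smul]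
  push_cast
  ring

/-! ### Cofactors of a selfdecomposable measure -/

/-- The exponent of the cofactor of a selfdecomposable measure with exponent `χ` for `c = e^{-h}`. -/
def dilationDiff (χ : ℝ → ℂ) (h u : ℝ) : ℂ := χ u - χ (Real.exp (-h) * u)

theorem continuous_dilationDiff {χ : ℝ → ℂ} (hχ : Continuous χ) (h : ℝ) :
    Continuous (dilationDiff χ h) := by unfold dilationDiff; fun_prop

theorem dilationDiff_zero (χ : ℝ → ℂ) (h : ℝ) : dilationDiff χ h 0 = 0 := by simp [dilationDiff]

theorem integral_neg_re_dilationDiff_le {χ : ℝ → ℂ} (hχ : Continuous χ) {h δ S : ℝ} (hh : 0 ≤ h)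
    (hδ : 0 ≤ δ) (hS : ∀ u ∈ Icc 0 δ, |(χ u).re| ≤ S) :
    ∫ u in (0 : ℝ)..δ, -(dilationDiff χ h u).re ≤ 2 * S * δ * h := by
  have hS0 : 0 ≤ S := (abs_nonneg _).trans (hS 0 ⟨le_rfl, hδ⟩)
  have h1 := integral_sub_comp_mul_le (g := fun u => -(χ u).re) (by fun_prop) (Real.exp_pos (-h))
    (Real.exp_le_one_iff.2 (by linarith)) hδ (fun u hu => by rw [abs_neg]; exact hS u hu)
  have h2 : 1 - Real.exp (-h) ≤ h := by linarith [Real.add_one_le_exp (-h)]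
  have e : ∀ u, -(dilationDiff χ h u).re = -(χ u).re - -(χ (Real.exp (-h) * u)).re := fun u => by
    simp [dilationDiff]; ring
  simp only [e]
  refine h1.trans ?_
  gcongr

theorem charFun_sub_one_eq {Q : Measure ℝ} [IsProbabilityMeasure Q] (h0 : ∫ x, clip x ∂Q = 0) (u : ℝ) :
    charFun Q u - 1 = ∫ x, clipKernel u x ∂Q := by
  have hc : Integrable clip Q := by simpa using integrable_clip Q 0
  have i1 : Integrable (fun x : ℝ => Complex.exp (Complex.I * u * x) - 1) Q :=
    (integrable_exp_I_mul Q u).sub (integrable_const _)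
  have i2 : Integrable (fun x : ℝ => Complex.I * u * (clip x : ℂ)) Q := hc.ofReal.const_mul _
  simp only [clipKernel]
  rw [integral_sub i1 i2, integral_sub (integrable_exp_I_mul Q u) (integrable_const _),
    integral_const_mul, integral_complex_ofReal, h0, charFun_eq_integral_exp]
  simp

theorem integrable_clip_sq (Q : Measure ℝ) [IsFiniteMeasure Q] : Integrable (fun x => clip x ^ 2) Q :=
  Integrable.of_bound (C := 1) (by have := continuous_clip; fun_prop) (Eventually.of_forall fun x => by
    rw [Real.norm_eq_abs, abs_pow]; exact pow_le_one₀ (abs_nonneg _) (abs_clip_le_one x))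

theorem norm_charFun_sub_one_le {Q : Measure ℝ} [IsProbabilityMeasure Q] (h0 : ∫ x, clip x ∂Q = 0)
    {ε : ℝ} (hε : ∫ x, clip x ^ 2 ∂Q ≤ ε) (u : ℝ) : ‖charFun Q u - 1‖ ≤ 3 * (1 + u ^ 2) * ε := by
  rw [charFun_sub_one_eq h0]
  calc _ ≤ ∫ x, 3 * (1 + u ^ 2) * clip x ^ 2 ∂Q :=
        norm_integral_le_of_norm_le ((integrable_clip_sq Q).const_mul _)
          (Eventually.of_forall (norm_clipKernel_le u))
    _ ≤ _ := by rw [integral_const_mul]; gcongr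

/-- Centering of a law whose characteristic function is `exp (dilationDiff χ h)`. -/
theorem exists_centered {χ : ℝ → ℂ} (hχ : Continuous χ) {h S : ℝ} (hh : 0 ≤ h)
    (hS : ∀ u ∈ Icc (0 : ℝ) 1, |(χ u).re| ≤ S) {P : Measure ℝ} [IsProbabilityMeasure P]
    (hP : ∀ u, charFun P u = Complex.exp (dilationDiff χ h u)) :
    ∃ (Q : Measure ℝ) (y : ℝ), IsProbabilityMeasure Q ∧
      (∀ u, charFun Q u = Complex.exp (dilationDiff χ h u - Complex.I * u * y)) ∧
      ∫ x, clip x ∂Q = 0 ∧ ∫ x, clip x ^ 2 ∂Q ≤ 120 * S * h := by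
  obtain ⟨y, hy⟩ := exists_integral_clip_sub_eq_zero P
  set Q : Measure ℝ := P.map (fun x => x + -y) with hQ
  have hQp : IsProbabilityMeasure Q := Measure.isProbabilityMeasure_map (by fun_prop)
  have hQc : ∀ u, charFun Q u = Complex.exp (dilationDiff χ h u - Complex.I * u * y) := by
    intro u
    rw [hQ, charFun_map_add_const, hP, ← Complex.exp_add]
    congr 1
    simp
    ring
  have hQ0 : ∫ x, clip x ∂Q = 0 := by
    rw [hQ, integral_map (by fun_prop) continuous_clip.aestronglyMeasurable]
    simpa [sub_eq_add_neg] using hy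
  -- The shift by y does not affect |φ|, and 1 - |φ|² = 1 - e^{2 Re r} ≤ -2 Re r for the exponent r.
  -- The constant is 120 = 30·2·2, the last factor coming from `integral_neg_re_dilationDiff_le`.
  refine ⟨Q, y, hQp, hQc, hQ0, (integral_clip_sq_le Q hQ0).trans ?_⟩
  have hcont := continuous_dilationDiff hχ h
  have h1 : ∫ u in (0 : ℝ)..1, (1 - ‖charFun Q u‖ ^ 2) ≤
      ∫ u in (0 : ℝ)..1, 2 * -(dilationDiff χ h u).re := by
    refine intervalIntegral.integral_mono_on zero_le_one
      (Continuous.intervalIntegrable (by fun_prop) _ _)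
      (Continuous.intervalIntegrable (by fun_prop) _ _) fun u _ => ?_
    rw [hQc, Complex.norm_exp, ← Real.exp_nat_mul]
    have e : (dilationDiff χ h u - Complex.I * u * y).re = (dilationDiff χ h u).re := by simp
    rw [e]
    push_cast
    linarith [Real.add_one_le_exp (2 * (dilationDiff χ h u).re)]
  rw [intervalIntegral.integral_const_mul] at h1
  have h2 := integral_neg_re_dilationDiff_le hχ hh zero_le_one hS
  linarith

/-- The exponent of a centred cofactor agrees with its characteristic function minus 1 up to the
square of a quantity of order h. After division by h the error still vanishes, so exponents may be
replaced by integrals against the cofactors. -/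
theorem norm_dilationDiff_sub_le {χ : ℝ → ℂ} (hχ : Continuous χ) {h y ε u δ : ℝ} {Q : Measure ℝ}
    [IsProbabilityMeasure Q]
    (hQ : ∀ u, charFun Q u = Complex.exp (dilationDiff χ h u - Complex.I * u * y))
    (h0 : ∫ x, clip x ∂Q = 0) (hε : ∫ x, clip x ^ 2 ∂Q ≤ ε) (hu : 3 * (1 + u ^ 2) * ε ≤ δ)
    (hδ : δ ≤ 1 / 2) :
    ‖dilationDiff χ h u - Complex.I * u * y - (charFun Q u - 1)‖ ≤ δ ^ 2 := by
  have hε0 : 0 ≤ ε := (integral_nonneg fun x => sq_nonneg _).trans hε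
  have hcont := continuous_dilationDiff hχ h
  rw [hQ]
  refine norm_sub_exp_sub_one_le (r := fun u => dilationDiff χ h u - Complex.I * u * y)
    (by fun_prop) (by simp [dilationDiff_zero]) hδ fun t ht => ?_
  rw [← hQ]
  refine (norm_charFun_sub_one_le h0 hε _).trans (le_trans ?_ hu)
  have : (t * u) ^ 2 ≤ u ^ 2 := by
    rw [mul_pow]
    exact mul_le_of_le_one_left (sq_nonneg u) (pow_le_one₀ ht.1 ht.2)
  gcongr

theorem measureReal_abs_gt_le_integral_re (Q : Measure ℝ) [IsProbabilityMeasure Q] {R : ℝ} (hR : 0 < R) :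
    Q.real {x | R < |x|} ≤ 15 * ∫ u in (0 : ℝ)..1, (1 - (charFun Q (u / R)).re) := by
  have hF : Integrable (Function.uncurry fun (x : ℝ) (u : ℝ) => 1 - Real.cos (u * (x / R)))
      (Q.prod (volume.restrict (Ioc 0 1))) := by
    refine Integrable.of_bound (C := 2) (by unfold Function.uncurry; fun_prop)
      (Eventually.of_forall fun p => ?_)
    simp only [Function.uncurry]
    rw [Real.norm_eq_abs, abs_le]
    constructor <;> linarith [Real.cos_le_one (p.2 * (p.1 / R)), Real.neg_one_le_cos (p.2 * (p.1 / R))]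
  have hms : MeasurableSet {x : ℝ | R < |x|} := measurableSet_lt measurable_const measurable_abs
  calc Q.real {x | R < |x|} = ∫ x, {x : ℝ | R < |x|}.indicator (fun _ => (1 : ℝ)) x ∂Q := by
        rw [integral_indicator hms]; simp
    _ ≤ ∫ x, 15 * (∫ u in Ioc (0 : ℝ) 1, (1 - Real.cos (u * (x / R)))) ∂Q := by
        refine integral_mono_of_nonneg (Eventually.of_forall fun x => indicator_nonneg (fun _ _ => zero_le_one) x)
          (hF.integral_prod_left.const_mul 15) (Eventually.of_forall fun x => ?_)
        simp only
        rw [← intervalIntegral.integral_of_le zero_le_one]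
        refine le_trans ?_ (min_one_sq_le_integral_one_sub_cos (x / R))
        by_cases hx : R < |x|
        · have : 1 ≤ (x / R) ^ 2 := by
            rw [← sq_abs, abs_div, abs_of_pos hR]
            exact one_le_pow₀ ((one_le_div hR).2 hx.le)
          simp [hx, this]
        · simp [hx]; positivity
    _ = 15 * ∫ u in (0 : ℝ)..1, (1 - (charFun Q (u / R)).re) := by
        have hswap := integral_integral_swap hF
        rw [integral_const_mul, hswap, intervalIntegral.integral_of_le zero_le_one]
        congr 1
        refine integral_congr_ae (Eventually.of_forall fun u => ?_)
        simp only
        have hi : Integrable (fun x : ℝ => Real.cos (u * (x / R))) Q :=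
          Integrable.of_bound (C := 1) (by fun_prop) (Eventually.of_forall fun p => Real.abs_cos_le_one _)
        rw [integral_sub (integrable_const _) hi, charFun_eq_integral_exp]
        have : ∀ x : ℝ, Real.cos (u * (x / R)) =
            (Complex.exp (Complex.I * ((u / R : ℝ) : ℂ) * x)).re := by
          intro x
          rw [← Complex.exp_ofReal_mul_I_re]
          congr 2; push_cast; ring
        simp only [this]
        have h3 := integral_re (integrable_exp_I_mul Q (u / R))
        simp only [RCLike.re_eq_complex_re] at h3
        rw [h3]
        simp

/-- Only frequencies in [0, 1/R] enter, where |Re χ| ≤ S is small for large R; the centring term is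
imaginary and drops out. Since the main term carries a factor h, the tails divided by h are
uniformly small, which is the tightness needed. -/
theorem measureReal_abs_gt_le {χ : ℝ → ℂ} (hχ : Continuous χ) {h y ε δ S R : ℝ} (hh : 0 ≤ h)
    {Q : Measure ℝ} [IsProbabilityMeasure Q]
    (hQ : ∀ u, charFun Q u = Complex.exp (dilationDiff χ h u - Complex.I * u * y))
    (h0 : ∫ x, clip x ∂Q = 0) (hε : ∫ x, clip x ^ 2 ∂Q ≤ ε) (hδε : 6 * ε ≤ δ) (hδ : δ ≤ 1 / 2)
    (hR : 1 ≤ R) (hS : ∀ u ∈ Icc (0 : ℝ) (1 / R), |(χ u).re| ≤ S) :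
    Q.real {x | R < |x|} ≤ 15 * (2 * S * h + δ ^ 2) := by
  have hR0 : 0 < R := by linarith
  have hε0 : 0 ≤ ε := (integral_nonneg fun x => sq_nonneg _).trans hε
  have hcont := continuous_dilationDiff hχ h
  refine (measureReal_abs_gt_le_integral_re Q hR0).trans ?_
  gcongr
  have h1 : ∫ u in (0 : ℝ)..1, (1 - (charFun Q (u / R)).re) ≤
      ∫ u in (0 : ℝ)..1, (-(dilationDiff χ h (u / R)).re + δ ^ 2) := by
    refine intervalIntegral.integral_mono_on zero_le_one
      (Continuous.intervalIntegrable (by fun_prop) _ _)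
      (Continuous.intervalIntegrable (by fun_prop) _ _) fun u hu => ?_
    have hu1 : (u / R) ^ 2 ≤ 1 := by
      refine pow_le_one₀ (div_nonneg hu.1 hR0.le) ?_
      rw [div_le_one hR0]; linarith [hu.2]
    have h2 := norm_dilationDiff_sub_le hχ hQ h0 hε (u := u / R) (δ := δ) (by nlinarith) hδ
    have h3 := (Complex.abs_re_le_norm _).trans h2
    have h4 := (abs_le.1 h3).2
    simp only [Complex.sub_re, Complex.one_re, Complex.mul_re, Complex.I_re, Complex.I_im,
      Complex.ofReal_re, Complex.ofReal_im, Complex.mul_im] at h4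
    linarith
  refine h1.trans ?_
  rw [intervalIntegral.integral_add (Continuous.intervalIntegrable (by fun_prop) _ _) (by simp),
    intervalIntegral.integral_comp_div (fun u => -(dilationDiff χ h u).re) hR0.ne', zero_div]
  have h5 := integral_neg_re_dilationDiff_le hχ hh (by positivity) hS
  have h6 : R • ∫ u in (0 : ℝ)..(1 / R), -(dilationDiff χ h u).re ≤ 2 * S * h := by
    rw [smul_eq_mul]
    calc _ ≤ R * (2 * S * (1 / R) * h) := by gcongr
      _ = _ := by field_simp
  simp only [intervalIntegral.integral_const, sub_zero, one_smul]
  linarith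

/-! ### Limits of accompanying measures -/

/-- The measure `r • clip² dQ`. -/
def clipMeasure (r : ℝ) (Q : Measure ℝ) : Measure ℝ :=
  Q.withDensity (fun x => ENNReal.ofReal (r * clip x ^ 2))

theorem isFiniteMeasure_clipMeasure (r : ℝ) (Q : Measure ℝ) [IsFiniteMeasure Q] :
    IsFiniteMeasure (clipMeasure r Q) := by
  refine isFiniteMeasure_withDensity ?_
  have := ((integrable_clip_sq Q).const_mul r).lintegral_lt_top
  exact this.ne

theorem clipMeasure_real_univ {r : ℝ} (hr : 0 ≤ r) (Q : Measure ℝ) [IsFiniteMeasure Q] :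
    (clipMeasure r Q).real univ = r * ∫ x, clip x ^ 2 ∂Q := by
  rw [Measure.real, clipMeasure, withDensity_apply _ MeasurableSet.univ, Measure.restrict_univ,
    ← integral_const_mul, integral_eq_lintegral_of_nonneg_ae (Eventually.of_forall fun x => by positivity)
    ((integrable_clip_sq Q).const_mul r).aestronglyMeasurable]

theorem clipMeasure_real_le {r : ℝ} (hr : 0 ≤ r) (Q : Measure ℝ) [IsFiniteMeasure Q] {A : Set ℝ}
    (hA : MeasurableSet A) : (clipMeasure r Q).real A ≤ r * Q.real A := by
  have h : clipMeasure r Q A ≤ ENNReal.ofReal r * Q A := by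
    rw [clipMeasure, withDensity_apply _ hA]
    calc _ ≤ ∫⁻ x in A, ENNReal.ofReal r ∂Q := by
          refine lintegral_mono fun x => ENNReal.ofReal_le_ofReal ?_
          refine mul_le_of_le_one_right hr ?_
          rw [← sq_abs]
          exact pow_le_one₀ (abs_nonneg _) (abs_clip_le_one x)
      _ = _ := by simp
  have := ENNReal.toReal_mono (by finiteness) h
  rwa [ENNReal.toReal_mul, ENNReal.toReal_ofReal hr] at this

theorem integral_normKernel_clipMeasure {r : ℝ} (hr : 0 ≤ r) (Q : Measure ℝ) [IsProbabilityMeasure Q]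
    (h0 : ∫ x, clip x ∂Q = 0) (u : ℝ) :
    ∫ x, normKernel u x ∂clipMeasure r Q = r * (charFun Q u - 1) := by
  have hc := continuous_clip
  rw [clipMeasure, integral_withDensity_eq_integral_toReal_smul (by fun_prop) (by simp),
    charFun_sub_one_eq h0, ← integral_const_mul]
  refine integral_congr_ae (Eventually.of_forall fun x => ?_)
  simp only
  rw [ENNReal.toReal_ofReal (by positivity), ← clip_sq_mul_normKernel, Complex.real_smul]
  push_cast
  ring

/-- A normalised sequence of cofactors, after centering, has a convergent subsequence. -/
theorem exists_subseq_tendsto_cofactors {χ : ℝ → ℂ} (hχ : Continuous χ) (hχ0 : χ 0 = 0)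
    {P : ℕ → Measure ℝ} (hPp : ∀ n, IsProbabilityMeasure (P n))
    (hP : ∀ n u, charFun (P n) u = Complex.exp (dilationDiff χ (1 / ((n : ℝ) + 1)) u)) :
    ∃ (m : Measure ℝ) (φ : ℕ → ℕ) (α : ℕ → ℝ) (K : ℝ), IsFiniteMeasure m ∧ StrictMono φ ∧
      (∀ u, Tendsto (fun j => ((φ j : ℝ) + 1 : ℝ) • dilationDiff χ (1 / ((φ j : ℝ) + 1)) u -
        Complex.I * u * α j) atTop (𝓝 (∫ x, normKernel u x ∂m))) ∧
      ∀ U : ℝ, ∀ᶠ j in atTop, ∀ u, |u| ≤ U →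
        ‖((φ j : ℝ) + 1 : ℝ) • dilationDiff χ (1 / ((φ j : ℝ) + 1)) u - Complex.I * u * α j‖ ≤
          K * (1 + U ^ 2) := by
  have hre : Continuous fun u => |(χ u).re| := by fun_prop
  obtain ⟨S, hS⟩ := (isCompact_Icc (a := (0 : ℝ)) (b := 1)).bddAbove_image hre.continuousOn
  have hS' : ∀ u ∈ Icc (0 : ℝ) 1, |(χ u).re| ≤ S := fun u hu => hS (mem_image_of_mem _ hu)
  have hS0 : 0 ≤ S := (abs_nonneg _).trans (hS' 0 (by simp))
  set K := 120 * S with hK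
  have hK0 : 0 ≤ K := by positivity
  have hcen : ∀ n : ℕ, ∃ (Q : Measure ℝ) (y : ℝ), IsProbabilityMeasure Q ∧
      (∀ u, charFun Q u = Complex.exp (dilationDiff χ (1 / ((n : ℝ) + 1)) u - Complex.I * u * y)) ∧
      ∫ x, clip x ∂Q = 0 ∧ ∫ x, clip x ^ 2 ∂Q ≤ K * (1 / ((n : ℝ) + 1)) := fun n => by
    have := hPp n
    exact exists_centered hχ (by positivity) hS' (hP n)
  choose Q y hQp hQc hQ0 hQK using hcen
  set m : ℕ → Measure ℝ := fun n => clipMeasure ((n : ℝ) + 1) (Q n) with hm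
  have hmf : ∀ n, IsFiniteMeasure (m n) := fun n => isFiniteMeasure_clipMeasure _ _
  have hmK : ∀ n, (m n).real univ ≤ K := fun n => by
    simp only [hm]
    rw [clipMeasure_real_univ (by positivity)]
    calc _ ≤ ((n : ℝ) + 1) * (K * (1 / ((n : ℝ) + 1))) := by gcongr; exact hQK n
      _ = K := by field_simp
  have hlarge : ∀ c : ℝ, ∀ᶠ n : ℕ in atTop, c * (1 / ((n : ℝ) + 1)) ≤ 1 / 2 := fun c => by
    have h1 : Tendsto (fun n : ℕ => c * (1 / ((n : ℝ) + 1))) atTop (𝓝 (c * 0)) :=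
      tendsto_one_div_add_atTop_nhds_zero_nat.const_mul c
    rw [mul_zero] at h1
    exact (h1.eventually_lt_const (by norm_num : (0 : ℝ) < 1 / 2)).mono fun n h => h.le
  have htight : ∀ ε > 0, ∃ R : ℝ, ∃ n₀ : ℕ, ∀ n ≥ n₀, (m n).real {x | R < |x|} ≤ ε := by
    intro ε hε
    have hr0 : Tendsto (fun u => |(χ u).re|) (𝓝 0) (𝓝 0) := by
      have := hre.tendsto 0
      simpa [hχ0] using this
    -- Half of ε goes to each term of the tail bound: 15·2·(ε/60) = ε/2, and 15·(6K)²/(n+1) =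
    -- 540K²/(n+1) is at most ε/2 for large n.
    obtain ⟨η, hη, hηb⟩ := Metric.eventually_nhds_iff.1
      (hr0.eventually_lt_const (by positivity : (0 : ℝ) < ε / 60))
    set R := max 1 (2 / η) with hR
    have hR1 : 1 ≤ R := le_max_left _ _
    have hSR : ∀ u ∈ Icc (0 : ℝ) (1 / R), |(χ u).re| ≤ ε / 60 := fun u hu => by
      refine (hηb ?_).le
      rw [Real.dist_eq, sub_zero, abs_of_nonneg hu.1]
      refine hu.2.trans_lt ?_
      rw [div_lt_iff₀ (by linarith)]
      have : 2 / η ≤ R := le_max_right _ _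
      rw [div_le_iff₀ hη] at this
      linarith
    have h2 : ∀ᶠ n : ℕ in atTop, (540 * K ^ 2 / ε) * (1 / ((n : ℝ) + 1)) ≤ 1 / 2 := hlarge _
    obtain ⟨n₀, hn₀⟩ := eventually_atTop.1 ((hlarge (6 * K)).and h2)
    refine ⟨R, n₀, fun n hn => ?_⟩
    have := hQp n
    obtain ⟨h3, h4⟩ := hn₀ n hn
    have h5 := measureReal_abs_gt_le hχ (h := 1 / ((n : ℝ) + 1)) (by positivity) (hQc n) (hQ0 n) (hQK n)
      (δ := 6 * K * (1 / ((n : ℝ) + 1))) (by linarith) h3 hR1 hSR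
    refine (clipMeasure_real_le (by positivity) _
      (measurableSet_lt measurable_const measurable_abs)).trans ?_
    have hn1 : (0 : ℝ) < (n : ℝ) + 1 := by positivity
    calc _ ≤ ((n : ℝ) + 1) * (15 * (2 * (ε / 60) * (1 / ((n : ℝ) + 1)) +
          (6 * K * (1 / ((n : ℝ) + 1))) ^ 2)) := by gcongr
      _ = ε / 2 + ε * ((540 * K ^ 2 / ε) * (1 / ((n : ℝ) + 1))) := by field_simp; ring
      _ ≤ ε / 2 + ε * (1 / 2) := by gcongr
      _ = ε := by ring
  obtain ⟨φ, hφ, μ, hμ, hlim⟩ := exists_subseq_tendsto_of_tight hmK htight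
  have hbd : ∀ (U : ℝ) (n : ℕ), 3 * (1 + U ^ 2) * K * (1 / ((n : ℝ) + 1)) ≤ 1 / 2 →
      ∀ u : ℝ, |u| ≤ U →
      ‖((n : ℝ) + 1 : ℝ) • dilationDiff χ (1 / ((n : ℝ) + 1)) u -
        Complex.I * u * ((((n : ℝ) + 1) * y n : ℝ) : ℂ) -
        (((n : ℝ) + 1 : ℝ) : ℂ) * (charFun (Q n) u - 1)‖ ≤
      (3 * (1 + U ^ 2) * K) ^ 2 * (1 / ((n : ℝ) + 1)) := by
    intro U n hn u hu
    have := hQp n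
    have hu2 : u ^ 2 ≤ U ^ 2 := by rw [← sq_abs]; gcongr
    have hn1 : (0 : ℝ) < (n : ℝ) + 1 := by positivity
    have h1 := norm_dilationDiff_sub_le hχ (hQc n) (hQ0 n) (hQK n) (u := u)
      (δ := 3 * (1 + U ^ 2) * K * (1 / ((n : ℝ) + 1))) (by
        rw [← mul_assoc]; gcongr) hn
    have e : ((n : ℝ) + 1 : ℝ) • dilationDiff χ (1 / ((n : ℝ) + 1)) u -
        Complex.I * u * ((((n : ℝ) + 1) * y n : ℝ) : ℂ) -
        (((n : ℝ) + 1 : ℝ) : ℂ) * (charFun (Q n) u - 1) =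
        (((n : ℝ) + 1 : ℝ) : ℂ) * (dilationDiff χ (1 / ((n : ℝ) + 1)) u - Complex.I * u * y n -
          (charFun (Q n) u - 1)) := by
      rw [Complex.real_smul]; push_cast; ring
    rw [e, norm_mul, Complex.norm_real, Real.norm_eq_abs, abs_of_pos hn1]
    calc _ ≤ ((n : ℝ) + 1) * (3 * (1 + U ^ 2) * K * (1 / ((n : ℝ) + 1))) ^ 2 := by gcongr
      _ = _ := by field_simp
  have hX : ∀ (n : ℕ) (u : ℝ), ‖(((n : ℝ) + 1 : ℝ) : ℂ) * (charFun (Q n) u - 1)‖ ≤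
      3 * (1 + u ^ 2) * K := by
    intro n u
    have := hQp n
    have hn1 : (0 : ℝ) < (n : ℝ) + 1 := by positivity
    rw [norm_mul, Complex.norm_real, Real.norm_eq_abs, abs_of_pos hn1]
    calc _ ≤ ((n : ℝ) + 1) * (3 * (1 + u ^ 2) * (K * (1 / ((n : ℝ) + 1)))) := by
          gcongr; exact norm_charFun_sub_one_le (hQ0 n) (hQK n) u
      _ = _ := by field_simp
  -- The rescaled centres serve as α. The bound 5K leaves room for 3K from the characteristic
  -- function and 3K/2 from the quadratic error.
  refine ⟨μ, φ, fun j => ((φ j : ℝ) + 1) * y (φ j), 5 * K, hμ, hφ, fun u => ?_, fun U => ?_⟩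
  · have h1 := hlim (BoundedContinuousFunction.ofNormedAddCommGroup (normKernel u)
      (continuous_normKernel u) _ (norm_normKernel_le u))
    simp only [BoundedContinuousFunction.coe_ofNormedAddCommGroup] at h1
    have h2 : ∀ j, ∫ x, normKernel u x ∂m (φ j) =
        (((φ j : ℝ) + 1 : ℝ) : ℂ) * (charFun (Q (φ j)) u - 1) := fun j => by
      have := hQp (φ j)
      exact integral_normKernel_clipMeasure (by positivity) _ (hQ0 _) u
    simp only [h2] at h1
    have h3 : Tendsto (fun j => ((φ j : ℝ) + 1 : ℝ) • dilationDiff χ (1 / ((φ j : ℝ) + 1)) u -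
        Complex.I * u * ((((φ j : ℝ) + 1) * y (φ j) : ℝ) : ℂ) -
        (((φ j : ℝ) + 1 : ℝ) : ℂ) * (charFun (Q (φ j)) u - 1)) atTop (𝓝 0) := by
      have h4 : Tendsto (fun n : ℕ => (3 * (1 + |u| ^ 2) * K) ^ 2 * (1 / ((n : ℝ) + 1))) atTop (𝓝 0) := by
        have h5 := (tendsto_one_div_add_atTop_nhds_zero_nat (𝕜 := ℝ)).const_mul
          ((3 * (1 + |u| ^ 2) * K) ^ 2)
        rwa [mul_zero] at h5
      refine squeeze_zero_norm' ?_ (h4.comp hφ.tendsto_atTop)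
      exact hφ.tendsto_atTop.eventually ((hlarge (3 * (1 + |u| ^ 2) * K)).mono
        fun n hn => hbd |u| n hn u le_rfl)
    simpa using h3.add h1
  · refine (hφ.tendsto_atTop.eventually (hlarge (3 * (1 + U ^ 2) * K))).mono fun j hn u hu => ?_
    set n := φ j
    have h1 := hbd U n hn u hu
    have hu2 : u ^ 2 ≤ U ^ 2 := by rw [← sq_abs]; gcongr
    have h2 : (3 * (1 + U ^ 2) * K) ^ 2 * (1 / ((n : ℝ) + 1)) ≤ 3 * (1 + U ^ 2) * K * (1 / 2) := by
      rw [sq, mul_assoc (3 * (1 + U ^ 2) * K) (3 * (1 + U ^ 2) * K)]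
      gcongr
    have h3 : 3 * (1 + u ^ 2) * K ≤ 3 * (1 + U ^ 2) * K := by gcongr
    have h4 := norm_add_le_of_le h1 (hX n u)
    rw [sub_add_cancel] at h4
    refine h4.trans ?_
    nlinarith [sq_nonneg U]

/-- A function all of whose dilation differences are exponents of probability measures is obtained
by integrating a Lévy–Khintchine exponent along dilations. -/
theorem exists_lkExp_of_cofactors {χ : ℝ → ℂ} (hχ : Continuous χ) (hχ0 : χ 0 = 0)
    {P : ℕ → Measure ℝ} (hPp : ∀ n, IsProbabilityMeasure (P n))
    (hP : ∀ n u, charFun (P n) u = Complex.exp (dilationDiff χ (1 / ((n : ℝ) + 1)) u)) :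
    ∃ (a v : ℝ) (M : Measure ℝ), 0 ≤ v ∧ IsLevyMeasure M ∧ ∃ φ : ℕ → ℕ, StrictMono φ ∧
      (∀ u, Tendsto (fun j => ((φ j : ℝ) + 1 : ℝ) • dilationDiff χ (1 / ((φ j : ℝ) + 1)) u) atTop
        (𝓝 (lkExp a v M u))) ∧
      ∀ u T : ℝ, 0 ≤ T → χ u - χ (Real.exp (-T) * u) =
        ∫ s in Ioc (0 : ℝ) T, lkExp a v M (Real.exp (-s) * u) := by
  obtain ⟨m, φ, α, K, hm, hφ, hlim, hbd⟩ := exists_subseq_tendsto_cofactors hχ hχ0 hPp hP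
  set F : ℝ → ℂ := fun u => ∫ x, normKernel u x ∂m with hF
  set w : ℕ → ℝ → ℂ := fun j u => ((φ j : ℝ) + 1 : ℝ) • dilationDiff χ (1 / ((φ j : ℝ) + 1)) u with hw
  have hwc : ∀ j, Continuous (w j) := fun j => by
    have := continuous_dilationDiff hχ (1 / ((φ j : ℝ) + 1)); fun_prop
  have hmean : ∀ u T : ℝ, Tendsto (fun j => ∫ s in (0 : ℝ)..T, w j (Real.exp (-s) * u)) atTop
      (𝓝 (χ u - χ (Real.exp (-T) * u))) := by
    intro u T
    have h := (tendsto_integral_difference (f := fun s => χ (Real.exp (-s) * u)) (by fun_prop) T).comp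
      hφ.tendsto_atTop
    simp only [neg_zero, Real.exp_zero, one_mul] at h
    refine h.congr fun j => ?_
    simp only [Function.comp, hw, dilationDiff]
    refine intervalIntegral.integral_congr fun s _ => ?_
    simp only [neg_add, Real.exp_add]
    ring_nf
  have hdct : ∀ (u T : ℝ), 0 ≤ T → Tendsto (fun j => ∫ s in (0 : ℝ)..T, (w j (Real.exp (-s) * u) -
      Complex.I * ((Real.exp (-s) * u : ℝ) : ℂ) * α j)) atTop
      (𝓝 (∫ s in (0 : ℝ)..T, F (Real.exp (-s) * u))) := by
    intro u T hT
    refine intervalIntegral.tendsto_integral_filter_of_dominated_convergence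
      (fun _ => K * (1 + |u| ^ 2)) (Eventually.of_forall fun j => ?_) ?_ (by simp) ?_
    · have := hwc j
      exact Continuous.aestronglyMeasurable (by fun_prop)
    · filter_upwards [hbd |u|] with j hj
      refine Eventually.of_forall fun s hs => ?_
      rw [uIoc_of_le hT] at hs
      refine hj _ ?_
      rw [abs_mul, abs_of_pos (Real.exp_pos _)]
      exact mul_le_of_le_one_left (abs_nonneg u) (Real.exp_le_one_iff.2 (by linarith [hs.1]))
    · exact Eventually.of_forall fun s _ => hlim _
  -- At u = T = 1 the integrals converge without centring, by telescoping, and with centring, by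
  -- dominated convergence. Their difference is i(1 - e^{-1})α_j, so the centring constants
  -- converge.
  have hα : ∃ a : ℝ, Tendsto α atTop (𝓝 a) := by
    have h := (hmean 1 1).sub (hdct 1 1 zero_le_one)
    have hc : (∫ s in (0 : ℝ)..1, Real.exp (-s)) = 1 - Real.exp (-1) := by simp
    have hpos : 0 < 1 - Real.exp (-1) := by
      have : Real.exp (-1) < 1 := by rw [← Real.exp_zero]; exact Real.exp_lt_exp.2 (by norm_num)
      linarith
    have e : ∀ j, (∫ s in (0 : ℝ)..1, w j (Real.exp (-s) * 1)) - (∫ s in (0 : ℝ)..1,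
        (w j (Real.exp (-s) * 1) - Complex.I * ((Real.exp (-s) * 1 : ℝ) : ℂ) * α j)) =
        Complex.I * (((1 - Real.exp (-1)) * α j : ℝ) : ℂ) := by
      intro j
      have := hwc j
      rw [← intervalIntegral.integral_sub (Continuous.intervalIntegrable (by fun_prop) _ _)
        (Continuous.intervalIntegrable (by fun_prop) _ _)]
      simp only [sub_sub_cancel, mul_one]
      rw [intervalIntegral.integral_mul_const, intervalIntegral.integral_const_mul,
        intervalIntegral.integral_ofReal, hc]
      push_cast
      ring
    simp only [e] at h
    have h2 := (Complex.continuous_im.tendsto _).comp h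
    have h3 := h2.const_mul (1 - Real.exp (-1))⁻¹
    refine ⟨_, h3.congr fun j => ?_⟩
    simp only [Function.comp]
    rw [Complex.mul_im, Complex.I_re, Complex.I_im, Complex.ofReal_re]
    field_simp
    ring
  obtain ⟨a, ha⟩ := hα
  obtain ⟨a', v, M, hv, hM, hL⟩ := exists_lkExp_eq_integral_normKernel a m
  have ha' : Tendsto (fun j => (α j : ℂ)) atTop (𝓝 (a : ℂ)) :=
    (Complex.continuous_ofReal.tendsto _).comp ha
  refine ⟨a', v, M, hv, hM, φ, hφ, fun u => ?_, fun u T hT => ?_⟩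
  · have h := (hlim u).add (ha'.const_mul (Complex.I * u))
    simp only [sub_add_cancel] at h
    rw [add_comm, hL] at h
    exact h
  · have hcont := hM.continuous_lkExp a' v
    have hFc : F = fun u => lkExp a' v M u - Complex.I * u * a := by
      funext u; rw [← hL]; simp [hF]
    have h1 : Tendsto (fun j => ∫ s in (0 : ℝ)..T, w j (Real.exp (-s) * u)) atTop
        (𝓝 (∫ s in (0 : ℝ)..T, lkExp a' v M (Real.exp (-s) * u))) := by
      have hd := (hdct u T hT).add
        (ha'.const_mul (∫ s in (0 : ℝ)..T, Complex.I * ((Real.exp (-s) * u : ℝ) : ℂ)))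
      have e1 : (∫ s in (0 : ℝ)..T, F (Real.exp (-s) * u)) +
          (∫ s in (0 : ℝ)..T, Complex.I * ((Real.exp (-s) * u : ℝ) : ℂ)) * a =
          ∫ s in (0 : ℝ)..T, lkExp a' v M (Real.exp (-s) * u) := by
        rw [← intervalIntegral.integral_mul_const, ← intervalIntegral.integral_add]
        · simp [hFc]
        · rw [hFc]; exact Continuous.intervalIntegrable (by fun_prop) _ _
        · exact Continuous.intervalIntegrable (by fun_prop) _ _
      rw [e1] at hd
      refine hd.congr fun j => ?_
      have := hwc j
      rw [← intervalIntegral.integral_mul_const, ← intervalIntegral.integral_add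
        (Continuous.intervalIntegrable (by fun_prop) _ _)
        (Continuous.intervalIntegrable (by fun_prop) _ _)]
      simp
    rw [← intervalIntegral.integral_of_le hT]
    exact tendsto_nhds_unique (hmean u T) h1

/-! ### Recovering the time moment from the exponent -/

theorem IsLevyMeasure.integrable_cos_sub_one {M : Measure ℝ} (hM : IsLevyMeasure M) (u : ℝ) :
    Integrable (fun x => Real.cos (u * x) - 1) M := by
  have h := (hM.integrable_lkKernel u).re
  simpa only [RCLike.re_eq_complex_re, lkKernel_re] using h

theorem IsLevyMeasure.re_lkExp {M : Measure ℝ} (hM : IsLevyMeasure M) (a v u : ℝ) :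
    (lkExp a v M u).re = -(1 / 2 * v * u ^ 2) + ∫ x, (Real.cos (u * x) - 1) ∂M := by
  have h := integral_re (hM.integrable_lkKernel u)
  simp only [RCLike.re_eq_complex_re, lkKernel_re] at h
  rw [lkExp_eq a v hM.1 u, Complex.add_re, ← h]
  congr 1
  have : Complex.I * u * a - (1 / 2) * v * u ^ 2 = Complex.I * ((u * a : ℝ) : ℂ) -
      ((1 / 2 * v * u ^ 2 : ℝ) : ℂ) := by push_cast; ring
  rw [this, Complex.sub_re, Complex.ofReal_re, Complex.re_mul_ofReal]
  simp

theorem IsLevyMeasure.lintegral_one_sub_cos_le {M : Measure ℝ} (hM : IsLevyMeasure M) (a : ℝ) {v : ℝ}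
    (hv : 0 ≤ v) (u : ℝ) :
    ∫⁻ x, ENNReal.ofReal (1 - Real.cos (u * x)) ∂M ≤ ENNReal.ofReal (-(lkExp a v M u).re) := by
  have hi : Integrable (fun x => 1 - Real.cos (u * x)) M := by
    refine (hM.integrable_cos_sub_one u).neg.congr (Eventually.of_forall fun x => ?_)
    simp
  rw [← ofReal_integral_eq_lintegral_ofReal hi
    (Eventually.of_forall fun x => by simp [Real.cos_le_one]), hM.re_lkExp]
  refine ENNReal.ofReal_le_ofReal ?_
  have e : ∫ x, (1 - Real.cos (u * x)) ∂M = -∫ x, (Real.cos (u * x) - 1) ∂M := by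
    rw [← integral_neg]; simp
  rw [e]
  have : 0 ≤ 1 / 2 * v * u ^ 2 := by positivity
  linarith

theorem IsLevyMeasure.re_lkExp_nonpos {M : Measure ℝ} (hM : IsLevyMeasure M) (a : ℝ) {v : ℝ}
    (hv : 0 ≤ v) (u : ℝ) : (lkExp a v M u).re ≤ 0 := by
  rw [hM.re_lkExp]
  have h1 : ∫ x, (Real.cos (u * x) - 1) ∂M ≤ 0 :=
    integral_nonpos fun x => by simp [Real.cos_le_one]
  have : 0 ≤ 1 / 2 * v * u ^ 2 := by positivity
  linarith

theorem HasTimeMoment.lintegral_erlang_one_sub_cos_le {k : ℕ} {M : Measure ℝ} (h : HasTimeMoment k M)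
    (a : ℝ) {v : ℝ} (hv : 0 ≤ v) (u : ℝ) :
    ∫⁻ s, ∫⁻ x, ENNReal.ofReal (1 - Real.cos (Real.exp (-s) * u * x)) ∂M ∂erlang k ≤
      ENNReal.ofReal (-(erlangMean k (lkExp a v M) u).re) := by
  have hL := h.isLevyMeasure
  have hi := h.integrable_erlang a hv u
  have e : -(erlangMean k (lkExp a v M) u).re =
      ∫ s, -(lkExp a v M (Real.exp (-s) * u)).re ∂erlang k := by
    have h1 := integral_re hi
    simp only [RCLike.re_eq_complex_re] at h1
    rw [integral_neg, h1, erlangMean]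
  have hn : Integrable (fun s => -(lkExp a v M (Real.exp (-s) * u)).re) (erlang k) := hi.re.neg
  rw [e, ofReal_integral_eq_lintegral_ofReal hn
    (Eventually.of_forall fun s => by simpa using hL.re_lkExp_nonpos a hv _)]
  exact lintegral_mono fun s => hL.lintegral_one_sub_cos_le a hv _

/-- Over (0, n] the integral is minus the real part of an increment of χ, hence at most 2B. The
integrand is nonnegative, so the bound survives as n → ∞. -/
theorem lintegral_Ioi_neg_re_le {χ Ψ : ℝ → ℂ} (hΨ : Continuous Ψ) (hre : ∀ u, (Ψ u).re ≤ 0)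
    (hinc : ∀ u T : ℝ, 0 ≤ T → χ u - χ (Real.exp (-T) * u) = ∫ s in Ioc (0 : ℝ) T, Ψ (Real.exp (-s) * u))
    {B u : ℝ} (hB : ∀ u ∈ Icc (0 : ℝ) 1, ‖χ u‖ ≤ B) (hu : u ∈ Icc (0 : ℝ) 1) :
    ∫⁻ s in Ioi (0 : ℝ), ENNReal.ofReal (-(Ψ (Real.exp (-s) * u)).re) ≤ ENNReal.ofReal (2 * B) := by
  have hT := (aecover_Iic (μ := volume.restrict (Ioi (0 : ℝ)))
    tendsto_natCast_atTop_atTop).lintegral_tendsto_of_nat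
    (f := fun s => ENNReal.ofReal (-(Ψ (Real.exp (-s) * u)).re)) (by fun_prop)
  refine le_of_tendsto hT (Eventually.of_forall fun n => ?_)
  rw [Measure.restrict_restrict measurableSet_Iic, inter_comm, Ioi_inter_Iic]
  have hi : IntegrableOn (fun s => Ψ (Real.exp (-s) * u)) (Ioc 0 (n : ℝ)) :=
    (Continuous.integrableOn_Icc (by fun_prop)).mono_set Ioc_subset_Icc_self
  have h1 := integral_re hi
  simp only [RCLike.re_eq_complex_re] at h1
  have hn : IntegrableOn (fun s => -(Ψ (Real.exp (-s) * u)).re) (Ioc 0 (n : ℝ)) := hi.re.neg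
  rw [← ofReal_integral_eq_lintegral_ofReal hn
    (Eventually.of_forall fun s => by simpa using hre _)]
  refine ENNReal.ofReal_le_ofReal ?_
  have e : ∫ s in Ioc 0 (n : ℝ), -(Ψ (Real.exp (-s) * u)).re =
      -(χ u - χ (Real.exp (-(n : ℝ)) * u)).re := by
    rw [integral_neg, h1, hinc u n (by positivity)]
  refine e.le.trans ?_
  have he : Real.exp (-(n : ℝ)) ≤ 1 := Real.exp_le_one_iff.2 (by simp)
  have h2 := hB u hu
  have h3 := hB (Real.exp (-(n : ℝ)) * u) ⟨mul_nonneg (Real.exp_pos _).le hu.1, by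
    nlinarith [hu.1, hu.2, Real.exp_pos (-(n : ℝ))]⟩
  have h4 := (abs_le.1 ((Complex.abs_re_le_norm _).trans (norm_sub_le (χ u) (χ (Real.exp (-(n : ℝ)) * u))))).1
  linarith

theorem measurable_lintegral_one_sub_cos (M : Measure ℝ) [SFinite M] :
    Measurable fun y : ℝ => ∫⁻ x, ENNReal.ofReal (1 - Real.cos (y * x)) ∂M :=
  Measurable.lintegral_prod_right'
    (f := fun p : ℝ × ℝ => ENNReal.ofReal (1 - Real.cos (p.1 * p.2))) (by fun_prop)

theorem ofReal_min_one_sq_le (y : ℝ) : ENNReal.ofReal (min 1 (y ^ 2)) ≤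
    15 * ∫⁻ u in Ioc (0 : ℝ) 1, ENNReal.ofReal (1 - Real.cos (u * y)) := by
  have hi : IntegrableOn (fun u : ℝ => 1 - Real.cos (u * y)) (Ioc 0 1) :=
    (Continuous.integrableOn_Icc (by fun_prop)).mono_set Ioc_subset_Icc_self
  rw [← ofReal_integral_eq_lintegral_ofReal hi
    (Eventually.of_forall fun x => by simp [Real.cos_le_one]),
    ← intervalIntegral.integral_of_le zero_le_one,
    (by simp : (15 : ENNReal) = ENNReal.ofReal 15), ← ENNReal.ofReal_mul (by norm_num)]
  exact ENNReal.ofReal_le_ofReal (min_one_sq_le_integral_one_sub_cos y)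

/-- The existence of a continuous χ with these increments forces one more time moment. Boundedness
of χ on [0,1] bounds the Erlang average of ∫ (1 - cos(e^{-s}ux)) M(dx) by 2B, uniformly for u ∈
[0,1]. Integrating over u and exchanging the integrals, all of nonnegative functions, turns the
cosines into min(1, ·²). -/
theorem HasTimeMoment.succ_of_increments {k : ℕ} {M : Measure ℝ} (h : HasTimeMoment k M) (a : ℝ) {v : ℝ}
    (hv : 0 ≤ v) {χ : ℝ → ℂ} (hχ : Continuous χ)
    (hinc : ∀ u T : ℝ, 0 ≤ T → χ u - χ (Real.exp (-T) * u) =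
      ∫ s in Ioc (0 : ℝ) T, erlangMean k (lkExp a v M) (Real.exp (-s) * u)) :
    HasTimeMoment (k + 1) M := by
  have hσ := h.isLevyMeasure.sigmaFinite
  obtain ⟨B, hB⟩ := (isCompact_Icc (a := (0 : ℝ)) (b := 1)).bddAbove_image hχ.norm.continuousOn
  have hB' : ∀ u ∈ Icc (0 : ℝ) 1, ‖χ u‖ ≤ B := fun u hu => hB (mem_image_of_mem _ hu)
  obtain ⟨a', v', M', hv', hM', hΨ⟩ := h.exists_erlangMean_eq a hv
  have hre : ∀ u, (erlangMean k (lkExp a v M) u).re ≤ 0 := fun u => by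
    rw [hΨ]; exact hM'.re_lkExp_nonpos a' hv' u
  have hmM := measurable_lintegral_one_sub_cos M
  have key : ∀ u ∈ Icc (0 : ℝ) 1, ∫⁻ s, ∫⁻ x, ENNReal.ofReal (1 - Real.cos (Real.exp (-s) * u * x)) ∂M
      ∂erlang (k + 1) ≤ ENNReal.ofReal (2 * B) := by
    intro u hu
    refine le_trans ?_ (lintegral_Ioi_neg_re_le (h.continuous_erlangMean a hv) hre hinc hB' hu)
    have hmu : Measurable fun s => ∫⁻ x, ENNReal.ofReal (1 - Real.cos (Real.exp (-s) * u * x)) ∂M :=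
      hmM.comp (by fun_prop : Measurable fun s => Real.exp (-s) * u)
    rw [lintegral_erlang_succ k hmu]
    refine lintegral_mono fun s => le_trans (le_of_eq ?_)
      (h.lintegral_erlang_one_sub_cos_le a hv (Real.exp (-s) * u))
    refine lintegral_congr fun r => ?_
    have : Real.exp (-(s + r)) * u = Real.exp (-r) * (Real.exp (-s) * u) := by
      rw [neg_add, Real.exp_add]; ring
    simp only [this]
  refine ⟨h.1, ?_⟩
  calc ∫⁻ x, ∫⁻ s, ENNReal.ofReal (min 1 (Real.exp (-s) * x ^ 2)) ∂erlang (k + 1) ∂M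
      ≤ ∫⁻ x, ∫⁻ s, 2 ^ (k + 1) * (15 * ∫⁻ u in Ioc (0 : ℝ) 1,
          ENNReal.ofReal (1 - Real.cos (u * (Real.exp (-s) * x)))) ∂erlang (k + 1) ∂M := by
        refine lintegral_mono fun x => ?_
        -- Replacing s by 2s writes the integrand as min(1, (e^{-s}x)²), the form to which the
        -- cosine bound applies.
        refine (lintegral_erlang_le_two_pow_mul (k + 1) (by fun_prop)).trans ?_
        rw [← lintegral_const_mul' _ _ (by finiteness)]
        refine lintegral_mono fun s => ?_
        gcongr
        refine le_trans (le_of_eq ?_) (ofReal_min_one_sq_le (Real.exp (-s) * x))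
        rw [mul_pow, ← Real.exp_nat_mul]
        congr 4
        push_cast; ring
    _ = 2 ^ (k + 1) * 15 * ∫⁻ x, ∫⁻ s, (∫⁻ u in Ioc (0 : ℝ) 1,
          ENNReal.ofReal (1 - Real.cos (Real.exp (-s) * u * x))) ∂erlang (k + 1) ∂M := by
        rw [← lintegral_const_mul' _ _ (by finiteness)]
        refine lintegral_congr fun x => ?_
        rw [← lintegral_const_mul' _ _ (by finiteness)]
        refine lintegral_congr fun s => ?_
        rw [mul_assoc]
        congr 1
        refine congrArg _ (lintegral_congr fun u => ?_)
        rw [← mul_assoc, mul_comm u]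
    _ = 2 ^ (k + 1) * 15 * ∫⁻ u in Ioc (0 : ℝ) 1, ∫⁻ s, ∫⁻ x,
          ENNReal.ofReal (1 - Real.cos (Real.exp (-s) * u * x)) ∂M ∂erlang (k + 1) := by
        congr 1
        have e1 : ∀ x, ∫⁻ s, (∫⁻ u in Ioc (0 : ℝ) 1,
            ENNReal.ofReal (1 - Real.cos (Real.exp (-s) * u * x))) ∂erlang (k + 1) =
            ∫⁻ u in Ioc (0 : ℝ) 1, ∫⁻ s,
            ENNReal.ofReal (1 - Real.cos (Real.exp (-s) * u * x)) ∂erlang (k + 1) := fun x =>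
          lintegral_lintegral_swap (f := fun s u =>
            ENNReal.ofReal (1 - Real.cos (Real.exp (-s) * u * x)))
            (by unfold Function.uncurry; fun_prop)
        simp only [e1]
        rw [lintegral_lintegral_swap]
        · refine lintegral_congr fun u => ?_
          exact lintegral_lintegral_swap (f := fun x s =>
            ENNReal.ofReal (1 - Real.cos (Real.exp (-s) * u * x)))
            (by unfold Function.uncurry; fun_prop)
        · refine Measurable.aemeasurable ?_
          exact Measurable.lintegral_prod_right' (f := fun q : (ℝ × ℝ) × ℝ =>
            ENNReal.ofReal (1 - Real.cos (Real.exp (-q.2) * q.1.2 * q.1.1))) (by fun_prop)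
    _ ≤ 2 ^ (k + 1) * 15 * ∫⁻ u in Ioc (0 : ℝ) 1, ENNReal.ofReal (2 * B) := by
        gcongr 2 ^ (k + 1) * 15 * ?_
        exact setLIntegral_mono' measurableSet_Ioc fun u hu => key u ⟨hu.1.le, hu.2⟩
    _ < ⊤ := by simp; finiteness

/-- A continuous function is determined by its increments along dilations. -/
theorem HasTimeMoment.eq_erlangMean_succ_of_increments {k : ℕ} {M : Measure ℝ}
    (h : HasTimeMoment (k + 1) M) (a : ℝ) {v : ℝ} (hv : 0 ≤ v) {χ : ℝ → ℂ} (hχ : Continuous χ)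
    (hχ0 : χ 0 = 0)
    (hinc : ∀ u T : ℝ, 0 ≤ T → χ u - χ (Real.exp (-T) * u) =
      ∫ s in Ioc (0 : ℝ) T, erlangMean k (lkExp a v M) (Real.exp (-s) * u)) :
    χ = erlangMean (k + 1) (lkExp a v M) := by
  have hE := h.continuous_erlangMean a hv
  set E := erlangMean (k + 1) (lkExp a v M) with hEdef
  have hE0 : E 0 = 0 := erlangMean_zero_right _ (lkExp_zero a v M)
  funext u
  have hc : Continuous fun y => χ y - E y := hχ.sub hE
  have hexp : Tendsto (fun T : ℝ => Real.exp (-T) * u) atTop (𝓝 0) := by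
    simpa using Real.tendsto_exp_neg_atTop_nhds_zero.mul_const u
  have h1 : Tendsto (fun T : ℝ => χ (Real.exp (-T) * u) - E (Real.exp (-T) * u)) atTop (𝓝 0) := by
    have := (hc.tendsto 0).comp hexp
    simpa [hχ0, hE0, Function.comp_def] using this
  have h2 : Tendsto (fun T : ℝ => χ (Real.exp (-T) * u) - E (Real.exp (-T) * u)) atTop (𝓝 (χ u - E u)) := by
    refine tendsto_const_nhds.congr' ?_
    filter_upwards [eventually_ge_atTop 0] with T hT
    have e1 := hinc u T hT
    rw [← h.erlangMean_sub a hv u hT, ← hEdef] at e1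
    linear_combination e1
  exact sub_eq_zero.1 (tendsto_nhds_unique h2 h1)

/-! ### Exponents of multiply selfdecomposable measures -/

theorem exists_cofactors_charFun {ν : Measure ℝ} {χ : ℝ → ℂ} (hχ : IsCharExponent ν χ)
    {p : Measure ℝ → Prop}
    (h : ∀ c : ℝ, 0 < c → c < 1 → ∃ νc : Measure ℝ, p νc ∧
      ∀ u, charFun ν u = charFun ν (c * u) * charFun νc u) :
    ∃ P : ℕ → Measure ℝ, (∀ n, p (P n)) ∧
      ∀ n u, charFun (P n) u = Complex.exp (dilationDiff χ (1 / ((n : ℝ) + 1)) u) := by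
  have h1 : ∀ n : ℕ, ∃ νc : Measure ℝ, p νc ∧
      ∀ u, charFun νc u = Complex.exp (dilationDiff χ (1 / ((n : ℝ) + 1)) u) := by
    intro n
    obtain ⟨νc, hνc, e⟩ := h (Real.exp (-(1 / ((n : ℝ) + 1)))) (Real.exp_pos _) (by
      rw [← Real.exp_zero]
      exact Real.exp_lt_exp.2 (by simp; positivity))
    refine ⟨νc, hνc, fun u => ?_⟩
    have := e u
    rw [hχ.2.2, hχ.2.2] at this
    rw [dilationDiff, Complex.exp_sub, this, mul_div_cancel_left₀ _ (Complex.exp_ne_zero _)]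
  choose P hp hP using h1
  exact ⟨P, hp, hP⟩

/-- The exponent of a measure in `L_k` is an iterated average of a Lévy–Khintchine exponent. -/
theorem IsUrbanik.exists_eq_erlangMean {k : ℕ} {ν : Measure ℝ} (h : IsUrbanik k ν) {χ : ℝ → ℂ}
    (hχ : IsCharExponent ν χ) : ∃ (a v : ℝ) (M : Measure ℝ), 0 ≤ v ∧ HasTimeMoment (k + 1) M ∧
      χ = erlangMean (k + 1) (lkExp a v M) := by
  induction k generalizing ν χ with
  | zero =>
    rw [isUrbanik_zero_iff] at h
    obtain ⟨P, hPp, hP⟩ := exists_cofactors_charFun hχ h.2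
    obtain ⟨a, v, M, hv, hM, φ, hφ, -, hinc⟩ := exists_lkExp_of_cofactors hχ.1 hχ.2.1 hPp hP
    have hM0 := (hasTimeMoment_zero_iff M).2 hM
    rw [← erlangMean_zero_left (lkExp a v M)] at hinc
    have hM1 := hM0.succ_of_increments a hv hχ.1 hinc
    exact ⟨a, v, M, hv, hM1, hM1.eq_erlangMean_succ_of_increments a hv hχ.1 hχ.2.1 hinc⟩
  | succ k ih =>
    rw [isUrbanik_succ_iff] at h
    obtain ⟨P, hPu, hP⟩ := exists_cofactors_charFun hχ h.2
    have hPp := fun n => (hPu n).isProbabilityMeasure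
    obtain ⟨a₀, v₀, M₀, hv₀, hM₀, φ, hφ, hlim, hinc⟩ :=
      exists_lkExp_of_cofactors hχ.1 hχ.2.1 hPp hP
    obtain ⟨μ, hμ, hμc⟩ := isCharFun_exp_lkExp a₀ hv₀ hM₀
    -- The (n+1)-st convolution power of the n-th cofactor stays in the class and has the rescaled
    -- difference as exponent. So μ is a limit, along the subsequence, of members of the class.
    have hμu : IsUrbanik k μ := by
      have hpow : ∀ j u, charFun (_root_.convPower (P (φ j)) (φ j + 1)) u =
          Complex.exp (((φ j : ℝ) + 1 : ℝ) • dilationDiff χ (1 / ((φ j : ℝ) + 1)) u) := by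
        intro j u
        have := hPp (φ j)
        rw [charFun_convPower, hP, ← Complex.exp_nat_mul, Complex.real_smul]
        push_cast
        rfl
      refine isUrbanik_of_tendsto (νn := fun j => _root_.convPower (P (φ j)) (φ j + 1))
        (fun u => ?_) (fun j => (hPu _).convPower _) (fun j u => ?_) fun u => ?_
      · rw [hμc]; exact Complex.exp_ne_zero _
      · rw [hpow]; exact Complex.exp_ne_zero _
      · simp only [hpow]
        rw [hμc]
        exact (Complex.continuous_exp.tendsto _).comp (hlim u)
    obtain ⟨a, v, M, hv, hM, e⟩ := ih hμu
      (χ := lkExp a₀ v₀ M₀) ⟨hM₀.continuous_lkExp _ _, lkExp_zero _ _ _, congrFun hμc⟩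
    rw [e] at hinc
    -- The induction hypothesis for μ gives only the moment of order k + 1; the increments of χ
    -- provide the next one.
    have hM1 := hM.succ_of_increments a hv hχ.1 hinc
    exact ⟨a, v, M, hv, hM1, hM1.eq_erlangMean_succ_of_increments a hv hχ.1 hχ.2.1 hinc⟩

/-! ### The free transform of an iterated average -/

theorem integral_pow_mul_cexp {t : ℝ} (ht : 0 < t) (n : ℕ) :
    IntegrableOn (fun u : ℝ => (u : ℂ) ^ n * Complex.exp (-(t * u))) (Ioi 0) ∧
    ∫ u in Ioi (0 : ℝ), (u : ℂ) ^ n * Complex.exp (-(t * u)) = n.factorial / t ^ (n + 1) := by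
  obtain ⟨h1, h2⟩ := integrableOn_pow_mul_exp n ht
  have e : (fun u : ℝ => (u : ℂ) ^ n * Complex.exp (-(t * u))) =
      fun u : ℝ => ((u ^ n * Real.exp (-(t * u)) : ℝ) : ℂ) := by
    funext u; push_cast; rfl
  rw [e]
  refine ⟨h1.ofReal, ?_⟩
  rw [integral_complex_ofReal, h2]
  push_cast
  rfl

theorem ofReal_add_I_mul_ne_zero {t : ℝ} (ht : 0 < t) (y : ℝ) : (t : ℂ) + Complex.I * y ≠ 0 := by
  intro h
  have := congrArg Complex.re h
  simp at this
  exact ht.ne' this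

theorem integral_lkKernel_mul_cexp {t : ℝ} (ht : 0 < t) (e x : ℝ) :
    ∫ u in Ioi (0 : ℝ), lkKernel (e * -u) x * Complex.exp (-(t * u)) =
      1 / (t + Complex.I * (e * x : ℝ)) - 1 / t + Complex.I * e * x / (1 + x ^ 2) / t ^ 2 := by
  have hre : (-((t : ℂ) + Complex.I * (e * x : ℝ))).re < 0 := by simp [ht]
  obtain ⟨i0, h0⟩ := integral_pow_mul_cexp ht 0
  obtain ⟨i1, h1⟩ := integral_pow_mul_cexp ht 1
  have i2 := integrableOn_exp_mul_complex_Ioi hre 0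
  have h2 := integral_exp_mul_complex_Ioi hre 0
  have i3 := i1.const_mul (Complex.I * e * x / (1 + x ^ 2))
  have i4 : IntegrableOn (fun u : ℝ => Complex.exp (-((t : ℂ) + Complex.I * (e * x : ℝ)) * u) -
      (u : ℂ) ^ 0 * Complex.exp (-(t * u))) (Ioi 0) := i2.sub i0
  have e1 : ∀ u : ℝ, lkKernel (e * -u) x * Complex.exp (-(t * u)) =
      (Complex.exp (-((t : ℂ) + Complex.I * (e * x : ℝ)) * u) - (u : ℂ) ^ 0 * Complex.exp (-(t * u))) +
      (Complex.I * e * x / (1 + x ^ 2)) * ((u : ℂ) ^ 1 * Complex.exp (-(t * u))) := by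
    intro u
    have : Complex.exp (-((t : ℂ) + Complex.I * (e * x : ℝ)) * u) =
        Complex.exp (Complex.I * (e * -u : ℝ) * x) * Complex.exp (-(t * u)) := by
      rw [← Complex.exp_add]; congr 1; push_cast; ring
    rw [this, lkKernel]
    push_cast
    ring
  simp only [e1]
  rw [integral_add i4 i3, integral_sub i2 i0, integral_const_mul, h0, h1, h2]
  simp only [Complex.ofReal_zero, mul_zero, Complex.exp_zero, Nat.factorial_zero, Nat.factorial_one,
    Nat.cast_one, zero_add, pow_one, neg_div_neg_eq]
  ring

theorem integrable_lkKernel_mul_cexp_prod {M κ : Measure ℝ} [SFinite κ] (hκ : ∀ᵐ s ∂κ, 0 ≤ s)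
    (h : ∫⁻ x, ∫⁻ s, ENNReal.ofReal (min 1 (Real.exp (-s) * x ^ 2)) ∂κ ∂M < ⊤) {t : ℝ} (ht : 0 < t) :
    Integrable (fun q : (ℝ × ℝ) × ℝ => lkKernel (Real.exp (-q.1.2) * -q.2) q.1.1 *
      Complex.exp (-(t * q.2))) ((M.prod κ).prod (volume.restrict (Ioi 0))) := by
  have i0 := (integrableOn_pow_mul_exp 0 ht).1
  have i2 := (integrableOn_pow_mul_exp 2 ht).1
  have hu : IntegrableOn (fun u : ℝ => 4 * (u ^ 0 * Real.exp (-(t * u)) + u ^ 2 * Real.exp (-(t * u))))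
      (Ioi 0) := (i0.add i2).const_mul 4
  refine ((integrable_min_prod h).mul_prod hu).mono' ?_ ?_
  · refine Continuous.aestronglyMeasurable (Continuous.mul ?_ (by fun_prop))
    exact continuous_lkKernel.comp
      (by fun_prop : Continuous fun q : (ℝ × ℝ) × ℝ => (Real.exp (-q.1.2) * -q.2, q.1.1))
  · filter_upwards [Measure.quasiMeasurePreserving_fst.ae (ae_prod_nonneg hκ)] with q hq
    have h1 := norm_lkKernel_le (Real.exp_pos (-q.1.2)).le (Real.exp_le_one_iff.2 (by linarith)) (-q.2) q.1.1
    have h2 : ‖Complex.exp (-(t * q.2))‖ = Real.exp (-(t * q.2)) := by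
      rw [Complex.norm_exp]; simp
    rw [norm_mul, h2]
    calc _ ≤ 4 * (1 + (-q.2) ^ 2) * min 1 (Real.exp (-q.1.2) * q.1.1 ^ 2) * Real.exp (-(t * q.2)) := by
          gcongr
      _ = _ := by ring

theorem integral_exp_neg_erlang (k : ℕ) : ∫ s, Real.exp (-s) ∂erlang k = 1 := by
  simpa using integral_erlang_exp k one_pos

theorem polylogSucc_eq (k : ℕ) (z : ℂ) : polylogSucc k z =
    z * ∫ s, (Real.exp (-s) : ℂ) / (1 - z * Real.exp (-s)) ∂erlang (k + 1) := by
  rw [polylogSucc, integral_erlang_succ]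
  congr 1
  refine integral_congr_ae (Eventually.of_forall fun s => ?_)
  simp only [Complex.real_smul]
  push_cast
  ring

/-- Put e = e^{-s} and z = x/(it). The Laplace integral gives it²(1/(t+iex) - 1/t) = it·z·e/(1 -
ze), whose Erlang average is it Li_{k+1}(z) by the integral formula. The compensator contributes
-e·x/(1+x²), and e has mean 1. -/
theorem integral_integral_lkKernel {t : ℝ} (ht : 0 < t) (k : ℕ) (x : ℝ) :
    Complex.I * (t : ℂ) ^ 2 * ∫ s, (∫ u in Ioi (0 : ℝ), lkKernel (Real.exp (-s) * -u) x *
      Complex.exp (-(t * u))) ∂erlang (k + 1) = polylogKernel k t x := by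
  have ht' : (t : ℂ) ≠ 0 := by exact_mod_cast ht.ne'
  have hx := one_add_sq_ne_zero x
  set z : ℂ := x / (Complex.I * t) with hz
  have hden : ∀ s : ℝ, 1 - z * Real.exp (-s) = 1 + Complex.I * ((x * Real.exp (-s) / t : ℝ) : ℂ) := by
    intro s
    rw [hz]
    have := Complex.I_sq
    push_cast
    field_simp [Complex.I_ne_zero]
    linear_combination (-(x : ℂ) * Complex.exp (-(s : ℂ))) * this
  have hden0 : ∀ s : ℝ, 1 - z * Real.exp (-s) ≠ 0 := fun s => by
    rw [hden]
    exact_mod_cast ofReal_add_I_mul_ne_zero one_pos _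
  have hie := integrable_exp_neg_erlang (k + 1)
  have i1 : Integrable (fun s : ℝ => (Real.exp (-s) : ℂ) / (1 - z * Real.exp (-s))) (erlang (k + 1)) := by
    refine hie.mono' (Continuous.aestronglyMeasurable
      (Continuous.div (by fun_prop) (by fun_prop) hden0)) (Eventually.of_forall fun s => ?_)
    rw [norm_div, Complex.norm_real, Real.norm_eq_abs, abs_of_pos (Real.exp_pos _)]
    refine div_le_self (Real.exp_pos _).le ?_
    refine le_trans ?_ (Complex.abs_re_le_norm _)
    rw [hden, Complex.add_re, Complex.one_re, Complex.I_mul_re, Complex.ofReal_im]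
    simp
  have i2 : Integrable (fun s : ℝ => (Real.exp (-s) : ℂ)) (erlang (k + 1)) := hie.ofReal
  have e1 : ∀ s : ℝ, Complex.I * (t : ℂ) ^ 2 * (∫ u in Ioi (0 : ℝ), lkKernel (Real.exp (-s) * -u) x *
      Complex.exp (-(t * u))) = Complex.I * t * z * ((Real.exp (-s) : ℂ) / (1 - z * Real.exp (-s))) -
        (x / (1 + x ^ 2)) * (Real.exp (-s) : ℂ) := by
    intro s
    rw [integral_lkKernel_mul_cexp ht]
    have h1 := ofReal_add_I_mul_ne_zero ht (Real.exp (-s) * x)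
    have h2 : (1 - z * Real.exp (-s)) = (t + Complex.I * ((Real.exp (-s) * x : ℝ) : ℂ)) / t := by
      rw [hden]; push_cast; field_simp
    have h3 : Complex.I * t * z = x := by rw [hz]; field_simp [Complex.I_ne_zero]
    rw [h2, h3]
    push_cast at h1 ⊢
    generalize Complex.exp (-(s : ℂ)) = E at *
    have h4 : 1 / ((t : ℂ) + Complex.I * (E * x)) - 1 / t =
        -(Complex.I * (E * x)) / ((t + Complex.I * (E * x)) * t) := by
      rw [div_sub_div _ _ h1 ht']; congr 1; ring
    rw [h4]
    generalize (t : ℂ) + Complex.I * (E * x) = D at *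
    field_simp
    ring_nf
    simp only [Complex.I_sq]
    ring
  rw [← integral_const_mul]
  simp only [e1]
  rw [integral_sub (i1.const_mul _) (i2.const_mul _), integral_const_mul, integral_const_mul,
    integral_complex_ofReal, integral_exp_neg_erlang, polylogKernel, polylogSucc_eq]
  simp only [Complex.ofReal_one, mul_one]
  ring

theorem HasTimeMoment.integrable_polylogKernel {k : ℕ} {M : Measure ℝ} (h : HasTimeMoment (k + 1) M)
    {t : ℝ} (ht : 0 < t) : Integrable (polylogKernel k t) M := by
  have := h.isLevyMeasure.sigmaFinite
  have h1 := (integrable_lkKernel_mul_cexp_prod (ae_erlang_nonneg (k + 1)) h.2 ht).integral_prod_left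
  refine (h1.integral_prod_left.const_mul (Complex.I * (t : ℂ) ^ 2)).congr
    (Eventually.of_forall fun x => ?_)
  exact integral_integral_lkKernel ht k x

/-- Here the dilation stays on the frequency u and is not moved to x, so no additional drift arises
and a appears unchanged, as (1) requires. -/
theorem HasTimeMoment.erlangMean_eq {k : ℕ} {M : Measure ℝ} (h : HasTimeMoment k M) (a : ℝ) (v u : ℝ) :
    erlangMean k (lkExp a v M) u = Complex.I * u * a - (1 / 2) * (v / 2 ^ k) * u ^ 2 +
      ∫ p : ℝ × ℝ, lkKernel (Real.exp (-p.2) * u) p.1 ∂M.prod (erlang k) := by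
  have := h.isLevyMeasure.sigmaFinite
  have hp := integrable_lkKernel_prod (ae_erlang_nonneg k) h.2 u
  have h2 := integrable_erlang_exp k two_pos
  have i1 : Integrable (fun s : ℝ => (Real.exp (-s) : ℂ)) (erlang k) :=
    (integrable_exp_neg_erlang k).ofReal
  have i2 : Integrable (fun s : ℝ => (Real.exp (-(2 * s)) : ℂ)) (erlang k) := h2.ofReal
  have i3 : Integrable (fun s : ℝ => Complex.I * u * a * (Real.exp (-s) : ℂ) -
      (1 / 2) * v * u ^ 2 * (Real.exp (-(2 * s)) : ℂ)) (erlang k) := (i1.const_mul _).sub (i2.const_mul _)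
  have e : ∀ s : ℝ, lkExp a v M (Real.exp (-s) * u) = Complex.I * u * a * (Real.exp (-s) : ℂ) -
      (1 / 2) * v * u ^ 2 * (Real.exp (-(2 * s)) : ℂ) + ∫ x, lkKernel (Real.exp (-s) * u) x ∂M := by
    intro s
    have : Real.exp (-(2 * s)) = Real.exp (-s) ^ 2 := by rw [← Real.exp_nat_mul]; congr 1; push_cast; ring
    rw [lkExp_eq a v h.1, this]
    push_cast
    ring
  simp only [erlangMean, e]
  rw [integral_add i3 hp.integral_prod_right, integral_sub (i1.const_mul _) (i2.const_mul _),
    integral_const_mul, integral_const_mul, integral_complex_ofReal, integral_complex_ofReal,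
    integral_exp_neg_erlang, integral_erlang_exp k two_pos, integral_prod_symm _ hp]
  push_cast
  ring

/-- The free transform of the exponent of the random integral. -/
theorem HasTimeMoment.free_transform_eq {k : ℕ} {M : Measure ℝ} (h : HasTimeMoment (k + 1) M) (a v : ℝ)
    {t : ℝ} (ht : 0 < t) :
    Complex.I * (t : ℂ) ^ 2 * ∫ u in Ioi (0 : ℝ), erlangMean (k + 1) (lkExp a v M) (-u) *
      Complex.exp (-(t * u)) = levyForm k a v M t := by
  have := h.isLevyMeasure.sigmaFinite
  have ht' : (t : ℂ) ≠ 0 := by exact_mod_cast ht.ne'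
  have hH := integrable_lkKernel_mul_cexp_prod (ae_erlang_nonneg (k + 1)) h.2 ht
  obtain ⟨i1, h1⟩ := integral_pow_mul_cexp ht 1
  obtain ⟨i2, h2⟩ := integral_pow_mul_cexp ht 2
  have i3 := hH.integral_prod_right
  have i4 : IntegrableOn (fun u : ℝ => -(Complex.I * a) * ((u : ℂ) ^ 1 * Complex.exp (-(t * u))) -
      (1 / 2) * (v / 2 ^ (k + 1)) * ((u : ℂ) ^ 2 * Complex.exp (-(t * u)))) (Ioi 0) :=
    (i1.const_mul _).sub (i2.const_mul _)
  have e : ∀ u : ℝ, erlangMean (k + 1) (lkExp a v M) (-u) * Complex.exp (-(t * u)) =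
      (-(Complex.I * a) * ((u : ℂ) ^ 1 * Complex.exp (-(t * u))) -
      (1 / 2) * (v / 2 ^ (k + 1)) * ((u : ℂ) ^ 2 * Complex.exp (-(t * u)))) +
      ∫ p : ℝ × ℝ, lkKernel (Real.exp (-p.2) * -u) p.1 * Complex.exp (-(t * u))
        ∂M.prod (erlang (k + 1)) := by
    intro u
    rw [h.erlangMean_eq, integral_mul_const]
    push_cast
    ring
  have hswap : ∫ u in Ioi (0 : ℝ), (∫ p : ℝ × ℝ, lkKernel (Real.exp (-p.2) * -u) p.1 *
      Complex.exp (-(t * u)) ∂M.prod (erlang (k + 1))) = ∫ x, (∫ s, (∫ u in Ioi (0 : ℝ),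
        lkKernel (Real.exp (-s) * -u) x * Complex.exp (-(t * u))) ∂erlang (k + 1)) ∂M := by
    rw [← integral_prod_symm _ hH, integral_prod _ hH, integral_prod _ hH.integral_prod_left]
  simp only [e]
  rw [integral_add i4 i3, integral_sub (i1.const_mul _) (i2.const_mul _), integral_const_mul,
    integral_const_mul, h1, h2, hswap, mul_add, ← integral_const_mul]
  simp only [integral_integral_lkKernel ht]
  rw [levyForm, setIntegral_compl_zero h.1]
  congr 1
  simp only [Nat.factorial, mul_one, Nat.succ_eq_add_one]
  push_cast
  field_simp
  ring_nf
  simp only [Complex.I_sq, Complex.I_pow_three]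
  ring

/-! ### Passing between the Lévy measure and the finite measure -/

section Weights

variable {k : ℕ} {v : ℝ} {M m : Measure ℝ}

theorem withDensity_logWeight_singleton_zero (hM0 : M {0} = 0) :
    M.withDensity (fun x => ENNReal.ofReal (logWeight k x)) {0} = 0 :=
  withDensity_absolutelyContinuous _ _ hM0

theorem isFiniteMeasure_dirac_add_iff (hM0 : M {0} = 0)
    (hm : m = ENNReal.ofReal v • Measure.dirac 0 +
      M.withDensity (fun x => ENNReal.ofReal (logWeight k x))) :
    IsFiniteMeasure m ↔ IsLevyMeasure M ∧ HasLogMoment k M := by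
  have hu : m univ = ENNReal.ofReal v + ∫⁻ x, ENNReal.ofReal (logWeight k x) ∂M := by
    rw [hm, Measure.add_apply, Measure.smul_apply, withDensity_apply _ MeasurableSet.univ]
    simp
  rw [← lintegral_logWeight_lt_top_iff k hM0]
  refine ⟨fun h => ?_, fun h => ⟨?_⟩⟩
  · have := h.measure_univ_lt_top
    rw [hu, ENNReal.add_lt_top] at this
    exact this.2
  · rw [hu, ENNReal.add_lt_top]
    exact ⟨ENNReal.ofReal_lt_top, h⟩

theorem ae_logWeight_smul_weightedKernel (hM0 : M {0} = 0) (t : ℝ) :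
    (fun x => (ENNReal.ofReal (logWeight k x)).toReal • weightedKernel k t x) =ᵐ[M]
      polylogKernel k t := by
  have h0 : ∀ᵐ x ∂M, x ∈ ({0} : Set ℝ)ᶜ := compl_mem_ae_iff.2 hM0
  filter_upwards [h0] with x (hx : x ≠ 0)
  have hW : (logWeight k x : ℂ) ≠ 0 := by exact_mod_cast (logWeight_pos k hx).ne'
  rw [ENNReal.toReal_ofReal (logWeight_nonneg k x), weightedKernel, if_neg hx, Complex.real_smul]
  field_simp

theorem integrable_weightedKernel_and_levyForm_eq (hv : 0 ≤ v) (h : HasTimeMoment (k + 1) M)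
    (hm : m = ENNReal.ofReal v • Measure.dirac 0 +
      M.withDensity (fun x => ENNReal.ofReal (logWeight k x))) (a : ℝ) {t : ℝ} (ht : 0 < t) :
    Integrable (weightedKernel k t) m ∧ levyForm k a v M t = weightedForm k a m t := by
  have hW := measurable_logWeight k
  have hae := ae_logWeight_smul_weightedKernel (k := k) h.1 t
  have i1 : Integrable (weightedKernel k t) (ENNReal.ofReal v • Measure.dirac 0) :=
    (integrable_dirac (by simp)).smul_measure ENNReal.ofReal_ne_top
  have i2 : Integrable (weightedKernel k t)
      (M.withDensity (fun x => ENNReal.ofReal (logWeight k x))) := by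
    rw [integrable_withDensity_iff_integrable_smul' (by fun_prop) (by simp), integrable_congr hae]
    exact h.integrable_polylogKernel ht
  subst hm
  refine ⟨i1.add_measure i2, ?_⟩
  rw [levyForm, weightedForm, integral_add_measure i1 i2, integral_smul_measure, integral_dirac,
    integral_withDensity_eq_integral_toReal_smul (by fun_prop) (by simp), integral_congr_ae hae,
    setIntegral_compl_zero h.1, ENNReal.toReal_ofReal hv, weightedKernel, if_pos rfl,
    Complex.real_smul]
  ring

theorem eq_dirac_add_withDensity_unweight (k : ℕ) (m : Measure ℝ) [IsFiniteMeasure m] :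
    m = ENNReal.ofReal (m {0}).toReal • Measure.dirac 0 +
      (unweight (logWeight k) m).withDensity (fun x => ENNReal.ofReal (logWeight k x)) := by
  rw [withDensity_unweight (measurable_logWeight k) (fun x hx => logWeight_pos k hx),
    ENNReal.ofReal_toReal (measure_ne_top m _)]
  exact eq_dirac_add_restrict_compl m

end Weights

/-! ### Free counterparts of multiply selfdecomposable measures -/

theorem VoiculescuOnAxis.congr {ρ : Measure ℝ} {f g : ℝ → ℂ} (h : VoiculescuOnAxis ρ f)
    (hfg : ∀ t, 0 < t → f t = g t) : VoiculescuOnAxis ρ g := by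
  obtain ⟨V, hV, e⟩ := h
  exact ⟨V, hV, fun t ht => (e t ht).trans (hfg t ht)⟩

theorem erlangMean_succ_eq (k : ℕ) (ψ : ℝ → ℂ) (u : ℝ) : erlangMean (k + 1) ψ u =
    ∫ s in Ioi (0 : ℝ), ψ (Real.exp (-s) * u) * ((s ^ k / k.factorial : ℝ) : ℂ) := by
  rw [erlangMean, integral_erlang_succ]
  refine integral_congr_ae (Eventually.of_forall fun s => ?_)
  simp only [Complex.real_smul, mul_comm]

/-- Every triple with the right moment is that of the background driving measure of some measure in
`L_k`. -/
theorem HasTimeMoment.exists_randomIntegralLaw {k : ℕ} {M : Measure ℝ} (h : HasTimeMoment (k + 1) M)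
    (a : ℝ) {v : ℝ} (hv : 0 ≤ v) : ∃ μ ν : Measure ℝ, HasLevyTriplet μ a v M ∧
      IsRandomIntegralLaw k μ ν ∧ IsUrbanik k ν ∧ IsInfDivisible ν ∧
      IsCharExponent ν (erlangMean (k + 1) (lkExp a v M)) := by
  have hL := h.isLevyMeasure
  obtain ⟨μ, hμ, hμc⟩ := isCharFun_exp_lkExp a hv hL
  obtain ⟨a', v', M', hv', hM', e⟩ := h.exists_erlangMean_eq a hv
  obtain ⟨ν, hν, hνc⟩ := isCharFun_exp_lkExp a' hv' hM'
  have hχ : IsCharExponent ν (erlangMean (k + 1) (lkExp a v M)) := by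
    refine ⟨h.continuous_erlangMean a hv, erlangMean_zero_right _ (lkExp_zero a v M), fun u => ?_⟩
    rw [e, hνc]
  refine ⟨μ, ν, ⟨hμ, hv, hL, congrFun hμc⟩, ⟨hμ, hν, lkExp a v M, _,
    ⟨hL.continuous_lkExp a v, lkExp_zero a v M, congrFun hμc⟩, hχ, fun u => ⟨?_, ?_⟩⟩,
    isUrbanik_of_charFun_eq hv h hν hχ.2.2, isInfDivisible_of_charFun_eq hv' hM' hν (congrFun hνc), hχ⟩
  · refine ((integrable_erlang_succ_iff k _).1 (h.integrable_erlang a hv u)).congr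
      (Eventually.of_forall fun s => ?_)
    simp only [Complex.real_smul, mul_comm]
  · exact erlangMean_succ_eq k _ u

theorem IsRandomIntegralLaw.isCharExponent {k : ℕ} {μ ν : Measure ℝ} {a v : ℝ} {M : Measure ℝ}
    (h : IsRandomIntegralLaw k μ ν) (hμ : HasLevyTriplet μ a v M) :
    IsCharExponent ν (erlangMean (k + 1) (lkExp a v M)) := by
  obtain ⟨-, -, ψ, χ, hψ, hχ, e⟩ := h
  have h1 : IsCharExponent μ (lkExp a v M) :=
    ⟨hμ.2.2.1.continuous_lkExp a v, lkExp_zero a v M, hμ.2.2.2⟩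
  have h2 : χ = erlangMean (k + 1) (lkExp a v M) := by
    funext u
    rw [(e u).2, ← hψ.unique h1, erlangMean_succ_eq]
  rwa [← h2]

/-- The continuous logarithm is unique, so the exponent in the definition of the counterpart must be
the given iterated average, whose free transform is known. -/
theorem isFreeCounterpart_iff_levyForm {k : ℕ} {ρ ν : Measure ℝ} {a v : ℝ} {M : Measure ℝ}
    (h : HasTimeMoment (k + 1) M) (hχ : IsCharExponent ν (erlangMean (k + 1) (lkExp a v M))) :
    IsFreeCounterpart ρ ν ↔ IsInfDivisible ν ∧ VoiculescuOnAxis ρ (levyForm k a v M) := by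
  refine and_congr_right fun hν => ⟨?_, fun hV => ⟨_, hχ, ?_⟩⟩
  · rintro ⟨ψ, hψ, hV⟩
    rw [hψ.unique hχ] at hV
    exact hV.congr fun t ht => h.free_transform_eq a v ht
  · exact hV.congr fun t ht => (h.free_transform_eq a v ht).symm

theorem exists_randomIntegralLaw_iff_levyForm {k : ℕ} {a v : ℝ} {M : Measure ℝ} (hv : 0 ≤ v)
    (h : HasTimeMoment (k + 1) M) (ρ : Measure ℝ) :
    (∃ μ ν : Measure ℝ, HasLevyTriplet μ a v M ∧ IsRandomIntegralLaw k μ ν ∧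
      IsUrbanik k ν ∧ IsFreeCounterpart ρ ν) ↔ VoiculescuOnAxis ρ (levyForm k a v M) := by
  constructor
  · rintro ⟨μ, ν, hμ, hν, -, hρ⟩
    exact ((isFreeCounterpart_iff_levyForm h (hν.isCharExponent hμ)).1 hρ).2
  · intro hV
    obtain ⟨μ, ν, h1, h2, h3, h4, h5⟩ := h.exists_randomIntegralLaw a hv
    exact ⟨μ, ν, h1, h2, h3, (isFreeCounterpart_iff_levyForm h h5).2 ⟨h4, hV⟩⟩

/-- Being a free counterpart already supplies the exponent and the infinite divisibility of ν, so
the first direction needs only the description of exponents of measures in L_k. Conversely, ν is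
constructed from the triple. -/
theorem exists_isUrbanik_iff_levyForm (k : ℕ) (ρ : Measure ℝ) :
    (∃ ν : Measure ℝ, IsUrbanik k ν ∧ IsFreeCounterpart ρ ν) ↔
      ∃ (a v : ℝ) (M : Measure ℝ), 0 ≤ v ∧ IsLevyMeasure M ∧ HasLogMoment k M ∧
        VoiculescuOnAxis ρ (levyForm k a v M) := by
  constructor
  · rintro ⟨ν, hν, hρ⟩
    obtain ⟨-, ψ, hψ, -⟩ := id hρ
    obtain ⟨a, v, M, hv, h, rfl⟩ := hν.exists_eq_erlangMean hψ
    obtain ⟨hL, hlog⟩ := (hasTimeMoment_succ_iff k h.1).1 h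
    exact ⟨a, v, M, hv, hL, hlog, ((isFreeCounterpart_iff_levyForm h hψ).1 hρ).2⟩
  · rintro ⟨a, v, M, hv, hL, hlog, hV⟩
    obtain ⟨μ, ν, -, -, h3, h4⟩ := (exists_randomIntegralLaw_iff_levyForm hv
      ((hasTimeMoment_succ_iff k hL.1).2 ⟨hL, hlog⟩) ρ).2 hV
    exact ⟨ν, h3, h4⟩

theorem exists_levyForm_iff_weightedForm (k : ℕ) (ρ : Measure ℝ) :
    (∃ (a v : ℝ) (M : Measure ℝ), 0 ≤ v ∧ IsLevyMeasure M ∧ HasLogMoment k M ∧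
        VoiculescuOnAxis ρ (levyForm k a v M)) ↔
      ∃ (a : ℝ) (m : Measure ℝ), IsFiniteMeasure m ∧ VoiculescuOnAxis ρ (weightedForm k a m) := by
  constructor
  · rintro ⟨a, v, M, hv, hL, hlog, hV⟩
    have h := (hasTimeMoment_succ_iff k hL.1).2 ⟨hL, hlog⟩
    exact ⟨a, _, (isFiniteMeasure_dirac_add_iff hL.1 rfl).2 ⟨hL, hlog⟩,
      hV.congr fun t ht => (integrable_weightedKernel_and_levyForm_eq hv h rfl a ht).2⟩
  · rintro ⟨a, m, hfin, hV⟩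
    have hm := eq_dirac_add_withDensity_unweight k m
    have hM0 := unweight_singleton_zero (logWeight k) m
    have hL := (isFiniteMeasure_dirac_add_iff hM0 hm).1 hfin
    have h := (hasTimeMoment_succ_iff k hM0).2 hL
    exact ⟨a, _, _, ENNReal.toReal_nonneg, hL.1, hL.2, hV.congr fun t ht =>
      (integrable_weightedKernel_and_levyForm_eq ENNReal.toReal_nonneg h hm a ht).2.symm⟩

end

theorem proposition3 (k : ℕ) :
    -- the free counterparts of measures in `L_k`, in terms of a Lévy measure, and of a finite one
    (∀ ρ : Measure ℝ, IsProbabilityMeasure ρ →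
      ((∃ ν : Measure ℝ, IsUrbanik k ν ∧ IsFreeCounterpart ρ ν) ↔
        ∃ (a v : ℝ) (M : Measure ℝ), 0 ≤ v ∧ IsLevyMeasure M ∧ HasLogMoment k M ∧
          VoiculescuOnAxis ρ (levyForm k a v M)) ∧
      ((∃ ν : Measure ℝ, IsUrbanik k ν ∧ IsFreeCounterpart ρ ν) ↔
        ∃ (a : ℝ) (m : Measure ℝ), IsFiniteMeasure m ∧
          VoiculescuOnAxis ρ (weightedForm k a m))) ∧
    -- the parameters are those of the background driving measure `μ = [a, v, M]` of `ν`
    (∀ (a v : ℝ) (M : Measure ℝ), 0 ≤ v → IsLevyMeasure M → HasLogMoment k M →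
      ∀ ρ : Measure ℝ, IsProbabilityMeasure ρ →
        ((∃ μ ν : Measure ℝ, HasLevyTriplet μ a v M ∧ IsRandomIntegralLaw k μ ν ∧
            IsUrbanik k ν ∧ IsFreeCounterpart ρ ν) ↔
          VoiculescuOnAxis ρ (levyForm k a v M))) ∧
    -- the two representations correspond to each other, and all their integrals converge
    (∀ (a v : ℝ) (M m : Measure ℝ), 0 ≤ v → M {0} = 0 →
      m = ENNReal.ofReal v • Measure.dirac 0 +
        M.withDensity (fun x => ENNReal.ofReal (logWeight k x)) →
      m {0} = ENNReal.ofReal v ∧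
      ((IsLevyMeasure M ∧ HasLogMoment k M) ↔ IsFiniteMeasure m) ∧
      (IsFiniteMeasure m → ∀ t : ℝ, 0 < t →
        IntegrableOn (polylogKernel k t) ({0} : Set ℝ)ᶜ M ∧ Integrable (weightedKernel k t) m ∧
        levyForm k a v M t = weightedForm k a m t)) := by
  refine ⟨fun ρ _ => ⟨exists_isUrbanik_iff_levyForm k ρ, ?_⟩,
    fun a v M hv hL hlog ρ _ => exists_randomIntegralLaw_iff_levyForm hv
      ((hasTimeMoment_succ_iff k hL.1).2 ⟨hL, hlog⟩) ρ,
    fun a v M m hv hM0 hm => ⟨?_, (isFiniteMeasure_dirac_add_iff hM0 hm).symm, fun hfin t ht => ?_⟩⟩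
  · rw [exists_isUrbanik_iff_levyForm, exists_levyForm_iff_weightedForm]
  · rw [hm, Measure.add_apply, withDensity_logWeight_singleton_zero hM0]
    simp
  · have h := (hasTimeMoment_succ_iff k hM0).2 ((isFiniteMeasure_dirac_add_iff hM0 hm).1 hfin)
    exact ⟨(h.integrable_polylogKernel ht).integrableOn,
      integrable_weightedKernel_and_levyForm_eq hv h hm a ht⟩
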